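/- **Setting.** For $n\ge 1$, let $\mathrm{GOE}(n)$ be the law of the symmetric $n\times n$ matrix $\mathbf X$ with zero diagonal whose entries $\mathbf X_{ij}$, $i<j$, are i.i.d. $\mathcal N(0,1/n)$. For $0<d<n$, let $\mathcal G(n,d/n)$ be the law of the symmetric matrix $\mathbf Y$ with zero diagonal and, for $i<j$, $$\mathbf Y_{ij}=-\frac{1}{\sqrt{d(1-d/n)}}\Big(B_{ij}-\frac dn\Big),$$ where the $B_{ij}$ are i.i.d., equal to $1$ with probability $d/n$ and to $0$ with probability $1-d/n$. A monomial $\mathbf x^{\alpha}=\prod_{i<j}\mathbf x_{ij}^{\alpha_{ij}}$ has the factor graph $G_\alpha$ whose edges are the pairs $\{i,j\}$ with $\alpha_{ij}>0$ and whose nodes are the endpoints of these edges. The monomial is a tree if $G_\alpha$ is a tree, and contains the node $k$ if $k$ is a node of $G_\alpha$; by convention the constant monomial is a tree and contains every node. For $\Delta\in\mathbb N$, $\mathcal T_{n,2,\Delta}$ is the set of real polynomials in $(\mathbf x_{ij})_{1\le i<j\le n}$ all of whose monomials (those with non-zero coefficient) are trees, have total degree at most $\Delta$, and have degree at most $2$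 in every variable. Write $k\in q$ if all monomials of $q$ contain $k$, and let $\|q\|$ be the largest absolute value of a coefficient of $q$. For a symmetric matrix $A$ with zero diagonal and $v\in\mathbb R^n$, a rounding $\sigma(v,A)\in\{\pm1\}^n$ is obtained by truncating the coordinates of $v$ to $[-1,1]$ and then sequentially replacing coordinates in $(-1,1)$ by $1$ or $-1$ so that the value of $w\mapsto w^\top A w$ does not decrease at any step, until all coordinates are $\pm1$. The order of the replacements and the choice among admissible values are arbitrary. Let $\mathrm{dist}$ be the Euclidean distance. We write $\operatorname{p-lim} Z=a$ if $\mathbb P(|Z-a|>\epsilon)\to0$ for every $\epsilon>0$, and $\operatorname{p-lim} Z\ge a$ if $\mathbb P(Z<a-\epsilon)\to 0$ for every $\epsilon>0$. The limit $d,n\to\infty$ is the joint limit $n\to\infty$, $d\to\infty$, $d/n\to0$, where $d$ is real (in particular, it covers the iterated limit, first $n\to\infty$ with $d$ fixed and then $d\to\infty$). **Theorem.** Let $\Delta\in\mathbb N$ and $c,\mathcal P\in\mathbb R$ be constants independent of $n$, and for every $n$ let $p=(p_i)_{i\in[n]}$ be a vector of polynomials with $p_i\in\mathcal T_{n,2,\Delta}$,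 $\|p_i\|\le c$ and $i\in p_i$ for all $i\in[n]$. Suppose that, for $\mathbf X\sim\mathrm{GOE}(n)$, $$\operatorname*{p-lim}_{n\to\infty}\frac1{2n}p(\mathbf X)^\top\mathbf X\,p(\mathbf X)\ge\mathcal P,\qquad \operatorname*{p-lim}_{n\to\infty}\frac{\mathrm{dist}(p(\mathbf X),[-1,1]^n)}{\sqrt n}=0 .$$ Then, for $\mathbf Y\sim\mathcal G(n,d/n)$, $$\operatorname*{p-lim}_{d,n\to\infty}\frac1{2n}p(\mathbf Y)^\top\mathbf Y\,p(\mathbf Y)\ge\mathcal P,\qquad \operatorname*{p-lim}_{d,n\to\infty}\frac{\mathrm{dist}(p(\mathbf Y),[-1,1]^n)}{\sqrt n}=0 ,$$ and, for every choice of the rounding $\sigma$, $$\operatorname*{p-lim}_{d,n\to\infty}\frac1{2n}\sigma(p(\mathbf Y),\mathbf Y)^\top\mathbf Y\,\sigma(p(\mathbf Y),\mathbf Y)\ge\mathcal P .$$ -/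

import Mathlib

open MeasureTheory ProbabilityTheory Filter Topology
open scoped NNReal ENNReal

noncomputable section

/-- The pairs `i < j` of nodes: positions of the entries strictly above the diagonal. -/
abbrev Edge (n : ℕ) : Type := {e : Fin n × Fin n // e.1 < e.2}

/-! ### Disorder matrices -/

/-- The symmetric matrix with zero diagonal whose entries above the diagonal are `x`. -/
def symMatrix {n : ℕ} (x : Edge n → ℝ) : Matrix (Fin n) (Fin n) ℝ :=
  Matrix.of fun i j =>
    if h : i < j then x ⟨(i, j), h⟩ else if h : j < i then x ⟨(j, i), h⟩ else 0

/-- The law `GOE(n)` (with null diagonal), given through the entries above the diagonal: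
they are independent centred Gaussian variables of variance `1 / n`. -/
def goeLaw (n : ℕ) : Measure (Edge n → ℝ) :=
  Measure.pi fun _ => gaussianReal 0 (n : ℝ≥0)⁻¹

/-- The centred and rescaled value of an entry `b ∈ {0, 1}` of the adjacency matrix. -/
def rescaledEntry (n : ℕ) (d b : ℝ) : ℝ :=
  -(1 / √(d * (1 - d / n))) * (b - d / n)

/-- The law of `rescaledEntry n d B`, where `B` is `1` with probability `d / n` and `0` with
probability `1 - d / n`; it is meant for `0 < d < n`. -/
def sparseEntryLaw (n : ℕ) (d : ℝ) : Measure ℝ :=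
  ENNReal.ofReal (d / n) • Measure.dirac (rescaledEntry n d 1) +
    ENNReal.ofReal (1 - d / n) • Measure.dirac (rescaledEntry n d 0)

/-- The law of the centred and rescaled adjacency matrix of the Erdős–Rényi graph with edge
probability `d / n`, given through the (independent) entries above the diagonal. -/
def sparseLaw (n : ℕ) (d : ℝ) : Measure (Edge n → ℝ) :=
  Measure.pi fun _ => sparseEntryLaw n d

/-- The double limit `n → ∞`, `d → ∞` in the sparse regime `d / n → 0`, as a filter on the
pairs `(n, d)`.  It contains the iterated limit (first `n → ∞` with `d` fixed, then `d → ∞`) as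
well as every choice `d = d(n) → ∞` with `d(n) = o(n)`. -/
def sparseLimit : Filter (ℕ × ℝ) :=
  (atTop ×ˢ atTop) ⊓ comap (fun q : ℕ × ℝ => q.2 / (q.1 : ℝ)) (𝓝 0)

/-! ### Limits in probability -/

/-- `p-lim f = c`: for every `ε > 0` the probability of `|f - c| > ε` tends to zero. -/
def PLimEq {ι : Type} {α : ι → Type} [∀ i, MeasurableSpace (α i)] (l : Filter ι)
    (μ : ∀ i, Measure (α i)) (f : ∀ i, α i → ℝ) (c : ℝ) : Prop :=
  ∀ ε : ℝ, 0 < ε → Tendsto (fun i => μ i {x | ε < |f i x - c|}) l (𝓝 0)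

/-- `p-lim f ≥ c`: for every `ε > 0` the probability of `f < c - ε` tends to zero. -/
def PLimGe {ι : Type} {α : ι → Type} [∀ i, MeasurableSpace (α i)] (l : Filter ι)
    (μ : ∀ i, Measure (α i)) (f : ∀ i, α i → ℝ) (c : ℝ) : Prop :=
  ∀ ε : ℝ, 0 < ε → Tendsto (fun i => μ i {x | f i x < c - ε}) l (𝓝 0)

/-! ### Tree polynomials

An exponent `α : Edge n →₀ ℕ` is a strictly upper triangular matrix of natural numbers. -/

/-- The factor graph of the monomial with exponent `α`, as a graph on all of `Fin n`: the edges
are the pairs with positive exponent. -/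
def factorGraph {n : ℕ} (α : Edge n →₀ ℕ) : SimpleGraph (Fin n) :=
  SimpleGraph.fromRel fun i j => ∃ h : i < j, 0 < α ⟨(i, j), h⟩

/-- The monomial with exponent `α` contains the node `k`: the node `k` is incident to an edge of
the factor graph.  By convention the constant monomial contains every node. -/
def ContainsNode {n : ℕ} (k : Fin n) (α : Edge n →₀ ℕ) : Prop :=
  α = 0 ∨ k ∈ (factorGraph α).support

/-- The monomial with exponent `α` is a tree: the factor graph, on the set of the nodes that are
incident to one of its edges, is a tree.  By convention the constant monomial is a tree. -/
def IsTreeMonomial {n : ℕ} (α : Edge n →₀ ℕ) : Prop :=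
  α = 0 ∨ ((factorGraph α).induce (factorGraph α).support).IsTree

/-- `p` is a tree polynomial of total degree at most `Δ` in which every variable has degree at
most `2` in every monomial. -/
def IsTreePoly {n : ℕ} (Δ : ℕ) (p : MvPolynomial (Edge n) ℝ) : Prop :=
  ∀ α ∈ p.support, IsTreeMonomial α ∧ (∀ e, α e ≤ 2) ∧ (α.sum fun _ m => m) ≤ Δ

/-- The largest absolute value of a coefficient of `p`. -/
def coeffNorm {n : ℕ} (p : MvPolynomial (Edge n) ℝ) : ℝ≥0 :=
  p.support.sup fun α => ‖p.coeff α‖₊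

/-- `k ∈ p`: all monomials of `p` contain the node `k`. -/
def PolyContains {n : ℕ} (k : Fin n) (p : MvPolynomial (Edge n) ℝ) : Prop :=
  ∀ α ∈ p.support, ContainsNode k α

/-- The vector of values of a vector of polynomials. -/
def evalVec {n : ℕ} (p : Fin n → MvPolynomial (Edge n) ℝ) (x : Edge n → ℝ) : Fin n → ℝ :=
  fun i => MvPolynomial.eval x (p i)

/-! ### The objective, the distance to the cube, and the rounding -/

/-- The quadratic form `vᵀ A v`. -/
def quad {n : ℕ} (A : Matrix (Fin n) (Fin n) ℝ) (v : Fin n → ℝ) : ℝ :=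
  v ⬝ᵥ A.mulVec v

/-- The normalized objective `vᵀ A v / (2 n)`. -/
def objective {n : ℕ} (A : Matrix (Fin n) (Fin n) ℝ) (v : Fin n → ℝ) : ℝ :=
  1 / (2 * (n : ℝ)) * quad A v

/-- The Euclidean distance of `v` to the cube `[-1, 1]ⁿ`. -/
def distCube {n : ℕ} (v : Fin n → ℝ) : ℝ :=
  Metric.infDist (WithLp.toLp 2 v : EuclideanSpace ℝ (Fin n))
    {w | ∀ i, w i ∈ Set.Icc (-1 : ℝ) 1}

/-- Coordinatewise truncation to `[-1, 1]`. -/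
def clip {n : ℕ} (v : Fin n → ℝ) : Fin n → ℝ :=
  fun i => min 1 (max (-1) (v i))

/-- One step of the rounding: a coordinate in `(-1, 1)` is replaced by `1` or `-1` in such a way
that the quadratic form does not decrease. -/
def RoundingStep {n : ℕ} (A : Matrix (Fin n) (Fin n) ℝ) (v w : Fin n → ℝ) : Prop :=
  ∃ (i : Fin n) (s : ℝ), v i ∈ Set.Ioo (-1 : ℝ) 1 ∧ (s = 1 ∨ s = -1) ∧
    w = Function.update v i s ∧ quad A v ≤ quad A w

/-- `w ∈ {1, -1}ⁿ` is a result of truncating `v` to the cube and then rounding sequentially. -/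
def IsRounding {n : ℕ} (A : Matrix (Fin n) (Fin n) ℝ) (v w : Fin n → ℝ) : Prop :=
  Relation.ReflTransGen (RoundingStep A) (clip v) w ∧ ∀ i, w i = 1 ∨ w i = -1

/-- `σ` is a rounding operator: it returns, for every symmetric matrix with zero diagonal, a result
of the sequential rounding.  The order of the coordinates and the choice between several
admissible values are left to `σ`. -/
def IsRoundingOperator
    (σ : ∀ n : ℕ, (Fin n → ℝ) → Matrix (Fin n) (Fin n) ℝ → (Fin n → ℝ)) : Prop :=
  ∀ (n : ℕ) (v : Fin n → ℝ) (A : Matrix (Fin n) (Fin n) ℝ),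
    A.IsSymm → (∀ i, A i i = 0) → IsRounding A v (σ n v A)

/-- If the diagonal vanishes, the quadratic form is affine in every coordinate. -/
theorem quad_update {n : ℕ} (A : Matrix (Fin n) (Fin n) ℝ) (hA : ∀ i, A i i = 0)
    (v : Fin n → ℝ) (i : Fin n) (s : ℝ) :
    quad A (Function.update v i s) =
      quad A v + (s - v i) * (A.mulVec v i + Matrix.vecMul v A i) := by
  have h : Function.update v i s = v + (s - v i) • Pi.single i (1 : ℝ) := by
    ext j
    by_cases hj : j = i
    · subst hj; simp
    · simp [hj]
  rw [h]
  simp only [quad, Matrix.mulVec_add, Matrix.mulVec_smul, add_dotProduct, dotProduct_add,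
    smul_dotProduct, dotProduct_smul, smul_eq_mul]
  have h1 : (Pi.single i (1:ℝ)) ⬝ᵥ A.mulVec v = A.mulVec v i := by simp
  have h2 : v ⬝ᵥ A.mulVec (Pi.single i (1:ℝ)) = Matrix.vecMul v A i := by
    rw [Matrix.dotProduct_mulVec]; simp
  have h3 : (Pi.single i (1:ℝ)) ⬝ᵥ A.mulVec (Pi.single i (1:ℝ)) = 0 := by
    simp [hA]
  rw [h1, h2, h3]; ring

/-- If the diagonal vanishes, the sequential rounding can always be carried out. -/
theorem exists_isRounding {n : ℕ} (A : Matrix (Fin n) (Fin n) ℝ) (hA : ∀ i, A i i = 0)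
    (v : Fin n → ℝ) : ∃ w, IsRounding A v w := by
  classical
  have key : ∀ (k : ℕ) (u : Fin n → ℝ), (∀ i, -1 ≤ u i ∧ u i ≤ 1) →
      (Finset.univ.filter fun i => u i ∈ Set.Ioo (-1 : ℝ) 1).card = k →
      ∃ w, Relation.ReflTransGen (RoundingStep A) u w ∧ ∀ i, w i = 1 ∨ w i = -1 := by
    intro k
    induction k using Nat.strong_induction_on with
    | _ k ih =>
    intro u hu hk
    by_cases hall : ∀ i, u i = 1 ∨ u i = -1
    · exact ⟨u, .refl, hall⟩
    push Not at hall
    obtain ⟨i, hi1, hi2⟩ := hall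
    have hi : u i ∈ Set.Ioo (-1 : ℝ) 1 :=
      ⟨lt_of_le_of_ne (hu i).1 (Ne.symm hi2), lt_of_le_of_ne (hu i).2 hi1⟩
    obtain ⟨s, hs, hq⟩ : ∃ s : ℝ, (s = 1 ∨ s = -1) ∧
        quad A u ≤ quad A (Function.update u i s) := by
      by_cases hL : 0 ≤ A.mulVec u i + Matrix.vecMul u A i
      · refine ⟨1, .inl rfl, ?_⟩
        rw [quad_update A hA]
        have := mul_nonneg (sub_nonneg.2 hi.2.le) hL
        linarith
      · refine ⟨-1, .inr rfl, ?_⟩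
        rw [quad_update A hA]
        have := mul_nonneg (sub_nonneg.2 hi.1.le) (neg_nonneg.2 (not_le.1 hL).le)
        linarith
    have hs' : s ∉ Set.Ioo (-1 : ℝ) 1 := by
      rcases hs with rfl | rfl <;> simp
    obtain ⟨w, hw, hw'⟩ := ih _ (by
      rw [← hk]
      apply Finset.card_lt_card
      rw [Finset.ssubset_iff_of_subset]
      · exact ⟨i, by simpa using hi, by simpa using hs'⟩
      · intro j hj
        by_cases hji : j = i
        · subst hji; simp at hj; exact absurd hj (by simpa using hs')
        · simpa [hji] using hj) (Function.update u i s) (by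
      intro j
      by_cases hji : j = i
      · subst hji; rcases hs with rfl | rfl <;> simp
      · simpa [hji] using hu j) rfl
    exact ⟨w, .head ⟨i, s, hi, hs, rfl, hq⟩ hw, hw'⟩
  obtain ⟨w, hw, hw'⟩ := key _ (clip v) (fun i => by simp [clip]) rfl
  exact ⟨w, hw, hw'⟩

/-- Rounding operators exist. -/
theorem exists_isRoundingOperator : ∃ σ, IsRoundingOperator σ := by
  classical
  refine ⟨fun n v A => if h : ∀ i, A i i = 0 then (exists_isRounding A h v).choose else v, ?_⟩
  intro n v A _ h
  simp only [h, implies_true, dif_pos]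
  exact (exists_isRounding A h v).choose_spec

end

noncomputable section

/-! The theorem is an invariance principle, followed by an argument that rounding costs little.

Invariance. The `p_i` and the objective are polynomials in the edge variables, and the Gaussian
entries are replaced by sparse ones one at a time, after Lindeberg. Both entry laws have mean 0,
variance 1/n, and moments of order at least 3 of size at most K/(√d n). A Taylor expansion of a
smooth bounded test function therefore bounds the cost of one replacement by K/√d times 1/n times
moments of the coefficients of the powers of the replaced variable (`abs_resample_le`). It remains
to see that these influences, summed over all of the order of n² edges, stay bounded; the total
error is then O(1/√d).

Counting. The expectation of a monomial is at most (K/n)^k if it involves k distinct edges, while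
only O(n^k) connected sets of k edges pass through a given node. The two powers of n cancel
(`LinkedFamily.sum_weight_le`). The monomials of `p_i` are connected to i, and since i is in `p_i`
and j is in `p_j`, the monomials of x_ij p_i p_j are connected as well. The influence of e only
involves tuples of monomials that all contain e, so their union is connected even if their roots
differ (`LinkedFamily.sum_sliceBound_le`). Exponents of at least 3 leave a first order term in the
expansion. It is absent for `p_i`, whose exponents are at most 2; for the objective it is paid for
by coefficients of order 1/n.

Transfer. A smooth step function carries over the bound for the objective. For the distance to the
cube, a bounded smooth indicator of large coordinates is transferred and combined with a fourth
moment bound; this yields convergence of the mean squared distance (`tendsto_integral_avgExcess`).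

Rounding. The sequential steps never decrease the form, so only the truncation to the cube has to be
controlled. Nodes of large degree make the operator norm of the sparse matrix unbounded when d grows
slowly, so the displacement is split at the level M = d^(1/8) (`quad_sub_quad`). Beyond M, moment
bounds suffice. The part with entries of size at most M is handled by a net of integer vectors,
Chernoff's bound and a union bound (`sparseLaw_admissiblePair_le`). -/

/-! ### Connected sets of edges -/

/-- The edge set `U` is connected, and contains the node `r` unless it is empty: every set of
nodes that contains `r` and is closed under adjacency contains all end points of `U`. -/
def Linked {n : ℕ} (r : Fin n) (U : Finset (Edge n)) : Prop :=
  ∀ W : Set (Fin n), r ∈ W → (∀ e ∈ U, e.1.1 ∈ W ↔ e.1.2 ∈ W) → ∀ e ∈ U, e.1.1 ∈ W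

/-- The end points of `U` together with `r`. -/
def nodesFrom {n : ℕ} (r : Fin n) (U : Finset (Edge n)) : Finset (Fin n) :=
  insert r (U.image (fun e => e.1.1) ∪ U.image fun e => e.1.2)

section Linked

variable {n : ℕ} {r r' : Fin n} {U U' : Finset (Edge n)} {e : Edge n}

theorem mem_nodesFrom {v : Fin n} :
    v ∈ nodesFrom r U ↔ v = r ∨ ∃ e ∈ U, v = e.1.1 ∨ v = e.1.2 := by
  simp only [nodesFrom, Finset.mem_insert, Finset.mem_union, Finset.mem_image]
  grind

theorem card_nodesFrom_le (r : Fin n) (U : Finset (Edge n)) :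
    (nodesFrom r U).card ≤ 2 * U.card + 1 := by
  have h1 := Finset.card_insert_le r (U.image (fun e => e.1.1) ∪ U.image fun e => e.1.2)
  have h2 := Finset.card_union_le (U.image fun e => e.1.1) (U.image fun e => e.1.2)
  have h3 := Finset.card_image_le (s := U) (f := fun e => e.1.1)
  have h4 := Finset.card_image_le (s := U) (f := fun e => e.1.2)
  unfold nodesFrom
  omega

theorem linked_empty (r : Fin n) : Linked r ∅ := fun _ _ _ e he => by simp at he

theorem Linked.mem_of_mem_nodesFrom (hU : Linked r U) {W : Set (Fin n)} (hr : r ∈ W)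
    (hW : ∀ e ∈ U, e.1.1 ∈ W ↔ e.1.2 ∈ W) {v : Fin n} (hv : v ∈ nodesFrom r U) : v ∈ W := by
  rcases mem_nodesFrom.1 hv with rfl | ⟨e, he, rfl | rfl⟩
  · exact hr
  · exact hU W hr hW e he
  · exact (hW e he).1 (hU W hr hW e he)

theorem Linked.union (hU : Linked r U) (hU' : Linked r' U') (h : r' ∈ nodesFrom r U) :
    Linked r (U ∪ U') := by
  intro W hr hW e he
  have h1 : ∀ e ∈ U, e.1.1 ∈ W ↔ e.1.2 ∈ W := fun e he => hW e (Finset.mem_union_left _ he)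
  have h2 : ∀ e ∈ U', e.1.1 ∈ W ↔ e.1.2 ∈ W := fun e he => hW e (Finset.mem_union_right _ he)
  rcases Finset.mem_union.1 he with he | he
  · exact hU W hr h1 e he
  · exact hU' W (hU.mem_of_mem_nodesFrom hr h1 h) h2 e he

theorem linked_singleton_left (e : Edge n) : Linked e.1.1 {e} := by
  intro W hr _ f hf
  rw [Finset.mem_singleton.1 hf]
  exact hr

theorem linked_singleton_right (e : Edge n) : Linked e.1.2 {e} := by
  intro W hr hW f hf
  rw [Finset.mem_singleton.1 hf]
  exact (hW e (by simp)).2 hr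

/-- The closedness condition is invariant under complements: if a closed set misses some edge of
`U`, it misses the root, and then its complement contains the root and hence every edge. -/
theorem Linked.reroot (hU : Linked r U) (he : e ∈ U) : Linked e.1.1 U := by
  intro W hW1 hW f hf
  by_contra hfW
  have hr : r ∉ W := fun hr => hfW (hU W hr hW f hf)
  exact hU Wᶜ hr (fun g hg => not_congr (hW g hg)) e he hW1

theorem linked_biUnion {ι : Type*} {T : Finset ι} {V : ι → Finset (Edge n)}
    (h : ∀ j ∈ T, Linked r (V j)) : Linked r (T.biUnion V) := by
  intro W hr hW e he
  obtain ⟨j, hj, hej⟩ := Finset.mem_biUnion.1 he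
  exact h j hj W hr (fun f hf => hW f (Finset.mem_biUnion.2 ⟨j, hj, hf⟩)) e hej

/-- All members share the edge `e`, so they can be re-rooted at an end point of `e`; a single member
then ties the union to `r`. This is what makes tuples of monomials with different roots connected.
-/
theorem linked_biUnion_of_mem {ι : Type*} {T : Finset ι} {V : ι → Finset (Edge n)}
    (h : ∀ j ∈ T, ∃ r, Linked r (V j)) (he : ∀ j ∈ T, e ∈ V j) {j₀ : ι} (hj₀ : j₀ ∈ T)
    (hr : Linked r (V j₀)) : Linked r (T.biUnion V) := by
  have h1 : Linked e.1.1 (T.biUnion V) := linked_biUnion fun j hj => by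
    obtain ⟨r', hr'⟩ := h j hj
    exact hr'.reroot (he j hj)
  have h2 := hr.union h1 (mem_nodesFrom.2 (.inr ⟨e, he j₀ hj₀, .inl rfl⟩))
  rwa [Finset.union_eq_right.2 (Finset.subset_biUnion_of_mem V hj₀)] at h2

/-- Take a maximal proper linked subset `V`. If no edge of `U` outside `V` touched the nodes of `V`,
that node set would be closed and `U` could not reach beyond it; so such an edge exists, and by
maximality adding it exhausts `U`. -/
theorem Linked.exists_insert (hU : Linked r U) (hne : U.Nonempty) :
    ∃ (V : Finset (Edge n)) (e : Edge n), Linked r V ∧ e ∉ V ∧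
      (e.1.1 ∈ nodesFrom r V ∨ e.1.2 ∈ nodesFrom r V) ∧ U = insert e V := by
  classical
  obtain ⟨V, hV, hmax⟩ := Finset.exists_max_image
    (U.powerset.filter fun V => V ≠ U ∧ Linked r V) Finset.card
    ⟨∅, by simpa [linked_empty] using hne.ne_empty.symm⟩
  simp only [Finset.mem_filter, Finset.mem_powerset] at hV hmax
  obtain ⟨hVU, hVne, hVl⟩ := hV
  by_cases h : ∃ e ∈ U, e ∉ V ∧ (e.1.1 ∈ nodesFrom r V ∨ e.1.2 ∈ nodesFrom r V)
  · obtain ⟨e, heU, heV, het⟩ := h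
    refine ⟨V, e, hVl, heV, het, ?_⟩
    by_contra hne'
    have hl : Linked r (insert e V) := by
      rw [Finset.insert_eq, Finset.union_comm]
      rcases het with het | het
      · exact hVl.union (linked_singleton_left e) het
      · exact hVl.union (linked_singleton_right e) het
    have := hmax (insert e V) ⟨Finset.insert_subset heU hVU, Ne.symm hne', hl⟩
    rw [Finset.card_insert_of_notMem heV] at this
    omega
  · push Not at h
    refine absurd (Finset.Subset.antisymm hVU fun e he => ?_) hVne
    have hclosed : ∀ e ∈ U, e.1.1 ∈ (nodesFrom r V : Set (Fin n)) ↔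
        e.1.2 ∈ (nodesFrom r V : Set (Fin n)) := by
      intro f hf
      by_cases hfV : f ∈ V
      · exact iff_of_true (mem_nodesFrom.2 (.inr ⟨f, hfV, .inl rfl⟩))
          (mem_nodesFrom.2 (.inr ⟨f, hfV, .inr rfl⟩))
      · exact iff_of_false (h f hf hfV).1 (h f hf hfV).2
    have := hU _ (mem_nodesFrom.2 (.inl rfl)) hclosed e he
    by_contra heV
    exact (h e he heV).1 this

theorem card_edges_at_le (v : Fin n) :
    (Finset.univ.filter fun e : Edge n => e.1.1 = v ∨ e.1.2 = v).card ≤ 2 * n := by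
  classical
  rw [Finset.filter_or]
  refine (Finset.card_union_le _ _).trans ?_
  have h1 : (Finset.univ.filter fun e : Edge n => e.1.1 = v).card ≤ n := by
    have := Finset.card_le_card_of_injOn (s := Finset.univ.filter fun e : Edge n => e.1.1 = v)
      (t := (Finset.univ : Finset (Fin n))) (fun e => e.1.2) (fun _ _ => by simp) (by
        intro a ha b hb hab
        simp only [Finset.coe_filter, Finset.mem_univ, true_and, Set.mem_ofPred_eq] at ha hb
        exact Subtype.ext (Prod.ext (ha.trans hb.symm) hab))
    simpa using this
  have h2 : (Finset.univ.filter fun e : Edge n => e.1.2 = v).card ≤ n := by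
    have := Finset.card_le_card_of_injOn (s := Finset.univ.filter fun e : Edge n => e.1.2 = v)
      (t := (Finset.univ : Finset (Fin n))) (fun e => e.1.1) (fun _ _ => by simp) (by
        intro a ha b hb hab
        simp only [Finset.coe_filter, Finset.mem_univ, true_and, Set.mem_ofPred_eq] at ha hb
        exact Subtype.ext (Prod.ext hab (ha.trans hb.symm)))
    simpa using this
  omega

theorem card_edges_touching_le (W : Finset (Fin n)) :
    (Finset.univ.filter fun e : Edge n => e.1.1 ∈ W ∨ e.1.2 ∈ W).card ≤ W.card * (2 * n) := by
  classical
  have hsub : (Finset.univ.filter fun e : Edge n => e.1.1 ∈ W ∨ e.1.2 ∈ W) ⊆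
      W.biUnion fun v => Finset.univ.filter fun e : Edge n => e.1.1 = v ∨ e.1.2 = v := by
    intro e he
    simp only [Finset.mem_filter, Finset.mem_univ, true_and] at he
    simp only [Finset.mem_biUnion, Finset.mem_filter, Finset.mem_univ, true_and]
    rcases he with he | he
    · exact ⟨_, he, .inl rfl⟩
    · exact ⟨_, he, .inr rfl⟩
  refine (Finset.card_le_card hsub).trans (Finset.card_biUnion_le_card_mul _ _ _ ?_)
  exact fun v _ => card_edges_at_le v

end Linked

open Classical in
/-- The connected sets of `k` edges that contain the node `r`. -/
def linkedSets {n : ℕ} (r : Fin n) (k : ℕ) : Finset (Finset (Edge n)) :=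
  Finset.univ.filter fun U => Linked r U ∧ U.card = k

/-- The combinatorial factor in the number of connected sets of `k` edges. -/
def linkedBound : ℕ → ℕ
  | 0 => 1
  | k + 1 => linkedBound k * (2 * (2 * k + 1))

/-- The set is grown edge by edge: a linked set of `k` edges has at most `2k + 1` nodes including
the root, and each node offers at most `2n` edges. -/
theorem card_linkedSets_le {n : ℕ} (r : Fin n) (k : ℕ) :
    (linkedSets r k).card ≤ linkedBound k * n ^ k := by
  classical
  induction k with
  | zero =>
    refine (Finset.card_le_card (t := {∅}) ?_).trans (by simp [linkedBound])
    intro U hU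
    simp only [linkedSets, Finset.mem_filter, Finset.mem_univ, true_and, Finset.card_eq_zero] at hU
    simp [hU.2]
  | succ k ih =>
    have hsub : linkedSets r (k + 1) ⊆ (linkedSets r k).biUnion fun V =>
        (Finset.univ.filter fun e : Edge n => e.1.1 ∈ nodesFrom r V ∨ e.1.2 ∈ nodesFrom r V).image
          fun e => insert e V := by
      intro U hU
      simp only [linkedSets, Finset.mem_filter, Finset.mem_univ, true_and] at hU
      obtain ⟨V, e, hV, heV, het, rfl⟩ :=
        hU.1.exists_insert (Finset.card_pos.1 (by rw [hU.2]; omega))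
      have hc := hU.2
      rw [Finset.card_insert_of_notMem heV] at hc
      simp only [linkedSets, Finset.mem_biUnion, Finset.mem_filter, Finset.mem_univ, true_and,
        Finset.mem_image]
      exact ⟨V, ⟨hV, by omega⟩, e, het, rfl⟩
    refine (Finset.card_le_card hsub).trans
      ((Finset.card_biUnion_le_card_mul _ _ ((2 * k + 1) * (2 * n)) ?_).trans ?_)
    · intro V hV
      simp only [linkedSets, Finset.mem_filter, Finset.mem_univ, true_and] at hV
      refine Finset.card_image_le.trans ((card_edges_touching_le _).trans ?_)
      have := card_nodesFrom_le r V
      rw [hV.2] at this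
      exact Nat.mul_le_mul_right _ this
    · calc (linkedSets r k).card * ((2 * k + 1) * (2 * n))
          ≤ (linkedBound k * n ^ k) * ((2 * k + 1) * (2 * n)) := Nat.mul_le_mul_right _ ih
        _ = linkedBound (k + 1) * n ^ (k + 1) := by rw [linkedBound]; ring

/-! ### Moments of polynomials in independent variables -/

/-- A probability measure on the line with mean `0`, variance `1 / n`, all moments, and absolute
moments of the orders `3, …, J` bounded by `κ / n`. -/
structure SmallLaw (n J : ℕ) (κ : ℝ) (ν : Measure ℝ) : Prop where
  prob : IsProbabilityMeasure ν
  integrable_pow : ∀ k : ℕ, Integrable (fun t : ℝ => t ^ k) ν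
  mean : ∫ t, t ∂ν = 0
  second : ∫ t, t ^ 2 ∂ν = 1 / (n : ℝ)
  abs_moment : ∀ k : ℕ, 3 ≤ k → k ≤ J → ∫ t, |t| ^ k ∂ν ≤ κ / n

theorem SmallLaw.mono {n J : ℕ} {κ K : ℝ} {ν : Measure ℝ} (h : SmallLaw n J κ ν) (hκ : κ ≤ K) :
    SmallLaw n J K ν :=
  ⟨h.prob, h.integrable_pow, h.mean, h.second, fun k h3 hJ =>
    (h.abs_moment k h3 hJ).trans (by gcongr)⟩

theorem SmallLaw.abs_integral_pow_le {n J : ℕ} {κ : ℝ} {ν : Measure ℝ} (h : SmallLaw n J κ ν)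
    {k : ℕ} (h3 : 3 ≤ k) (hJ : k ≤ J) : |∫ t, t ^ k ∂ν| ≤ κ / n := by
  refine (abs_integral_le_integral_abs).trans ?_
  simpa only [abs_pow] using h.abs_moment k h3 hJ

/-- The bound does not improve with the exponent, so a monomial is charged one factor `K / n` per
distinct variable, whatever its degree. This matches the one factor of `n` per edge in
`card_linkedSets_le`. -/
theorem SmallLaw.abs_integral_pow_le_of_pos {n J : ℕ} {K : ℝ} {ν : Measure ℝ}
    (h : SmallLaw n J K ν) (hK : 1 ≤ K) {k : ℕ} (h1 : k ≠ 0) (hJ : k ≤ J) :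
    |∫ t, t ^ k ∂ν| ≤ K / n := by
  have hn : (0 : ℝ) ≤ n := Nat.cast_nonneg n
  rcases (by omega : k = 1 ∨ k = 2 ∨ 3 ≤ k) with rfl | rfl | h3
  · simp only [pow_one, h.mean, abs_zero]
    positivity
  · rw [h.second, abs_of_nonneg (by positivity)]
    gcongr
  · exact h.abs_integral_pow_le h3 hJ

/-- The variables that occur in a monomial. -/
def expSupp {V : Type*} [Fintype V] (g : V → ℕ) : Finset V :=
  Finset.univ.filter fun f => g f ≠ 0

theorem mem_expSupp {V : Type*} [Fintype V] {g : V → ℕ} {f : V} : f ∈ expSupp g ↔ g f ≠ 0 := by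
  simp [expSupp]

section Moments

variable {V : Type*} [Fintype V] {n J : ℕ} {K : ℝ} {ν : V → Measure ℝ}

theorem integrable_monomial (hν : ∀ f, SmallLaw n J K (ν f)) (g : V → ℕ) :
    Integrable (fun x : V → ℝ => ∏ f, x f ^ g f) (Measure.pi ν) := by
  have := fun f => (hν f).prob
  exact Integrable.fintype_prod fun f => (hν f).integrable_pow (g f)

theorem abs_integral_monomial_le (hν : ∀ f, SmallLaw n J K (ν f)) (hK : 1 ≤ K) {g : V → ℕ}
    (hg : ∀ f, g f ≤ J) :
    |∫ x, ∏ f, x f ^ g f ∂(Measure.pi ν)| ≤ (K / n) ^ (expSupp g).card := by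
  have := fun f => (hν f).prob
  rw [integral_fintype_prod_eq_prod (μ := ν) (fun f (t : ℝ) => t ^ g f), Finset.abs_prod,
    ← Finset.prod_const, expSupp, Finset.prod_filter]
  refine Finset.prod_le_prod (fun _ _ => abs_nonneg _) fun f _ => ?_
  by_cases hf : g f = 0
  · simp [hf]
  · simp only [hf, ne_eq, not_false_eq_true, if_true]
    exact (hν f).abs_integral_pow_le_of_pos hK hf (hg f)

/-- The value at `x` of the polynomial with coefficients `c` and exponents `γ`. -/
def famVal {ι : Type*} (L : Finset ι) (c : ι → ℝ) (γ : ι → V → ℕ) (x : V → ℝ) : ℝ :=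
  ∑ l ∈ L, c l * ∏ f, x f ^ γ l f

variable {ι : Type*} {L : Finset ι} {c : ι → ℝ} {γ : ι → V → ℕ}

theorem continuous_famVal (L : Finset ι) (c : ι → ℝ) (γ : ι → V → ℕ) :
    Continuous (famVal L c γ) := by
  unfold famVal
  fun_prop

theorem famVal_pow (m : ℕ) (x : V → ℝ) :
    famVal L c γ x ^ m = ∑ s ∈ Fintype.piFinset fun _ : Fin m => L,
      (∏ j, c (s j)) * ∏ f, x f ^ ∑ j, γ (s j) f := by
  have h : famVal L c γ x ^ m = ∏ _j : Fin m, ∑ l ∈ L, c l * ∏ f, x f ^ γ l f := by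
    simp [famVal]
  rw [h, Finset.prod_univ_sum]
  refine Finset.sum_congr rfl fun s _ => ?_
  rw [Finset.prod_mul_distrib, Finset.prod_comm]
  simp only [Finset.prod_pow_eq_pow_sum]

theorem integrable_famVal_pow (hν : ∀ f, SmallLaw n J K (ν f)) (m : ℕ) :
    Integrable (fun x => famVal L c γ x ^ m) (Measure.pi ν) := by
  simp only [famVal_pow]
  exact integrable_finsetSum _ fun s _ => (integrable_monomial hν _).const_mul _

theorem integrable_famVal (hν : ∀ f, SmallLaw n J K (ν f)) :
    Integrable (famVal L c γ) (Measure.pi ν) := by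
  simpa using integrable_famVal_pow (L := L) (c := c) (γ := γ) hν 1

/-- Expanding the power gives a sum over `m`-tuples of monomials. By independence the weight of a
tuple depends only on the union of the supports. -/
theorem integral_famVal_pow_le [DecidableEq V] (hν : ∀ f, SmallLaw n J K (ν f)) (hK : 1 ≤ K)
    {b : ℝ} (hc : ∀ l ∈ L, |c l| ≤ b) {D m : ℕ} (hγ : ∀ l ∈ L, ∀ f, γ l f ≤ D)
    (hJ : m * D ≤ J) :
    ∫ x, famVal L c γ x ^ m ∂(Measure.pi ν) ≤ b ^ m * ∑ s ∈ Fintype.piFinset fun _ : Fin m => L,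
      (K / n) ^ (Finset.univ.biUnion fun j => expSupp (γ (s j))).card := by
  simp only [famVal_pow]
  rw [integral_finsetSum _ fun s _ => (integrable_monomial hν _).const_mul _, Finset.mul_sum]
  refine Finset.sum_le_sum fun s hs => ?_
  have hs' : ∀ j, s j ∈ L := fun j => Fintype.mem_piFinset.1 hs j
  rw [integral_const_mul]
  refine (le_abs_self _).trans ?_
  rw [abs_mul, Finset.abs_prod]
  have h1 : ∏ j, |c (s j)| ≤ b ^ m := by
    refine (Finset.prod_le_prod (fun j _ => abs_nonneg _) fun j _ => hc _ (hs' j)).trans_eq ?_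
    simp
  have h0 : 0 ≤ b ^ m := (Finset.prod_nonneg fun j _ => abs_nonneg (c (s j))).trans h1
  have h2 : expSupp (fun f => ∑ j, γ (s j) f) =
      Finset.univ.biUnion fun j => expSupp (γ (s j)) := by
    ext f
    simp [mem_expSupp]
  have h3 := abs_integral_monomial_le hν hK (g := fun f => ∑ j, γ (s j) f) fun f => by
    refine le_trans ?_ hJ
    simpa using Finset.sum_le_card_nsmul Finset.univ (fun j => γ (s j) f) D
      fun j _ => hγ _ (hs' j) f
  rw [h2] at h3
  gcongr

end Moments

/-! ### Families of connected monomials -/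

/-- A family of monomials, indexed by `L`, with coefficients bounded by `b`, exponents bounded by
`D`, connected supports of at most `S` edges that contain a node of `R`, and with at most `N ^ k`
members that are supported by a given set of `k` edges. -/
structure LinkedFamily {n : ℕ} {ι : Type*} (L : Finset ι) (c : ι → ℝ) (γ : ι → Edge n → ℕ)
    (R : Finset (Fin n)) (b : ℝ) (D S N : ℕ) : Prop where
  coeff_le : ∀ l ∈ L, |c l| ≤ b
  exp_le : ∀ l ∈ L, ∀ e, γ l e ≤ D
  card_le : ∀ l ∈ L, (expSupp (γ l)).card ≤ S
  linked : ∀ l ∈ L, ∃ r ∈ R, Linked r (expSupp (γ l))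
  mult : ∀ U : Finset (Edge n), ∀ T ⊆ L, (∀ l ∈ T, expSupp (γ l) ⊆ U) → T.card ≤ N ^ U.card

/-- The constant in `LinkedFamily.sum_weight_le`. -/
def weightBound (K : ℝ) (S N m : ℕ) : ℝ :=
  ∑ k ∈ Finset.range (m * S + 1), (linkedBound k : ℝ) * K ^ k * ((N : ℝ) ^ k) ^ m

theorem weightBound_nonneg {K : ℝ} (hK : 0 ≤ K) (S N m : ℕ) : 0 ≤ weightBound K S N m :=
  Finset.sum_nonneg fun _ _ => by positivity

section Family

variable {n : ℕ} {ι : Type*} {L : Finset ι} {c : ι → ℝ} {γ : ι → Edge n → ℕ}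
  {R : Finset (Fin n)} {b : ℝ} {D S N : ℕ}

/-- The union of the supports of a tuple of monomials. -/
def tupleSupp (γ : ι → Edge n → ℕ) {m : ℕ} (s : Fin m → ι) : Finset (Edge n) :=
  Finset.univ.biUnion fun j => expSupp (γ (s j))

theorem LinkedFamily.card_tupleSupp_le (h : LinkedFamily L c γ R b D S N) {m : ℕ} {s : Fin m → ι}
    (hs : ∀ j, s j ∈ L) : (tupleSupp γ s).card ≤ m * S := by
  refine (Finset.card_biUnion_le_card_mul _ _ S fun j _ => h.card_le _ (hs j)).trans ?_
  simp

/-- The tuples are grouped by their union `U`. With `k` edges there are at most `linkedBound k * n ^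
k` sets `U` per root and at most `(N ^ k) ^ m` tuples per set, and the weight `(K / n) ^ k` removes
the power of `n`. -/
theorem LinkedFamily.sum_weight_le (h : LinkedFamily L c γ R b D S N) (hn : 0 < n) {K : ℝ}
    (hK : 0 ≤ K) {m : ℕ} (T : Finset (Fin m → ι)) (hT : ∀ s ∈ T, ∀ j, s j ∈ L)
    (hlink : ∀ s ∈ T, ∃ r ∈ R, Linked r (tupleSupp γ s)) :
    ∑ s ∈ T, (K / n) ^ (tupleSupp γ s).card ≤ weightBound K S N m * R.card := by
  classical
  have hn' : (0 : ℝ) < n := Nat.cast_pos.2 hn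
  -- Each entry of a tuple with union `U` is supported in `U`, so the multiplicity bound applies to
  -- each of the `m` entries.
  have hfib : ∀ U : Finset (Edge n), ((T.filter fun s => tupleSupp γ s = U).card : ℝ) ≤
      ((N : ℝ) ^ U.card) ^ m := by
    intro U
    have hsub : T.filter (fun s => tupleSupp γ s = U) ⊆
        Fintype.piFinset fun _ : Fin m => L.filter fun l => expSupp (γ l) ⊆ U := by
      intro s hs
      rw [Finset.mem_filter] at hs
      rw [Fintype.mem_piFinset]
      intro j
      rw [Finset.mem_filter]
      refine ⟨hT s hs.1 j, ?_⟩
      rw [← hs.2]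
      exact Finset.subset_biUnion_of_mem (fun j => expSupp (γ (s j))) (Finset.mem_univ j)
    have h1 := Finset.card_le_card hsub
    rw [Fintype.card_piFinset_const] at h1
    have h2 := h.mult U (L.filter fun l => expSupp (γ l) ⊆ U) (Finset.filter_subset _ _)
      fun l hl => (Finset.mem_filter.1 hl).2
    exact_mod_cast h1.trans (Nat.pow_le_pow_left h2 m)
  rw [Finset.sum_comp (fun U : Finset (Edge n) => (K / n) ^ U.card) (tupleSupp γ)]
  calc ∑ U ∈ T.image (tupleSupp γ), (T.filter fun s => tupleSupp γ s = U).card • (K / n) ^ U.card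
      ≤ ∑ U ∈ T.image (tupleSupp γ), ((N : ℝ) ^ U.card) ^ m * (K / n) ^ U.card := by
        refine Finset.sum_le_sum fun U _ => ?_
        rw [nsmul_eq_mul]
        exact mul_le_mul_of_nonneg_right (hfib U) (by positivity)
    _ ≤ ∑ q ∈ (R ×ˢ Finset.range (m * S + 1)).sigma fun q => linkedSets q.1 q.2,
          ((N : ℝ) ^ q.2.card) ^ m * (K / n) ^ q.2.card := by
        -- A set linked to several roots is counted once for each of them, which only enlarges the
        -- sum.
        have himg : T.image (tupleSupp γ) ⊆
            ((R ×ˢ Finset.range (m * S + 1)).sigma fun q => linkedSets q.1 q.2).image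
              fun q => q.2 := by
          intro U hU
          obtain ⟨s, hs, rfl⟩ := Finset.mem_image.1 hU
          obtain ⟨r, hr, hl⟩ := hlink s hs
          refine Finset.mem_image.2 ⟨⟨(r, (tupleSupp γ s).card), tupleSupp γ s⟩, ?_, rfl⟩
          simp only [Finset.mem_sigma, Finset.mem_product, Finset.mem_range, linkedSets,
            Finset.mem_filter, Finset.mem_univ, true_and, and_true]
          exact ⟨⟨hr, Nat.lt_succ_of_le (h.card_tupleSupp_le (hT s hs))⟩, hl⟩
        refine (Finset.sum_le_sum_of_subset_of_nonneg himg fun _ _ _ => by positivity).trans ?_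
        exact Finset.sum_image_le_of_nonneg
          (f := fun U : Finset (Edge n) => ((N : ℝ) ^ U.card) ^ m * (K / n) ^ U.card)
          fun _ _ => by positivity
    _ ≤ weightBound K S N m * R.card := by
        rw [Finset.sum_sigma, Finset.sum_product, mul_comm (weightBound K S N m), ← nsmul_eq_mul,
          weightBound]
        refine Finset.sum_le_card_nsmul _ _ _ fun r _ => Finset.sum_le_sum fun k _ => ?_
        have h1 : ∑ U ∈ linkedSets r k, ((N : ℝ) ^ U.card) ^ m * (K / n) ^ U.card =
            (linkedSets r k).card * (((N : ℝ) ^ k) ^ m * (K / n) ^ k) := by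
          rw [← nsmul_eq_mul, ← Finset.sum_const]
          refine Finset.sum_congr rfl fun U hU => ?_
          simp only [linkedSets, Finset.mem_filter, Finset.mem_univ, true_and] at hU
          rw [hU.2]
        rw [h1]
        have h2 : ((linkedSets r k).card : ℝ) ≤ linkedBound k * (n : ℝ) ^ k := by
          exact_mod_cast card_linkedSets_le r k
        calc ((linkedSets r k).card : ℝ) * (((N : ℝ) ^ k) ^ m * (K / n) ^ k)
            ≤ (linkedBound k * (n : ℝ) ^ k) * (((N : ℝ) ^ k) ^ m * (K / n) ^ k) := by gcongr
          _ = linkedBound k * K ^ k * ((N : ℝ) ^ k) ^ m := by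
            rw [div_pow]
            field_simp

/-- Moments of a polynomial all of whose monomials are connected to the same root. -/
theorem LinkedFamily.integral_pow_le {r : Fin n} (h : LinkedFamily L c γ {r} b D S N)
    {K : ℝ} (hK : 1 ≤ K) (hb : 0 ≤ b) {m J : ℕ} (hJ : m * D ≤ J) {ν : Edge n → Measure ℝ}
    (hν : ∀ e, SmallLaw n J K (ν e)) :
    ∫ x, famVal L c γ x ^ m ∂(Measure.pi ν) ≤ b ^ m * weightBound K S N m := by
  refine (integral_famVal_pow_le hν hK h.coeff_le h.exp_le hJ).trans ?_
  gcongr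
  have := h.sum_weight_le (Fin.pos r) (zero_le_one.trans hK) (m := m)
    (Fintype.piFinset fun _ : Fin m => L) (fun s hs j => Fintype.mem_piFinset.1 hs j) (by
      intro s hs
      refine ⟨r, by simp, linked_biUnion fun j _ => ?_⟩
      obtain ⟨r', hr', hl⟩ := h.linked _ (Fintype.mem_piFinset.1 hs j)
      rwa [Finset.mem_singleton.1 hr'] at hl)
  simpa [tupleSupp] using this

end Family

/-! ### Resampling one coordinate of a product measure -/

section Resample

variable {V : Type*} [Fintype V] [DecidableEq V]

theorem pi_update_eq_map (ν : V → Measure ℝ) [∀ f, IsProbabilityMeasure (ν f)] (e : V)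
    (ν' : Measure ℝ) [IsProbabilityMeasure ν'] :
    Measure.pi (Function.update ν e ν') =
      ((Measure.pi ν).prod ν').map fun q : (V → ℝ) × ℝ => Function.update q.1 e q.2 := by
  have hprob : ∀ f, IsProbabilityMeasure (Function.update ν e ν' f) := by
    intro f
    by_cases hf : f = e
    · subst hf; simpa
    · simpa [hf] using (inferInstance : IsProbabilityMeasure (ν f))
  have hmeas : Measurable fun q : (V → ℝ) × ℝ => Function.update q.1 e q.2 := by
    refine measurable_pi_lambda _ fun f => ?_
    by_cases hf : f = e
    · subst hf; simpa using measurable_snd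
    · simpa [hf] using! (measurable_pi_apply f).comp measurable_fst
  refine (Measure.pi_eq fun s hs => ?_)
  rw [Measure.map_apply hmeas (MeasurableSet.univ_pi hs)]
  have hpre : (fun q : (V → ℝ) × ℝ => Function.update q.1 e q.2) ⁻¹' Set.pi Set.univ s =
      Set.pi Set.univ (Function.update s e Set.univ) ×ˢ s e := by
    ext q
    simp only [Set.mem_preimage, Set.mem_pi, Set.mem_univ, true_imp_iff, Set.mem_prod]
    constructor
    · intro h
      refine ⟨fun f => ?_, by simpa using h e⟩
      by_cases hf : f = e
      · subst hf; simp
      · simpa [hf] using h f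
    · rintro ⟨h1, h2⟩ f
      by_cases hf : f = e
      · subst hf; simpa using h2
      · simpa [hf] using h1 f
  rw [hpre, Measure.prod_prod, Measure.pi_pi, ← Finset.mul_prod_erase _ _ (Finset.mem_univ e),
    ← Finset.mul_prod_erase Finset.univ (fun f => Function.update ν e ν' f (s f))
      (Finset.mem_univ e)]
  simp only [Function.update_self, measure_univ, one_mul]
  rw [mul_comm]
  congr 1
  refine Finset.prod_congr rfl fun f hf => ?_
  simp [Finset.ne_of_mem_erase hf]

theorem integral_pi_update (ν : V → Measure ℝ) [∀ f, IsProbabilityMeasure (ν f)] (e : V)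
    (ν' : Measure ℝ) [IsProbabilityMeasure ν'] {G : (V → ℝ) → ℝ} (hG : Continuous G) {B : ℝ}
    (hB : ∀ x, |G x| ≤ B) :
    ∫ x, G x ∂(Measure.pi (Function.update ν e ν')) =
      ∫ x, ∫ t, G (Function.update x e t) ∂ν' ∂(Measure.pi ν) := by
  have hcont : Continuous fun q : (V → ℝ) × ℝ => Function.update q.1 e q.2 :=
    continuous_fst.update e continuous_snd
  rw [pi_update_eq_map, integral_map hcont.measurable.aemeasurable
    hG.measurable.aestronglyMeasurable, integral_prod]
  exact Integrable.of_bound (hG.comp hcont).measurable.aestronglyMeasurable B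
    (.of_forall fun q => hB _)

end Resample

/-! ### Test functions -/

/-- `φ` is bounded by `B` and has a second order Taylor expansion with coefficients `φ₁`, `φ₂`
bounded by `B` and a remainder of at most `B |h| ^ 3`. -/
structure TestFun (φ φ₁ φ₂ : ℝ → ℝ) (B : ℝ) : Prop where
  cont : Continuous φ
  bound : ∀ a, |φ a| ≤ B
  bound₁ : ∀ a, |φ₁ a| ≤ B
  bound₂ : ∀ a, |φ₂ a| ≤ B
  taylor : ∀ a h, |φ (a + h) - φ a - φ₁ a * h - φ₂ a * h ^ 2| ≤ B * |h| ^ 3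

/-- The size of the change if one coordinate, with slice coefficients `A`, is resampled. -/
def sliceSize (D : ℕ) (A : ℕ → ℝ) : ℝ :=
  ∑ k ∈ Finset.Icc 3 D, |A k| + ∑ k ∈ Finset.Icc 1 D, (A k ^ 2 + A k ^ 4)

/-- Even powers of a polynomial are polynomials without absolute values, so their expectations can
be expanded in monomials. -/
theorem abs_pow_three_le (a : ℝ) : |a| ^ 3 ≤ a ^ 2 + a ^ 4 := by
  have h2 : a ^ 2 = |a| ^ 2 := (sq_abs a).symm
  have h4 : a ^ 4 = |a| ^ 4 := by rw [pow_abs, abs_of_nonneg (by positivity)]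
  rw [h2, h4]
  have := abs_nonneg a
  nlinarith [mul_nonneg (sq_nonneg |a|) (sq_nonneg (|a| - 1)), sq_nonneg (|a|)]

theorem abs_mul_le_half (a b : ℝ) : |a * b| ≤ (a ^ 2 + b ^ 2) / 2 := by
  rw [abs_mul, ← sq_abs a, ← sq_abs b]
  nlinarith [sq_nonneg (|a| - |b|)]

/-! ### Resampling a single variable -/

section OneVariable

variable {n J D : ℕ} {κ : ℝ} {ν ν₁ ν₂ : Measure ℝ}

theorem SmallLaw.abs_moment_sub_le (h₁ : SmallLaw n J κ ν₁) (h₂ : SmallLaw n J κ ν₂) {k : ℕ}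
    (h3 : 3 ≤ k) (hJ : k ≤ J) : |∫ t, t ^ k ∂ν₁ - ∫ t, t ^ k ∂ν₂| ≤ 2 * (κ / n) := by
  have a1 := h₁.abs_integral_pow_le h3 hJ
  have a2 := h₂.abs_integral_pow_le h3 hJ
  have := abs_sub (∫ t, t ^ k ∂ν₁) (∫ t, t ^ k ∂ν₂)
  linarith

theorem SmallLaw.nonneg (h : SmallLaw n J κ ν) (hJ : 3 ≤ J) : 0 ≤ κ / n :=
  (integral_nonneg fun t => by positivity).trans (h.abs_moment 3 le_rfl hJ)

/-- Taylor's formula is applied at `A 0`, the value with the variable set to zero. The first two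
moments of the two laws agree, so every surviving term carries a moment of order at least 3 and with
it the factor `κ / n`. The remainder uses moments up to order `3 * D`. -/
theorem abs_resample_le (h₁ : SmallLaw n J κ ν₁) (h₂ : SmallLaw n J κ ν₂) (hJ : 3 * D + 3 ≤ J)
    {φ φ₁ φ₂ : ℝ → ℝ} {B : ℝ} (hφ : TestFun φ φ₁ φ₂ B) (A : ℕ → ℝ) :
    |∫ t, φ (∑ k ∈ Finset.range (D + 1), A k * t ^ k) ∂ν₁ -
      ∫ t, φ (∑ k ∈ Finset.range (D + 1), A k * t ^ k) ∂ν₂| ≤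
        B * (8 * (D + 1) ^ 2) * (κ / n) * sliceSize D A := by
  have := h₁.prob
  have := h₂.prob
  have hκ : 0 ≤ κ / n := h₁.nonneg (by omega)
  have hB : 0 ≤ B := (abs_nonneg _).trans (hφ.bound 0)
  set I := Finset.Icc 1 D with hI
  set h : ℝ → ℝ := fun t => ∑ k ∈ I, A k * t ^ k with hh
  have hrange : ∀ t, ∑ k ∈ Finset.range (D + 1), A k * t ^ k = A 0 + h t := by
    intro t
    rw [Finset.sum_range_succ', add_comm, hh, hI]
    simp only [pow_zero, mul_one]
    congr 1
    rw [Finset.range_eq_Ico, Finset.sum_Ico_add' (fun k => A k * t ^ k) 0 D 1]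
    rfl
  simp only [hrange]
  have hcont : Continuous h := by fun_prop
  have hsq : ∀ t, h t ^ 2 = ∑ k ∈ I, ∑ l ∈ I, A k * A l * t ^ (k + l) := by
    intro t
    rw [sq, hh]
    simp only [Finset.sum_mul_sum]
    refine Finset.sum_congr rfl fun k _ => Finset.sum_congr rfl fun l _ => ?_
    ring
  have hI1 : ∀ {ν : Measure ℝ}, SmallLaw n J κ ν → Integrable h ν := fun hν =>
    integrable_finsetSum _ fun k _ => (hν.integrable_pow k).const_mul _
  have hI2 : ∀ {ν : Measure ℝ}, SmallLaw n J κ ν → Integrable (fun t => h t ^ 2) ν := by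
    intro ν hν
    simp only [hsq]
    exact integrable_finsetSum _ fun k _ => integrable_finsetSum _ fun l _ =>
      (hν.integrable_pow (k + l)).const_mul _
  have hIφ : ∀ {ν : Measure ℝ}, SmallLaw n J κ ν → Integrable (fun t => φ (A 0 + h t)) ν := by
    intro ν hν
    have := hν.prob
    exact Integrable.of_bound
      (hφ.cont.comp (continuous_const.add hcont)).measurable.aestronglyMeasurable B
      (.of_forall fun t => hφ.bound _)
  -- the remainder term
  have hrem : ∀ {ν : Measure ℝ}, SmallLaw n J κ ν →
      |∫ t, (φ (A 0 + h t) - φ (A 0) - φ₁ (A 0) * h t - φ₂ (A 0) * h t ^ 2) ∂ν| ≤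
        B * ((D : ℝ) ^ 2 * ((κ / n) * ∑ k ∈ I, (A k ^ 2 + A k ^ 4))) := by
    intro ν hν
    have hint : ∀ k, Integrable (fun t : ℝ => |A k| ^ 3 * |t| ^ (3 * k)) ν := by
      intro k
      refine Integrable.const_mul ?_ _
      simpa only [abs_pow] using (hν.integrable_pow (3 * k)).abs
    have hint' : Integrable (fun t : ℝ => B * ((D : ℝ) ^ 2 *
        ∑ k ∈ I, |A k| ^ 3 * |t| ^ (3 * k))) ν :=
      ((integrable_finsetSum _ fun k _ => hint k).const_mul _).const_mul _
    have hpt : ∀ t, |φ (A 0 + h t) - φ (A 0) - φ₁ (A 0) * h t - φ₂ (A 0) * h t ^ 2| ≤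
        B * ((D : ℝ) ^ 2 * ∑ k ∈ I, |A k| ^ 3 * |t| ^ (3 * k)) := by
      intro t
      refine (hφ.taylor _ _).trans ?_
      gcongr
      have h1 : |h t| ≤ ∑ k ∈ I, |A k| * |t| ^ k := by
        refine (Finset.abs_sum_le_sum_abs _ _).trans (le_of_eq ?_)
        simp only [abs_mul, abs_pow]
      -- Convexity of the cube, with `D` summands.
      have h3 : (∑ k ∈ I, |A k| * |t| ^ k) ^ 3 ≤ (D : ℝ) ^ 2 * ∑ k ∈ I, (|A k| * |t| ^ k) ^ 3 := by
        have := pow_sum_le_card_mul_sum_pow (s := I) (f := fun k => |A k| * |t| ^ k)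
          (fun k _ => by positivity) 2
        simpa [hI] using this
      refine (pow_le_pow_left₀ (abs_nonneg _) h1 3).trans (h3.trans (le_of_eq ?_))
      congr 1
      refine Finset.sum_congr rfl fun k _ => ?_
      ring
    refine abs_integral_le_integral_abs.trans
      ((integral_mono_of_nonneg (.of_forall fun t => abs_nonneg _) hint'
        (.of_forall hpt)).trans ?_)
    rw [integral_const_mul, integral_const_mul, integral_finsetSum _ fun k _ => hint k]
    gcongr
    rw [Finset.mul_sum]
    refine Finset.sum_le_sum fun k hk => ?_
    rw [hI, Finset.mem_Icc] at hk
    rw [integral_const_mul, mul_comm]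
    exact mul_le_mul (hν.abs_moment _ (by omega) (by omega)) (abs_pow_three_le _)
      (by positivity) hκ
  -- The exponents 1 and 2 cancel because mean and variance coincide; only the exponents from 3 on
  -- remain.
  have hlin : |∫ t, h t ∂ν₁ - ∫ t, h t ∂ν₂| ≤ 2 * (κ / n) * ∑ k ∈ Finset.Icc 3 D, |A k| := by
    rw [hh, integral_finsetSum _ fun k _ => (h₁.integrable_pow k).const_mul _,
      integral_finsetSum _ fun k _ => (h₂.integrable_pow k).const_mul _,
      ← Finset.sum_sub_distrib]
    have hsub : Finset.Icc 3 D ⊆ I := Finset.Icc_subset_Icc (by norm_num) le_rfl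
    rw [← Finset.sum_subset hsub]
    · refine (Finset.abs_sum_le_sum_abs _ _).trans ?_
      rw [Finset.mul_sum]
      refine Finset.sum_le_sum fun k hk => ?_
      rw [Finset.mem_Icc] at hk
      rw [integral_const_mul, integral_const_mul, ← mul_sub, abs_mul, mul_comm]
      gcongr
      exact h₁.abs_moment_sub_le h₂ hk.1 (by omega)
    · intro k hk hk3
      rw [hI, Finset.mem_Icc] at hk
      rw [Finset.mem_Icc] at hk3
      rcases (by omega : k = 1 ∨ k = 2) with rfl | rfl
      · simp only [pow_one]
        rw [integral_const_mul, integral_const_mul, h₁.mean, h₂.mean, sub_self]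
      · simp [integral_const_mul, h₁.second, h₂.second]
  -- Only `k = l = 1` gives a moment of order 2, which cancels; all other pairs have order at least
  -- 3.
  have hquad : |∫ t, h t ^ 2 ∂ν₁ - ∫ t, h t ^ 2 ∂ν₂| ≤
      2 * (κ / n) * (D * ∑ k ∈ I, A k ^ 2) := by
    simp only [hsq]
    have e : ∀ {ν : Measure ℝ}, SmallLaw n J κ ν →
        ∫ t, ∑ k ∈ I, ∑ l ∈ I, A k * A l * t ^ (k + l) ∂ν =
          ∑ k ∈ I, ∑ l ∈ I, A k * A l * ∫ t, t ^ (k + l) ∂ν := by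
      intro ν hν
      rw [integral_finsetSum _ fun k _ => integrable_finsetSum _ fun l _ =>
        (hν.integrable_pow (k + l)).const_mul _]
      refine Finset.sum_congr rfl fun k _ => ?_
      rw [integral_finsetSum _ fun l _ => (hν.integrable_pow (k + l)).const_mul _]
      simp only [integral_const_mul]
    rw [e h₁, e h₂, ← Finset.sum_sub_distrib]
    have hcard : (I.card : ℝ) = D := by simp [hI]
    calc |∑ k ∈ I, (∑ l ∈ I, A k * A l * ∫ t, t ^ (k + l) ∂ν₁ -
          ∑ l ∈ I, A k * A l * ∫ t, t ^ (k + l) ∂ν₂)|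
        ≤ ∑ k ∈ I, ∑ l ∈ I, 2 * (κ / n) * ((A k ^ 2 + A l ^ 2) / 2) := by
          refine (Finset.abs_sum_le_sum_abs _ _).trans (Finset.sum_le_sum fun k hk => ?_)
          rw [← Finset.sum_sub_distrib]
          refine (Finset.abs_sum_le_sum_abs _ _).trans (Finset.sum_le_sum fun l hl => ?_)
          rw [hI, Finset.mem_Icc] at hk hl
          rw [← mul_sub, abs_mul, mul_comm]
          refine mul_le_mul ?_ (abs_mul_le_half _ _) (abs_nonneg _) (by positivity)
          rcases (by omega : (k = 1 ∧ l = 1) ∨ 3 ≤ k + l) with ⟨rfl, rfl⟩ | h3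
          · simp only [Nat.reduceAdd, h₁.second, h₂.second, sub_self, abs_zero]
            positivity
          · exact h₁.abs_moment_sub_le h₂ h3 (by omega)
      _ = 2 * (κ / n) * (D * ∑ k ∈ I, A k ^ 2) := by
          simp only [← Finset.mul_sum, ← Finset.sum_div, Finset.sum_add_distrib, Finset.sum_const,
            nsmul_eq_mul, hcard]
          ring
  have hexp : ∀ {ν : Measure ℝ}, SmallLaw n J κ ν → ∫ t, φ (A 0 + h t) ∂ν =
      φ (A 0) + φ₁ (A 0) * ∫ t, h t ∂ν + φ₂ (A 0) * ∫ t, h t ^ 2 ∂ν +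
        ∫ t, (φ (A 0 + h t) - φ (A 0) - φ₁ (A 0) * h t - φ₂ (A 0) * h t ^ 2) ∂ν := by
    intro ν hν
    have := hν.prob
    have i0 := hIφ hν
    have i1 : Integrable (fun t => φ₁ (A 0) * h t) ν := (hI1 hν).const_mul _
    have i2 : Integrable (fun t => φ₂ (A 0) * h t ^ 2) ν := (hI2 hν).const_mul _
    have i3 : Integrable (fun t => φ (A 0 + h t) - φ (A 0)) ν := i0.sub (integrable_const _)
    have i4 : Integrable (fun t => φ (A 0 + h t) - φ (A 0) - φ₁ (A 0) * h t) ν := i3.sub i1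
    rw [integral_sub i4 i2, integral_sub i3 i1, integral_sub i0 (integrable_const _),
      integral_const_mul, integral_const_mul, integral_const, probReal_univ, one_smul]
    ring
  rw [hexp h₁, hexp h₂]
  have r1 := hrem h₁
  have r2 := hrem h₂
  set T₁ := ∫ t, (φ (A 0 + h t) - φ (A 0) - φ₁ (A 0) * h t - φ₂ (A 0) * h t ^ 2) ∂ν₁
  set T₂ := ∫ t, (φ (A 0 + h t) - φ (A 0) - φ₁ (A 0) * h t - φ₂ (A 0) * h t ^ 2) ∂ν₂
  set H₁ := ∫ t, h t ∂ν₁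
  set H₂ := ∫ t, h t ∂ν₂
  set Q₁ := ∫ t, h t ^ 2 ∂ν₁
  set Q₂ := ∫ t, h t ^ 2 ∂ν₂
  have hs3 : 0 ≤ ∑ k ∈ Finset.Icc 3 D, |A k| := Finset.sum_nonneg fun _ _ => abs_nonneg _
  have hs2 : ∑ k ∈ I, A k ^ 2 ≤ ∑ k ∈ I, (A k ^ 2 + A k ^ 4) :=
    Finset.sum_le_sum fun k _ => le_add_of_nonneg_right (by positivity)
  have hs2' : 0 ≤ ∑ k ∈ I, A k ^ 2 := Finset.sum_nonneg fun _ _ => sq_nonneg _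
  rw [sliceSize, ← hI]
  set s₃ := ∑ k ∈ Finset.Icc 3 D, |A k|
  set s₂ := ∑ k ∈ I, A k ^ 2
  set s := ∑ k ∈ I, (A k ^ 2 + A k ^ 4)
  have b1 : |φ₁ (A 0) * (H₁ - H₂)| ≤ B * (2 * (κ / n) * s₃) := by
    rw [abs_mul]
    exact mul_le_mul (hφ.bound₁ _) hlin (abs_nonneg _) hB
  have b2 : |φ₂ (A 0) * (Q₁ - Q₂)| ≤ B * (2 * (κ / n) * (D * s)) := by
    rw [abs_mul]
    refine mul_le_mul (hφ.bound₂ _) (hquad.trans ?_) (abs_nonneg _) hB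
    gcongr
  have b3 : |T₁ - T₂| ≤ 2 * (B * ((D : ℝ) ^ 2 * ((κ / n) * s))) :=
    (abs_sub _ _).trans (by linarith)
  have hsplit : φ (A 0) + φ₁ (A 0) * H₁ + φ₂ (A 0) * Q₁ + T₁ -
      (φ (A 0) + φ₁ (A 0) * H₂ + φ₂ (A 0) * Q₂ + T₂) =
      φ₁ (A 0) * (H₁ - H₂) + φ₂ (A 0) * (Q₁ - Q₂) + (T₁ - T₂) := by ring
  rw [hsplit]
  refine ((abs_add_le _ _).trans (add_le_add_left (abs_add_le _ _) _)).trans ?_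
  refine (add_le_add (add_le_add b1 b2) b3).trans ?_
  have hD : (0 : ℝ) ≤ D := Nat.cast_nonneg D
  have hs : 0 ≤ s := hs2'.trans hs2
  have hBκ : 0 ≤ B * (κ / n) := mul_nonneg hB hκ
  have e1 : 0 ≤ B * (κ / n) * s₃ * (8 * (D + 1) ^ 2 - 2) :=
    mul_nonneg (mul_nonneg hBκ hs3) (by nlinarith)
  have e2 : 0 ≤ B * (κ / n) * s * (8 * (D + 1) ^ 2 - 2 * D - 2 * D ^ 2) :=
    mul_nonneg (mul_nonneg hBκ hs) (by nlinarith)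
  linarith

end OneVariable

/-! ### Replacing the coordinates one after the other -/

section Slices

variable {V : Type*} [Fintype V] [DecidableEq V] {ι : Type*} {L : Finset ι} {c : ι → ℝ}
  {γ : ι → V → ℕ}

/-- The coefficient of `x e ^ k` in the polynomial with coefficients `c` and exponents `γ`. -/
def sliceVal (L : Finset ι) (c : ι → ℝ) (γ : ι → V → ℕ) (e : V) (x : V → ℝ) (k : ℕ) : ℝ :=
  famVal (L.filter fun l => γ l e = k) c (fun l => Function.update (γ l) e 0) x

theorem famVal_update {D : ℕ} {e : V} (hD : ∀ l ∈ L, γ l e ≤ D) (x : V → ℝ) (t : ℝ) :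
    famVal L c γ (Function.update x e t) =
      ∑ k ∈ Finset.range (D + 1), sliceVal L c γ e x k * t ^ k := by
  rw [famVal, ← Finset.sum_fiberwise_of_maps_to (t := Finset.range (D + 1)) (g := fun l => γ l e)
    fun l hl => Finset.mem_range.2 (Nat.lt_succ_of_le (hD l hl))]
  refine Finset.sum_congr rfl fun k _ => ?_
  rw [sliceVal, famVal, Finset.sum_mul]
  refine Finset.sum_congr rfl fun l hl => ?_
  have hk : γ l e = k := (Finset.mem_filter.1 hl).2
  rw [mul_assoc, ← Finset.mul_prod_erase _ _ (Finset.mem_univ e),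
    ← Finset.mul_prod_erase Finset.univ (fun f => x f ^ Function.update (γ l) e 0 f)
      (Finset.mem_univ e)]
  simp only [Function.update_self, pow_zero, one_mul, hk]
  rw [mul_comm (t ^ k)]
  congr 2
  refine Finset.prod_congr rfl fun f hf => ?_
  simp [Finset.ne_of_mem_erase hf]

theorem expSupp_update_zero (g : V → ℕ) (e : V) :
    expSupp (Function.update g e 0) = (expSupp g).erase e := by
  ext f
  by_cases hf : f = e
  · subst hf; simp [mem_expSupp]
  · simp [mem_expSupp, hf]

end Slices

/-! ### Influences of single edges -/

section Influence

variable {n : ℕ} {ι : Type*} {L : Finset ι} {c : ι → ℝ} {γ : ι → Edge n → ℕ}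
  {R : Finset (Fin n)} {b : ℝ} {D S N : ℕ}

/-- A bound for the `m`-th moment of the coefficient of `x e ^ k`, divided by `n`. -/
def sliceBound (L : Finset ι) (γ : ι → Edge n → ℕ) (K : ℝ) (m k : ℕ) (e : Edge n) : ℝ :=
  ∑ s ∈ Fintype.piFinset fun _ : Fin m => L.filter fun l => γ l e = k,
    (K / n) ^ (tupleSupp γ s).card

/-- Dropping the variable `e` removes one edge from the union of the supports. The prefactor `1 /
n`, which comes from `κ / n` in the cost of one replacement, restores the weight of the full union.
-/
theorem LinkedFamily.integral_sliceVal_pow_le (h : LinkedFamily L c γ R b D S N) {K : ℝ}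
    (hK : 1 ≤ K) (hb : 0 ≤ b) {m J : ℕ} (hm : m ≠ 0) (hJ : m * D ≤ J) {ν : Edge n → Measure ℝ}
    (hν : ∀ e, SmallLaw n J K (ν e)) {k : ℕ} (hk : k ≠ 0) (e : Edge n) :
    1 / (n : ℝ) * ∫ x, sliceVal L c γ e x k ^ m ∂(Measure.pi ν) ≤
      b ^ m * sliceBound L γ K m k e := by
  have hn : (0 : ℝ) < n := Nat.cast_pos.2 (Fin.pos e.1.1)
  have h1 := integral_famVal_pow_le (L := L.filter fun l => γ l e = k) (c := c)
    (γ := fun l => Function.update (γ l) e 0) hν hK (b := b) (D := D) (m := m)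
    (fun l hl => h.coeff_le l (Finset.mem_filter.1 hl).1)
    (fun l hl f => by
      by_cases hf : f = e
      · subst hf; simp
      · simpa [hf] using h.exp_le l (Finset.mem_filter.1 hl).1 f) hJ
  refine (mul_le_mul_of_nonneg_left h1 (by positivity)).trans ?_
  rw [mul_left_comm]
  refine mul_le_mul_of_nonneg_left ?_ (by positivity)
  rw [sliceBound, Finset.mul_sum]
  refine Finset.sum_le_sum fun s hs => ?_
  have hunion : (Finset.univ.biUnion fun j => expSupp (Function.update (γ (s j)) e 0)) =
      (tupleSupp γ s).erase e := by
    simp only [expSupp_update_zero, tupleSupp]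
    ext f
    simp only [Finset.mem_biUnion, Finset.mem_univ, true_and, Finset.mem_erase]
    tauto
  have hmem : e ∈ tupleSupp γ s := by
    have h2 := Fintype.mem_piFinset.1 hs ⟨0, Nat.pos_of_ne_zero hm⟩
    rw [Finset.mem_filter] at h2
    exact Finset.mem_biUnion.2 ⟨_, Finset.mem_univ _, mem_expSupp.2 (h2.2 ▸ hk)⟩
  -- The missing factor is `K / n`, which is at least `1 / n` because `1 ≤ K`.
  rw [hunion, ← Finset.card_erase_add_one hmem, pow_succ, mul_comm]
  gcongr

/-- After exchanging the sums, a tuple is counted once for each edge at which all its exponents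
equal `k`, hence at most `m * S` times. Such a common edge makes the union connected, so the
weighted count of connected sets applies. -/
theorem LinkedFamily.sum_sliceBound_le (h : LinkedFamily L c γ R b D S N) (hn : 0 < n) {K : ℝ}
    (hK : 0 ≤ K) {m k : ℕ} (hm : m ≠ 0) (hk : k ≠ 0) :
    ∑ e, sliceBound L γ K m k e ≤ (m * S : ℕ) * (weightBound K S N m * R.card) := by
  classical
  set T := (Fintype.piFinset fun _ : Fin m => L).filter fun s => ∃ e, ∀ j, γ (s j) e = k with hT
  have hTL : ∀ s ∈ T, ∀ j, s j ∈ L := fun s hs j =>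
    Fintype.mem_piFinset.1 (Finset.mem_filter.1 hs).1 j
  have hsub : ∀ e, sliceBound L γ K m k e =
      ∑ s ∈ T, if ∀ j, γ (s j) e = k then (K / n) ^ (tupleSupp γ s).card else 0 := by
    intro e
    rw [sliceBound, ← Finset.sum_filter]
    refine Finset.sum_congr ?_ fun _ _ => rfl
    ext s
    simp only [hT, Fintype.mem_piFinset, Finset.mem_filter]
    constructor
    · intro hs
      exact ⟨⟨fun j => (hs j).1, e, fun j => (hs j).2⟩, fun j => (hs j).2⟩
    · rintro ⟨⟨hs, -⟩, hs'⟩ j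
      exact ⟨hs j, hs' j⟩
  simp only [hsub]
  rw [Finset.sum_comm]
  have hw := h.sum_weight_le hn hK T hTL (by
    intro s hs
    obtain ⟨e, he⟩ := (Finset.mem_filter.1 hs).2
    obtain ⟨r, hr, hl⟩ := h.linked _ (hTL s hs ⟨0, Nat.pos_of_ne_zero hm⟩)
    exact ⟨r, hr, linked_biUnion_of_mem (e := e)
      (fun j _ => (h.linked _ (hTL s hs j)).imp fun r hr => hr.2)
      (fun j _ => mem_expSupp.2 (by rw [he j]; exact hk)) (Finset.mem_univ _) hl⟩)
  refine le_trans ?_ (mul_le_mul_of_nonneg_left hw (Nat.cast_nonneg _))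
  rw [Finset.mul_sum]
  refine Finset.sum_le_sum fun s hs => ?_
  rw [← Finset.sum_filter, Finset.sum_const, nsmul_eq_mul]
  gcongr
  refine (Finset.card_le_card ?_).trans (h.card_tupleSupp_le (hTL s hs))
  intro e he
  rw [Finset.mem_filter] at he
  exact Finset.mem_biUnion.2 ⟨⟨0, Nat.pos_of_ne_zero hm⟩, Finset.mem_univ _,
    mem_expSupp.2 (by rw [he.2]; exact hk)⟩

end Influence

/-! ### Lindeberg replacement -/

section Swap

variable {V : Type*} [Fintype V] [DecidableEq V] {ι : Type*} {L : Finset ι} {c : ι → ℝ}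
  {γ : ι → V → ℕ} {n J D : ℕ} {κ K : ℝ} {ν₁ ν₂ : Measure ℝ}

theorem integrable_sliceSize {ν : V → Measure ℝ} (hν : ∀ e, SmallLaw n J K (ν e)) (e : V) :
    Integrable (fun x => sliceSize D (sliceVal L c γ e x)) (Measure.pi ν) := by
  refine (integrable_finsetSum _ fun k _ => (integrable_famVal hν).abs).add
    (integrable_finsetSum _ fun k _ => ?_)
  exact (integrable_famVal_pow hν 2).add (integrable_famVal_pow hν 4)

/-- Lindeberg's replacement of the law `ν₁` of all coordinates by `ν₂`. -/
theorem abs_integral_sub_le_of_sliceSize (hn : 0 < n) (h₁ : SmallLaw n J κ ν₁) (h₂ : SmallLaw n J κ ν₂)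
    (hJ : 3 * D + 3 ≤ J) (hD : ∀ l ∈ L, ∀ e, γ l e ≤ D) {φ φ₁ φ₂ : ℝ → ℝ} {B : ℝ}
    (hφ : TestFun φ φ₁ φ₂ B) {β : V → ℝ}
    (hβ : ∀ ν : V → Measure ℝ, (∀ f, SmallLaw n J κ (ν f)) → ∀ e,
      1 / (n : ℝ) * ∫ x, sliceSize D (sliceVal L c γ e x) ∂(Measure.pi ν) ≤ β e) :
    |∫ x, φ (famVal L c γ x) ∂(Measure.pi fun _ => ν₂) -
      ∫ x, φ (famVal L c γ x) ∂(Measure.pi fun _ => ν₁)| ≤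
        B * (8 * (D + 1) ^ 2) * κ * ∑ e, β e := by
  have := h₁.prob
  have := h₂.prob
  have hB : 0 ≤ B := (abs_nonneg _).trans (hφ.bound 0)
  -- The hybrid laws: the coordinates in `T` are already replaced. The induction on `T` adds one
  -- coordinate at a time.
  set μ : Finset V → V → Measure ℝ := fun T f => if f ∈ T then ν₂ else ν₁ with hμ
  have hμs : ∀ T f, SmallLaw n J κ (μ T f) := by
    intro T f
    simp only [hμ]
    split_ifs
    exacts [h₂, h₁]
  have hμp : ∀ T f, IsProbabilityMeasure (μ T f) := fun T f => (hμs T f).prob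
  have hκ : 0 ≤ κ / n := h₁.nonneg (by omega)
  have hcont : Continuous fun x => φ (famVal L c γ x) := hφ.cont.comp (continuous_famVal L c γ)
  have key : ∀ T : Finset V, |∫ x, φ (famVal L c γ x) ∂(Measure.pi (μ T)) -
      ∫ x, φ (famVal L c γ x) ∂(Measure.pi (μ ∅))| ≤
        ∑ e ∈ T, B * (8 * (D + 1) ^ 2) * κ * β e := by
    intro T
    induction T using Finset.induction_on with
    | empty => simp
    | insert e T he ih =>
      have e2 : μ (insert e T) = Function.update (μ T) e ν₂ := by
        funext f
        by_cases hf : f = e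
        · subst hf; simp [hμ]
        · simp [hμ, hf]
      -- A trivial update, which presents both hybrid laws as resamplings of coordinate `e` from the
      -- same base law.
      have e1 : μ T = Function.update (μ T) e ν₁ := by
        funext f
        by_cases hf : f = e
        · subst hf; simp [hμ, he]
        · simp [hf]
      have hstep : |∫ x, φ (famVal L c γ x) ∂(Measure.pi (μ (insert e T))) -
          ∫ x, φ (famVal L c γ x) ∂(Measure.pi (μ T))| ≤ B * (8 * (D + 1) ^ 2) * κ * β e := by
        have hupd : Continuous fun q : (V → ℝ) × ℝ => φ (famVal L c γ (Function.update q.1 e q.2)) :=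
          hcont.comp (continuous_fst.update e continuous_snd)
        have hint : ∀ ν : Measure ℝ, IsProbabilityMeasure ν → Integrable
            (fun x => ∫ t, φ (famVal L c γ (Function.update x e t)) ∂ν) (Measure.pi (μ T)) := by
          intro ν _
          refine Integrable.integral_prod_left (f := fun q : (V → ℝ) × ℝ =>
            φ (famVal L c γ (Function.update q.1 e q.2))) (ν := ν) ?_
          exact Integrable.of_bound hupd.measurable.aestronglyMeasurable B
            (.of_forall fun q => hφ.bound _)
        rw [e2, integral_pi_update (μ T) e ν₂ hcont fun x => hφ.bound _]
        nth_rewrite 2 [e1]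
        rw [integral_pi_update (μ T) e ν₁ hcont fun x => hφ.bound _,
          ← integral_sub (hint ν₂ inferInstance) (hint ν₁ inferInstance)]
        refine abs_integral_le_integral_abs.trans ?_
        have hpt : ∀ x, |∫ t, φ (famVal L c γ (Function.update x e t)) ∂ν₂ -
            ∫ t, φ (famVal L c γ (Function.update x e t)) ∂ν₁| ≤
              B * (8 * (D + 1) ^ 2) * (κ / n) * sliceSize D (sliceVal L c γ e x) := by
          intro x
          simp only [famVal_update fun l hl => hD l hl e]
          exact abs_resample_le h₂ h₁ hJ hφ _
        refine (integral_mono_of_nonneg (.of_forall fun _ => abs_nonneg _)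
          ((integrable_sliceSize (hμs T) e).const_mul _) (.of_forall hpt)).trans ?_
        rw [integral_const_mul]
        have hβe := hβ (μ T) (hμs T) e
        have hκ' : 0 ≤ κ := by
          have hn' : (0 : ℝ) < n := Nat.cast_pos.2 hn
          exact (div_nonneg_iff.1 hκ).elim (fun h => h.1) fun h => absurd h.2 (not_le.2 hn')
        calc _ = B * (8 * (D + 1) ^ 2) * κ * (1 / (n : ℝ) *
              ∫ x, sliceSize D (sliceVal L c γ e x) ∂(Measure.pi (μ T))) := by ring
          _ ≤ _ := by gcongr
      rw [Finset.sum_insert he]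
      refine (abs_sub_le _ (∫ x, φ (famVal L c γ x) ∂(Measure.pi (μ T))) _).trans ?_
      exact add_le_add hstep ih
  have := key Finset.univ
  rw [← Finset.mul_sum] at this
  simpa [hμ] using this

end Swap

/-! ### The invariance principle for connected families -/

section Lindeberg

variable {n : ℕ} {ι : Type*} {L : Finset ι} {c : ι → ℝ} {γ : ι → Edge n → ℕ}
  {R : Finset (Fin n)} {b κ K B : ℝ} {D S N J : ℕ} {ν₁ ν₂ : Measure ℝ} {φ φ₁ φ₂ : ℝ → ℝ}

/-- The constant in the bound for the sum of the influences. -/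
def influenceBound (K : ℝ) (D S N : ℕ) : ℝ :=
  D * ((2 * S : ℕ) * weightBound K S N 2 + (4 * S : ℕ) * weightBound K S N 4)

theorem sum_sliceBound_add_le (h : LinkedFamily L c γ R b D S N) (hn : 0 < n) (hK : 1 ≤ K) :
    ∑ e, ∑ k ∈ Finset.Icc 1 D, (b ^ 2 * sliceBound L γ K 2 k e + b ^ 4 * sliceBound L γ K 4 k e) ≤
      influenceBound K D S N * ((b ^ 2 + b ^ 4) * R.card) := by
  have hK0 : 0 ≤ K := zero_le_one.trans hK
  rw [Finset.sum_comm]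
  have hw2 := weightBound_nonneg hK0 S N 2
  have hw4 := weightBound_nonneg hK0 S N 4
  refine (Finset.sum_le_card_nsmul _ _
    (b ^ 2 * ((2 * S : ℕ) * (weightBound K S N 2 * R.card)) +
      b ^ 4 * ((4 * S : ℕ) * (weightBound K S N 4 * R.card))) fun k hk => ?_).trans ?_
  · have hk : k ≠ 0 := by
      have := (Finset.mem_Icc.1 hk).1
      omega
    rw [Finset.sum_add_distrib, ← Finset.mul_sum, ← Finset.mul_sum]
    gcongr
    · exact h.sum_sliceBound_le hn hK0 two_ne_zero hk
    · exact h.sum_sliceBound_le hn hK0 four_ne_zero hk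
  · rw [nsmul_eq_mul, Nat.card_Icc, Nat.add_sub_cancel, influenceBound]
    have e2 : 0 ≤ b ^ 4 * ((2 * S : ℕ) * (weightBound K S N 2 * R.card)) := by positivity
    have e4 : 0 ≤ b ^ 2 * ((4 * S : ℕ) * (weightBound K S N 4 * R.card)) := by positivity
    have hD : (0 : ℝ) ≤ D := Nat.cast_nonneg D
    nlinarith [mul_nonneg hD e2, mul_nonneg hD e4]

theorem integral_sliceSize_eq {ν : Edge n → Measure ℝ} (hν : ∀ e, SmallLaw n J K (ν e))
    (e : Edge n) :
    ∫ x, sliceSize D (sliceVal L c γ e x) ∂(Measure.pi ν) =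
      ∑ k ∈ Finset.Icc 3 D, ∫ x, |sliceVal L c γ e x k| ∂(Measure.pi ν) +
      ∑ k ∈ Finset.Icc 1 D, (∫ x, sliceVal L c γ e x k ^ 2 ∂(Measure.pi ν) +
        ∫ x, sliceVal L c γ e x k ^ 4 ∂(Measure.pi ν)) := by
  have i1 : ∀ k, Integrable (fun x => |sliceVal L c γ e x k|) (Measure.pi ν) :=
    fun k => (integrable_famVal hν).abs
  have i2 : ∀ k, Integrable (fun x => sliceVal L c γ e x k ^ 2) (Measure.pi ν) :=
    fun k => integrable_famVal_pow hν 2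
  have i4 : ∀ k, Integrable (fun x => sliceVal L c γ e x k ^ 4) (Measure.pi ν) :=
    fun k => integrable_famVal_pow hν 4
  have i24 : ∀ k, Integrable (fun x => sliceVal L c γ e x k ^ 2 + sliceVal L c γ e x k ^ 4)
      (Measure.pi ν) := fun k => (i2 k).add (i4 k)
  simp only [sliceSize]
  rw [integral_add (integrable_finsetSum _ fun k _ => i1 k)
      (integrable_finsetSum _ fun k _ => i24 k),
    integral_finsetSum _ fun k _ => i1 k, integral_finsetSum _ fun k _ => i24 k]
  congr 1
  refine Finset.sum_congr rfl fun k _ => ?_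
  exact integral_add (i2 k) (i4 k)

theorem LinkedFamily.integral_sliceVal_add_le (h : LinkedFamily L c γ R b D S N) (hK : 1 ≤ K)
    (hb : 0 ≤ b) (hJ : 4 * D + 3 ≤ J) {ν : Edge n → Measure ℝ}
    (hν : ∀ e, SmallLaw n J K (ν e)) (e : Edge n) :
    1 / (n : ℝ) * ∑ k ∈ Finset.Icc 1 D, (∫ x, sliceVal L c γ e x k ^ 2 ∂(Measure.pi ν) +
        ∫ x, sliceVal L c γ e x k ^ 4 ∂(Measure.pi ν)) ≤
      ∑ k ∈ Finset.Icc 1 D, (b ^ 2 * sliceBound L γ K 2 k e + b ^ 4 * sliceBound L γ K 4 k e) := by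
  rw [Finset.mul_sum]
  refine Finset.sum_le_sum fun k hk => ?_
  have hk : k ≠ 0 := by
    have := (Finset.mem_Icc.1 hk).1
    omega
  rw [mul_add]
  exact add_le_add (h.integral_sliceVal_pow_le hK hb two_ne_zero (by omega) hν hk e)
    (h.integral_sliceVal_pow_le hK hb four_ne_zero (by omega) hν hk e)

/-- Invariance for families with exponents at most two. -/
theorem LinkedFamily.abs_integral_sub_le_of_le_two (h : LinkedFamily L c γ R b D S N)
    (hn : 0 < n) (hK : 1 ≤ K) (hκ : κ ≤ K) (hb : 0 ≤ b) (hJ : 4 * D + 3 ≤ J) (hD : D ≤ 2)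
    (h₁ : SmallLaw n J κ ν₁) (h₂ : SmallLaw n J κ ν₂) (hφ : TestFun φ φ₁ φ₂ B) :
    |∫ x, φ (famVal L c γ x) ∂(Measure.pi fun _ => ν₂) -
      ∫ x, φ (famVal L c γ x) ∂(Measure.pi fun _ => ν₁)| ≤
        B * (8 * (D + 1) ^ 2) * κ * (influenceBound K D S N * ((b ^ 2 + b ^ 4) * R.card)) := by
  have hB : 0 ≤ B := (abs_nonneg _).trans (hφ.bound 0)
  have hκ0 : 0 ≤ κ := by
    have hn' : (0 : ℝ) < n := Nat.cast_pos.2 hn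
    exact (div_nonneg_iff.1 (h₁.nonneg (by omega))).elim (fun h => h.1)
      fun h => absurd h.2 (not_le.2 hn')
  refine (abs_integral_sub_le_of_sliceSize hn h₁ h₂ (by omega) h.exp_le hφ
    fun ν hν e => ?_).trans (mul_le_mul_of_nonneg_left (sum_sliceBound_add_le h hn hK)
      (by positivity))
  have hν' : ∀ e, SmallLaw n J K (ν e) := fun e => (hν e).mono hκ
  -- No exponent reaches 3, so the terms of first order in the slice coefficients disappear.
  rw [integral_sliceSize_eq hν', Finset.Icc_eq_empty (by omega), Finset.sum_empty, zero_add]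
  exact h.integral_sliceVal_add_le hK hb hJ hν' e

/-- Invariance for general families; the bound is useful if `b` is of order `1 / n`. -/
theorem LinkedFamily.abs_integral_sub_le (h : LinkedFamily L c γ R b D S N)
    (hn : 0 < n) (hK : 1 ≤ K) (hκ : κ ≤ K) (hb : 0 ≤ b) (hJ : 4 * D + 3 ≤ J)
    (h₁ : SmallLaw n J κ ν₁) (h₂ : SmallLaw n J κ ν₂) (hφ : TestFun φ φ₁ φ₂ B) :
    |∫ x, φ (famVal L c γ x) ∂(Measure.pi fun _ => ν₂) -
      ∫ x, φ (famVal L c γ x) ∂(Measure.pi fun _ => ν₁)| ≤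
        B * (8 * (D + 1) ^ 2) * κ * (D * (1 + n * (b ^ 2 * ((2 * S : ℕ) *
          (weightBound K S N 2 * R.card)))) +
          influenceBound K D S N * ((b ^ 2 + b ^ 4) * R.card)) := by
  have hn' : (0 : ℝ) < n := Nat.cast_pos.2 hn
  have hB : 0 ≤ B := (abs_nonneg _).trans (hφ.bound 0)
  have hK0 : 0 ≤ K := zero_le_one.trans hK
  have hκ0 : 0 ≤ κ := (div_nonneg_iff.1 (h₁.nonneg (by omega))).elim (fun h => h.1)
    fun h => absurd h.2 (not_le.2 hn')
  have hw2 := weightBound_nonneg hK0 S N 2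
  -- There are at most `n ^ 2` edges, so the summands `1 / n ^ 2` contribute at most 1. In the rest,
  -- `b` of order `1 / n` and `n` roots make `n * b ^ 2 * R.card` bounded.
  have hsum3 : ∑ e : Edge n, ∑ k ∈ Finset.Icc 3 D, (1 / (n : ℝ) ^ 2 +
      n * (b ^ 2 * sliceBound L γ K 2 k e)) ≤
        D * (1 + n * (b ^ 2 * ((2 * S : ℕ) * (weightBound K S N 2 * R.card)))) := by
    rw [Finset.sum_comm]
    have hcard : ((Finset.Icc 3 D).card : ℝ) ≤ D := by
      rw [Nat.card_Icc]
      exact_mod_cast (by omega : D + 1 - 3 ≤ D)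
    refine (Finset.sum_le_card_nsmul _ _
      (1 + n * (b ^ 2 * ((2 * S : ℕ) * (weightBound K S N 2 * R.card)))) fun k hk => ?_).trans ?_
    · have hk : k ≠ 0 := by
        have := (Finset.mem_Icc.1 hk).1
        omega
      rw [Finset.sum_add_distrib, ← Finset.mul_sum, ← Finset.mul_sum]
      gcongr
      · have hE : (Fintype.card (Edge n) : ℝ) ≤ (n : ℝ) ^ 2 := by
          have := Fintype.card_subtype_le fun e : Fin n × Fin n => e.1 < e.2
          rw [Fintype.card_prod, Fintype.card_fin, ← sq] at this
          exact_mod_cast this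
        rw [Finset.sum_const, nsmul_eq_mul, mul_one_div, Finset.card_univ]
        exact div_le_one_of_le₀ hE (by positivity)
      · exact h.sum_sliceBound_le hn hK0 two_ne_zero hk
    · rw [nsmul_eq_mul]
      gcongr
  refine (abs_integral_sub_le_of_sliceSize hn h₁ h₂ (by omega) h.exp_le hφ
    (β := fun e => ∑ k ∈ Finset.Icc 3 D, (1 / (n : ℝ) ^ 2 + n * (b ^ 2 * sliceBound L γ K 2 k e)) +
      ∑ k ∈ Finset.Icc 1 D, (b ^ 2 * sliceBound L γ K 2 k e + b ^ 4 * sliceBound L γ K 4 k e))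
    fun ν hν e => ?_).trans (mul_le_mul_of_nonneg_left ?_ (by positivity))
  · have hν' : ∀ e, SmallLaw n J K (ν e) := fun e => (hν e).mono hκ
    have hprob : ∀ e, IsProbabilityMeasure (ν e) := fun e => (hν e).prob
    rw [integral_sliceSize_eq hν', mul_add]
    refine add_le_add ?_ (h.integral_sliceVal_add_le hK hb hJ hν' e)
    rw [Finset.mul_sum]
    refine Finset.sum_le_sum fun k hk => ?_
    have hk : k ≠ 0 := by
      have := (Finset.mem_Icc.1 hk).1
      omega
    have i2 : Integrable (fun x => sliceVal L c γ e x k ^ 2) (Measure.pi ν) :=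
      integrable_famVal_pow hν' 2
    have hle : ∫ x, |sliceVal L c γ e x k| ∂(Measure.pi ν) ≤
        1 / n + n * ∫ x, sliceVal L c γ e x k ^ 2 ∂(Measure.pi ν) := by
      -- The arithmetic-geometric mean inequality with weight `n` turns the absolute value into a
      -- square, whose expectation can be expanded.
      have hpt : ∀ x, |sliceVal L c γ e x k| ≤ 1 / n + n * sliceVal L c γ e x k ^ 2 := by
        intro x
        rw [← sq_abs (sliceVal L c γ e x k)]
        set a := |sliceVal L c γ e x k| with ha
        have ha0 : 0 ≤ a := abs_nonneg _
        rw [← sub_nonneg]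
        have : 1 / (n : ℝ) + n * a ^ 2 - a = (((n : ℝ) * a - 1) ^ 2 + n * a) / n := by
          field_simp
          ring
        rw [this]
        positivity
      have i0 : Integrable (fun x => 1 / (n : ℝ) + n * sliceVal L c γ e x k ^ 2)
        (Measure.pi ν) := (integrable_const _).add (i2.const_mul _)
      refine (integral_mono_of_nonneg (.of_forall fun _ => abs_nonneg _) i0
        (.of_forall hpt)).trans (le_of_eq ?_)
      rw [integral_add (integrable_const _) (i2.const_mul _), integral_const_mul]
      simp
    have h2 := h.integral_sliceVal_pow_le hK hb two_ne_zero (by omega) hν' hk e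
    calc 1 / (n : ℝ) * ∫ x, |sliceVal L c γ e x k| ∂(Measure.pi ν)
        ≤ 1 / (n : ℝ) * (1 / n + n * ∫ x, sliceVal L c γ e x k ^ 2 ∂(Measure.pi ν)) := by gcongr
      _ = 1 / (n : ℝ) ^ 2 + n * (1 / (n : ℝ) * ∫ x, sliceVal L c γ e x k ^ 2 ∂(Measure.pi ν)) := by
        ring
      _ ≤ _ := by gcongr
  · rw [Finset.sum_add_distrib]
    exact add_le_add hsum3 (sum_sliceBound_add_le h hn hK)

end Lindeberg

/-! ### The laws of the entries -/

section SparseEntry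

variable {n : ℕ} {d : ℝ}

theorem isProbabilityMeasure_sparseEntryLaw (hd : 0 ≤ d) (hdn : d ≤ n) :
    IsProbabilityMeasure (sparseEntryLaw n d) := by
  constructor
  have h0 : 0 ≤ d / n := by positivity
  have h1 : d / n ≤ 1 := div_le_one_of_le₀ hdn (Nat.cast_nonneg n)
  simp only [sparseEntryLaw, Measure.add_apply, Measure.smul_apply, measure_univ, smul_eq_mul,
    mul_one]
  rw [← ENNReal.ofReal_add h0 (by linarith)]
  simp

theorem integrable_sparseEntryLaw (g : ℝ → ℝ) : Integrable g (sparseEntryLaw n d) := by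
  refine Integrable.add_measure ?_ ?_
  · exact (integrable_dirac (by simp)).smul_measure ENNReal.ofReal_ne_top
  · exact (integrable_dirac (by simp)).smul_measure ENNReal.ofReal_ne_top

theorem integral_sparseEntryLaw (hd : 0 ≤ d) (hdn : d ≤ n) (g : ℝ → ℝ) :
    ∫ t, g t ∂(sparseEntryLaw n d) =
      d / n * g (rescaledEntry n d 1) + (1 - d / n) * g (rescaledEntry n d 0) := by
  have h0 : 0 ≤ d / n := by positivity
  have h1 : d / n ≤ 1 := div_le_one_of_le₀ hdn (Nat.cast_nonneg n)
  rw [sparseEntryLaw, integral_add_measure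
    ((integrable_dirac (by simp)).smul_measure ENNReal.ofReal_ne_top)
    ((integrable_dirac (by simp)).smul_measure ENNReal.ofReal_ne_top), integral_smul_measure,
    integral_smul_measure, integral_dirac, integral_dirac, ENNReal.toReal_ofReal h0,
    ENNReal.toReal_ofReal (by linarith)]
  simp

theorem ae_sparseEntryLaw {p : ℝ → Prop} (h1 : p (rescaledEntry n d 1))
    (h0 : p (rescaledEntry n d 0)) : ∀ᵐ t ∂(sparseEntryLaw n d), p t := by
  rw [sparseEntryLaw, ae_add_measure_iff]
  exact ⟨Measure.ae_smul_measure (by simpa [ae_dirac_eq] using h1) _,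
    Measure.ae_smul_measure (by simpa [ae_dirac_eq] using h0) _⟩

theorem rescaledEntry_one_sq (hd : 0 < d) (hdn : 2 * d ≤ n) :
    rescaledEntry n d 1 ^ 2 = (1 - d / n) / d := by
  have hn : (0 : ℝ) < n := by linarith
  have hq : d / n ≤ 1 / 2 := by rw [div_le_iff₀ hn]; linarith
  have hq' : 0 < 1 - d / n := by linarith
  rw [rescaledEntry, mul_pow, neg_sq, div_pow, Real.sq_sqrt (by positivity)]
  field_simp

theorem rescaledEntry_zero_sq (hd : 0 < d) (hdn : 2 * d ≤ n) :
    rescaledEntry n d 0 ^ 2 = (d / n) ^ 2 / (d * (1 - d / n)) := by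
  have hn : (0 : ℝ) < n := by linarith
  have hq : d / n ≤ 1 / 2 := by rw [div_le_iff₀ hn]; linarith
  have hq' : 0 < 1 - d / n := by linarith
  rw [rescaledEntry, mul_pow, neg_sq, div_pow, Real.sq_sqrt (by positivity)]
  ring

theorem abs_rescaledEntry_one_le (hd : 0 < d) (hdn : 2 * d ≤ n) :
    |rescaledEntry n d 1| ≤ 1 / √d := by
  have hn : (0 : ℝ) < n := by linarith
  refine abs_le_of_sq_le_sq ?_ (by positivity)
  rw [rescaledEntry_one_sq hd hdn, div_pow, Real.sq_sqrt hd.le]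
  have : 0 ≤ d / n := by positivity
  gcongr
  linarith

theorem abs_rescaledEntry_zero_le (hd : 0 < d) (hdn : 2 * d ≤ n) :
    |rescaledEntry n d 0| ≤ 1 / √d := by
  have hn : (0 : ℝ) < n := by linarith
  have hq : d / n ≤ 1 / 2 := by rw [div_le_iff₀ hn]; linarith
  have hq0 : 0 < d / n := by positivity
  refine abs_le_of_sq_le_sq ?_ (by positivity)
  rw [rescaledEntry_zero_sq hd hdn, div_pow 1, Real.sq_sqrt hd.le, div_le_div_iff₀ (by nlinarith) hd]
  have h1 : (d / n) ^ 2 ≤ 1 ^ 2 * (1 - d / n) := by nlinarith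
  nlinarith

/-- An edge has an entry of order `1 / √d`, where the square dominates; for a non-edge (the
companion lemma) the order is `√d / n` and the term `1 / n` dominates. Together they replace
absolute values by squares, whose row sums have bounded moments. -/
theorem abs_rescaledEntry_one_le_sq (hd : 0 < d) (hdn : 2 * d ≤ n) :
    |rescaledEntry n d 1| ≤ √(2 * d) * (1 / n + rescaledEntry n d 1 ^ 2) := by
  have hn : (0 : ℝ) < n := by linarith
  have hq : d / n ≤ 1 / 2 := by rw [div_le_iff₀ hn]; linarith
  have h1 : 1 ≤ √(2 * d) * |rescaledEntry n d 1| := by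
    rw [← Real.sqrt_sq_eq_abs, ← Real.sqrt_mul (by positivity), rescaledEntry_one_sq hd hdn]
    refine Real.one_le_sqrt.2 ?_
    rw [mul_div_assoc', le_div_iff₀ hd]
    nlinarith
  have h2 : 0 ≤ √(2 * d) * (1 / n) := by positivity
  rw [← sq_abs (rescaledEntry n d 1)]
  nlinarith [abs_nonneg (rescaledEntry n d 1)]

theorem abs_rescaledEntry_zero_le_sq (hd : 0 < d) (hdn : 2 * d ≤ n) :
    |rescaledEntry n d 0| ≤ √(2 * d) * (1 / n + rescaledEntry n d 0 ^ 2) := by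
  have hn : (0 : ℝ) < n := by linarith
  have hq : d / n ≤ 1 / 2 := by rw [div_le_iff₀ hn]; linarith
  have h1 : |rescaledEntry n d 0| ≤ √(2 * d) * (1 / n) := by
    refine abs_le_of_sq_le_sq ?_ (by positivity)
    rw [rescaledEntry_zero_sq hd hdn, mul_pow, Real.sq_sqrt (by positivity),
      div_le_iff₀ (by nlinarith)]
    have e : 2 * d * (1 / (n : ℝ)) ^ 2 * (d * (1 - d / n)) = (d / n) ^ 2 * (2 * (1 - d / n)) := by
      field_simp
    rw [e]
    nlinarith [sq_nonneg (d / n)]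
  have h2 : 0 ≤ √(2 * d) * rescaledEntry n d 0 ^ 2 := by positivity
  linarith

theorem integral_id_sparseEntryLaw (hd : 0 ≤ d) (hdn : d ≤ n) :
    ∫ t, t ∂(sparseEntryLaw n d) = 0 := by
  rw [integral_sparseEntryLaw hd hdn]
  simp only [rescaledEntry]
  ring

theorem integral_sq_sparseEntryLaw (hd : 0 < d) (hdn : 2 * d ≤ n) :
    ∫ t, t ^ 2 ∂(sparseEntryLaw n d) = 1 / n := by
  have hn : (0 : ℝ) < n := by linarith
  have hq : d / n ≤ 1 / 2 := by rw [div_le_iff₀ hn]; linarith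
  have hq' : 0 < 1 - d / n := by linarith
  rw [integral_sparseEntryLaw hd.le (by linarith), rescaledEntry_one_sq hd hdn,
    rescaledEntry_zero_sq hd hdn]
  have e : (1 - d / n) * ((d / n) ^ 2 / (d * (1 - d / n))) = (d / n) ^ 2 / d := by
    clear hq
    generalize d / (n : ℝ) = q at *
    field_simp
  rw [e]
  field_simp
  ring

/-- The entries are bounded by `1 / √d ≤ 1`, so `|t| ^ k ≤ t ^ 2 / √d` for `k ≥ 3`, and the second
moment is `1 / n`. The factor `1 / √d` is the gain of the whole invariance argument. -/
theorem smallLaw_sparseEntryLaw (J : ℕ) (hd : 1 ≤ d) (hdn : 2 * d ≤ n) :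
    SmallLaw n J (1 / √d) (sparseEntryLaw n d) := by
  have hd0 : 0 < d := by linarith
  have hb : 1 / √d ≤ 1 := by
    rw [div_le_one (by positivity)]
    exact Real.one_le_sqrt.2 hd
  refine ⟨isProbabilityMeasure_sparseEntryLaw hd0.le (by linarith),
    fun k => integrable_sparseEntryLaw _, integral_id_sparseEntryLaw hd0.le (by linarith),
    integral_sq_sparseEntryLaw hd0 hdn, fun k hk _ => ?_⟩
  have hpt : ∀ t : ℝ, |t| ≤ 1 / √d → |t| ^ k ≤ 1 / √d * t ^ 2 := by
    intro t ht
    obtain ⟨j, rfl⟩ := Nat.exists_eq_add_of_le hk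
    have : |t| ^ (3 + j) = |t| ^ j * |t| * t ^ 2 := by rw [← sq_abs t]; ring
    rw [this]
    have h1 : |t| ^ j ≤ 1 := pow_le_one₀ (abs_nonneg t) (ht.trans hb)
    gcongr
    nlinarith [abs_nonneg t]
  calc ∫ t, |t| ^ k ∂(sparseEntryLaw n d) ≤ ∫ t, 1 / √d * t ^ 2 ∂(sparseEntryLaw n d) :=
        integral_mono_ae (integrable_sparseEntryLaw _) (integrable_sparseEntryLaw _)
          (ae_sparseEntryLaw (hpt _ (abs_rescaledEntry_one_le hd0 hdn))
            (hpt _ (abs_rescaledEntry_zero_le hd0 hdn)))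
    _ = 1 / √d / n := by
        rw [integral_const_mul, integral_sq_sparseEntryLaw hd0 hdn]
        ring

/-- A sub-Gaussian bound for the exponential moments. -/
theorem integral_exp_sparseEntryLaw_le (hd : 0 < d) (hdn : 2 * d ≤ n) {a : ℝ}
    (ha : |a| * (1 / √d) ≤ 1) :
    ∫ t, Real.exp (a * t) ∂(sparseEntryLaw n d) ≤ Real.exp (a ^ 2 / n) := by
  have := isProbabilityMeasure_sparseEntryLaw (n := n) hd.le (by linarith)
  -- For an exponent `x` of absolute value at most 1, `exp x ≤ 1 + x + x ^ 2`.
  have hpt : ∀ t : ℝ, |t| ≤ 1 / √d → Real.exp (a * t) ≤ 1 + a * t + a ^ 2 * t ^ 2 := by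
    intro t ht
    have h1 : |a * t| ≤ 1 := by
      rw [abs_mul]
      exact (mul_le_mul_of_nonneg_left ht (abs_nonneg a)).trans ha
    have := Real.abs_exp_sub_one_sub_id_le h1
    have := (abs_le.1 this).2
    nlinarith
  calc ∫ t, Real.exp (a * t) ∂(sparseEntryLaw n d)
      ≤ ∫ t, (1 + a * t + a ^ 2 * t ^ 2) ∂(sparseEntryLaw n d) :=
        integral_mono_ae (integrable_sparseEntryLaw _) (integrable_sparseEntryLaw _)
          (ae_sparseEntryLaw (hpt _ (abs_rescaledEntry_one_le hd hdn))
            (hpt _ (abs_rescaledEntry_zero_le hd hdn)))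
    _ = 1 + a ^ 2 / n := by
        rw [integral_add (integrable_sparseEntryLaw _) (integrable_sparseEntryLaw _),
          integral_add (integrable_sparseEntryLaw _) (integrable_sparseEntryLaw _),
          integral_const_mul, integral_const_mul, integral_sq_sparseEntryLaw hd hdn,
          integral_id_sparseEntryLaw hd.le (by linarith)]
        simp
        ring
    _ ≤ Real.exp (a ^ 2 / n) := by
        rw [add_comm]
        exact Real.add_one_le_exp _

end SparseEntry

/-- The absolute moments of the standard Gaussian. -/
def gaussianMoment (k : ℕ) : ℝ := ∫ t, |t| ^ k ∂(gaussianReal 0 1)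

theorem gaussianMoment_nonneg (k : ℕ) : 0 ≤ gaussianMoment k :=
  integral_nonneg fun _ => by positivity

theorem gaussianReal_inv_eq_map (n : ℕ) :
    gaussianReal 0 (n : ℝ≥0)⁻¹ = (gaussianReal 0 1).map (fun t => (√(n : ℝ))⁻¹ * t) := by
  rw [gaussianReal_map_const_mul, mul_zero, mul_one]
  congr 1
  ext
  simp

theorem integrable_pow_gaussianReal (v : ℝ≥0) (k : ℕ) :
    Integrable (fun t : ℝ => t ^ k) (gaussianReal 0 v) := by
  have h := (memLp_id_gaussianReal (μ := 0) (v := v) (k : ℝ≥0)).integrable_norm_pow'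
  refine (integrable_norm_iff (by fun_prop)).1 ?_
  simpa using h

/-- By scaling, the moment of order `k ≥ 3` is of size at most `n ^ (-3/2)`, and `d ≤ n` turns one
factor `1 / √n` into `1 / √d`, the same form as for the sparse law. -/
theorem exists_smallLaw_gaussianReal (J : ℕ) : ∃ K : ℝ, 1 ≤ K ∧ ∀ (n : ℕ) (d : ℝ), 1 ≤ d → d ≤ n →
    SmallLaw n J (K / √d) (gaussianReal 0 (n : ℝ≥0)⁻¹) := by
  refine ⟨1 + ∑ k ∈ Finset.range (J + 1), gaussianMoment k,
    le_add_of_nonneg_right (Finset.sum_nonneg fun k _ => gaussianMoment_nonneg k),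
    fun n d hd hdn => ?_⟩
  have hn : (1 : ℝ) ≤ n := hd.trans hdn
  have hn0 : (0 : ℝ) < n := by linarith
  refine ⟨inferInstance, integrable_pow_gaussianReal _, by simp, ?_, fun k hk hkJ => ?_⟩
  · have h := variance_fun_id_gaussianReal (μ := 0) (v := (n : ℝ≥0)⁻¹)
    rw [variance_of_integral_eq_zero (by fun_prop) (by simp)] at h
    simpa using h
  · have hM : gaussianMoment k ≤ 1 + ∑ k ∈ Finset.range (J + 1), gaussianMoment k := by
      have := Finset.single_le_sum (f := gaussianMoment) (fun k _ => gaussianMoment_nonneg k)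
        (Finset.mem_range.2 (Nat.lt_succ_of_le hkJ))
      linarith
    rw [gaussianReal_inv_eq_map, integral_map (by fun_prop) (by fun_prop)]
    simp only [abs_mul, mul_pow]
    rw [integral_const_mul, ← gaussianMoment]
    have hs : |(√(n : ℝ))⁻¹| ^ k ≤ 1 / √d / n := by
      rw [abs_of_nonneg (by positivity)]
      have h1 : (√(n : ℝ))⁻¹ ≤ 1 := inv_le_one_of_one_le₀ (Real.one_le_sqrt.2 hn)
      refine (pow_le_pow_of_le_one (by positivity) h1 hk).trans ?_
      have e : (√(n : ℝ))⁻¹ ^ 3 = (√(n : ℝ))⁻¹ / n := by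
        rw [pow_succ, inv_pow, Real.sq_sqrt hn0.le]
        ring
      rw [e, one_div]
      gcongr
    calc |(√(n : ℝ))⁻¹| ^ k * gaussianMoment k
        ≤ 1 / √d / n * (1 + ∑ k ∈ Finset.range (J + 1), gaussianMoment k) :=
          mul_le_mul hs hM (gaussianMoment_nonneg k) (by positivity)
      _ = _ := by ring

/-- Both disorder laws have small entries. -/
theorem exists_smallLaw (J : ℕ) : ∃ K : ℝ, 1 ≤ K ∧ ∀ (n : ℕ) (d : ℝ), 1 ≤ d → 2 * d ≤ n →
    SmallLaw n J (K / √d) (gaussianReal 0 (n : ℝ≥0)⁻¹) ∧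
      SmallLaw n J (K / √d) (sparseEntryLaw n d) ∧ K / √d ≤ K := by
  obtain ⟨K, hK, h⟩ := exists_smallLaw_gaussianReal J
  refine ⟨K, hK, fun n d hd hdn => ⟨h n d hd (by linarith),
    (smallLaw_sparseEntryLaw J hd hdn).mono (by gcongr), ?_⟩⟩
  exact div_le_self (by linarith) (Real.one_le_sqrt.2 hd)

/-! ### The families of monomials of the theorem -/

section TreeMonomials

variable {n : ℕ} {i : Fin n} {Δ : ℕ} {p : MvPolynomial (Edge n) ℝ}

/-- A walk in the factor graph cannot leave a closed set of nodes, and a tree has a walk from `i` to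
every other node. -/
theorem linked_expSupp_of_isTreeMonomial {α : Edge n →₀ ℕ} (hα : IsTreeMonomial α)
    (hi : ContainsNode i α) : Linked i (expSupp ⇑α) := by
  by_cases h0 : α = 0
  · have : expSupp ⇑α = ∅ := by
      ext e
      simp [mem_expSupp, h0]
    rw [this]
    exact linked_empty i
  replace hα := hα.resolve_left h0
  replace hi := hi.resolve_left h0
  intro W hiW hW e he
  have hadj : (factorGraph α).Adj e.1.1 e.1.2 := by
    rw [factorGraph, SimpleGraph.fromRel_adj]
    exact ⟨e.2.ne, .inl ⟨e.2, Nat.pos_of_ne_zero (mem_expSupp.1 he)⟩⟩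
  have he1 : e.1.1 ∈ (factorGraph α).support := ⟨_, hadj⟩
  have hclosed : ∀ a b, (factorGraph α).Adj a b → a ∈ W → b ∈ W := by
    intro a b hab ha
    rw [factorGraph, SimpleGraph.fromRel_adj] at hab
    rcases hab.2 with ⟨h, hpos⟩ | ⟨h, hpos⟩
    · exact (hW ⟨(a, b), h⟩ (mem_expSupp.2 hpos.ne')).1 ha
    · exact (hW ⟨(b, a), h⟩ (mem_expSupp.2 hpos.ne')).2 ha
  obtain ⟨w⟩ := hα.connected.preconnected ⟨i, hi⟩ ⟨e.1.1, he1⟩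
  have hwalk : ∀ a b : (factorGraph α).support,
      ((factorGraph α).induce (factorGraph α).support).Walk a b → (a : Fin n) ∈ W →
        (b : Fin n) ∈ W := by
    intro a b w
    induction w with
    | nil => exact id
    | cons h _ ih => exact fun ha => ih (hclosed _ _ h ha)
  exact hwalk _ _ w hiW

theorem abs_coeff_le_coeffNorm {α : Edge n →₀ ℕ} (hα : α ∈ p.support) :
    |p.coeff α| ≤ coeffNorm p := by
  have h := Finset.le_sup (f := fun α => ‖p.coeff α‖₊) hα
  have : ‖p.coeff α‖₊ ≤ coeffNorm p := h
  exact_mod_cast this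

theorem linkedFamily_of_isTreePoly (hp : IsTreePoly Δ p) (hi : PolyContains i p) {c : ℝ}
    (hc : (coeffNorm p : ℝ) ≤ c) :
    LinkedFamily p.support (fun α => p.coeff α) (fun α => ⇑α) {i} c 2 Δ 3 where
  coeff_le α hα := (abs_coeff_le_coeffNorm hα).trans hc
  exp_le α hα := (hp α hα).2.1
  card_le α hα := by
    refine le_trans ?_ (hp α hα).2.2
    have h : expSupp ⇑α = α.support := by
      ext e
      simp [mem_expSupp]
    rw [h, Finsupp.sum, Finset.card_eq_sum_ones]
    exact Finset.sum_le_sum fun e he => Nat.one_le_iff_ne_zero.2 (Finsupp.mem_support_iff.1 he)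
  linked α hα := ⟨i, by simp, linked_expSupp_of_isTreeMonomial (hp α hα).1 (hi α hα)⟩
  -- An exponent supported in `U` is a function from `U` to {0, 1, 2}, whence `N = 3`.
  mult U T hT hU := by
    classical
    have h := Finset.card_le_card_of_injOn (s := T)
      (t := Fintype.piFinset fun e : Edge n => if e ∈ U then Finset.range 3 else {0})
      (fun α => ⇑α) (by
        intro α hα
        refine Finset.mem_coe.2 (Fintype.mem_piFinset.2 fun e => ?_)
        by_cases he : e ∈ U
        · simpa [he, Nat.lt_succ_iff] using (hp α (hT hα)).2.1 e
        · have : e ∉ expSupp ⇑α := fun h => he (hU α hα h)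
          simpa [he, mem_expSupp] using this) (fun a _ b _ hab => DFunLike.coe_injective hab)
    refine h.trans (le_of_eq ?_)
    rw [Fintype.card_piFinset, ← Finset.prod_const, ← Finset.prod_filter_mul_prod_filter_not
      Finset.univ (· ∈ U), Finset.prod_congr rfl (g := fun _ => 3)
      (fun e he => by rw [if_pos (Finset.mem_filter.1 he).2, Finset.card_range]),
      Finset.prod_eq_one (s := Finset.univ.filter (· ∉ U))
      (fun e he => by rw [if_neg (Finset.mem_filter.1 he).2, Finset.card_singleton])]
    simp

theorem eval_eq_famVal (x : Edge n → ℝ) : MvPolynomial.eval x p =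
    famVal p.support (fun α => p.coeff α) (fun α => ⇑α) x :=
  MvPolynomial.eval_eq' x p

end TreeMonomials

/-! ### Multiplying monomials by a power of one variable -/

section Attach

variable {n : ℕ} {ι : Type*}

/-- The exponents of `x e ^ k` times a monomial. -/
def attachExp (k : ℕ) (γ : Edge n → ι → Edge n → ℕ) (q : Σ _ : Edge n, ι) (f : Edge n) : ℕ :=
  (if f = q.1 then k else 0) + γ q.1 q.2 f

theorem expSupp_attachExp {k : ℕ} (hk : k ≠ 0) (γ : Edge n → ι → Edge n → ℕ)
    (q : Σ _ : Edge n, ι) :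
    expSupp (attachExp k γ q) = {q.1} ∪ expSupp (γ q.1 q.2) := by
  ext f
  by_cases hf : f = q.1
  · subst hf; simp [mem_expSupp, attachExp, hk]
  · simp [mem_expSupp, attachExp, hf]

theorem famVal_attachExp (k : ℕ) (A : Finset (Edge n)) (L : Edge n → Finset ι)
    (c : Edge n → ι → ℝ) (γ : Edge n → ι → Edge n → ℕ) (x : Edge n → ℝ) :
    famVal (A.sigma L) (fun q => c q.1 q.2) (attachExp k γ) x =
      ∑ e ∈ A, x e ^ k * famVal (L e) (c e) (γ e) x := by
  rw [famVal, Finset.sum_sigma]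
  refine Finset.sum_congr rfl fun e _ => ?_
  rw [famVal, Finset.mul_sum]
  refine Finset.sum_congr rfl fun l _ => ?_
  simp only [attachExp, pow_add, Finset.prod_mul_distrib]
  have : ∏ f, x f ^ (if f = e then k else 0) = x e ^ k := by
    rw [Finset.prod_eq_single e (fun f _ hf => by simp [hf]) (by simp)]
    simp
  rw [this]
  ring

theorem linkedFamily_attachExp {k : ℕ} (hk : k ≠ 0) {A : Finset (Edge n)}
    {L : Edge n → Finset ι} {c : Edge n → ι → ℝ} {γ : Edge n → ι → Edge n → ℕ}
    {R : Finset (Fin n)} {b : ℝ} {D S N : ℕ}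
    (hc : ∀ e ∈ A, ∀ l ∈ L e, |c e l| ≤ b) (hD : ∀ e ∈ A, ∀ l ∈ L e, ∀ f, γ e l f ≤ D)
    (hS : ∀ e ∈ A, ∀ l ∈ L e, (expSupp (γ e l)).card ≤ S)
    (hlink : ∀ e ∈ A, ∀ l ∈ L e, ∃ r ∈ R, Linked r ({e} ∪ expSupp (γ e l)))
    (hN : ∀ e ∈ A, ∀ U : Finset (Edge n), ∀ T ⊆ L e, (∀ l ∈ T, expSupp (γ e l) ⊆ U) →
      T.card ≤ N ^ U.card) :
    LinkedFamily (A.sigma L) (fun q => c q.1 q.2) (attachExp k γ) R b (k + D) (1 + S) (2 * N) where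
  coeff_le q hq := hc _ (Finset.mem_sigma.1 hq).1 _ (Finset.mem_sigma.1 hq).2
  exp_le q hq f := by
    have := hD _ (Finset.mem_sigma.1 hq).1 _ (Finset.mem_sigma.1 hq).2 f
    unfold attachExp
    split_ifs <;> omega
  card_le q hq := by
    rw [expSupp_attachExp hk]
    refine (Finset.card_union_le _ _).trans ?_
    rw [Finset.card_singleton]
    exact Nat.add_le_add_left (hS _ (Finset.mem_sigma.1 hq).1 _ (Finset.mem_sigma.1 hq).2) 1
  linked q hq := by
    rw [expSupp_attachExp hk]
    exact hlink _ (Finset.mem_sigma.1 hq).1 _ (Finset.mem_sigma.1 hq).2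
  mult U T hT hU := by
    classical
    have hsub : T ⊆ (A.filter (· ∈ U)).sigma fun e => (L e).filter fun l => expSupp (γ e l) ⊆ U := by
      intro q hq
      have h1 := Finset.mem_sigma.1 (hT hq)
      have h2 := hU q hq
      rw [expSupp_attachExp hk] at h2
      rw [Finset.mem_sigma, Finset.mem_filter, Finset.mem_filter]
      exact ⟨⟨h1.1, h2 (by simp)⟩, h1.2, Finset.subset_union_right.trans h2⟩
    refine (Finset.card_le_card hsub).trans ?_
    rw [Finset.card_sigma]
    refine (Finset.sum_le_card_nsmul _ _ (N ^ U.card) fun e he => ?_).trans ?_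
    · exact hN e (Finset.mem_filter.1 he).1 U _ (Finset.filter_subset _ _)
        fun l hl => (Finset.mem_filter.1 hl).2
    -- The attached edge lies in `U`; its at most `U.card ≤ 2 ^ U.card` choices are absorbed by the
    -- passage from `N` to `2 * N`.
    · rw [smul_eq_mul, mul_pow]
      gcongr
      refine (Finset.card_le_card fun e he => (Finset.mem_filter.1 he).2).trans
        (Nat.lt_two_pow_self (n := U.card)).le

end Attach

/-! ### The quadratic form as a sum over edges -/

section QuadraticForm

variable {n : ℕ}

theorem sum_symMatrix_mul (x : Edge n → ℝ) (g : Fin n → Fin n → ℝ) :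
    ∑ i, ∑ j, symMatrix x i j * g i j = ∑ e : Edge n, x e * (g e.1.1 e.1.2 + g e.1.2 e.1.1) := by
  have hlt : ∀ f : Fin n × Fin n → ℝ,
      ∑ q ∈ Finset.univ.filter (fun q : Fin n × Fin n => q.1 < q.2), f q = ∑ e : Edge n, f e.1 :=
    fun f => Finset.sum_subtype _ (by simp) f
  rw [← Finset.sum_product', Finset.univ_product_univ]
  have hsplit : ∀ q : Fin n × Fin n, symMatrix x q.1 q.2 * g q.1 q.2 =
      (if q.1 < q.2 then symMatrix x q.1 q.2 * g q.1 q.2 else 0) +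
        (if q.2 < q.1 then symMatrix x q.1 q.2 * g q.1 q.2 else 0) := by
    intro q
    rcases lt_trichotomy q.1 q.2 with h | h | h
    · simp [h, h.le]
    · simp [h, symMatrix]
    · simp [h, h.le]
  rw [Finset.sum_congr rfl fun q _ => hsplit q, Finset.sum_add_distrib]
  have hswap : ∑ q : Fin n × Fin n, (if q.2 < q.1 then symMatrix x q.1 q.2 * g q.1 q.2 else 0) =
      ∑ q : Fin n × Fin n, (if q.1 < q.2 then symMatrix x q.2 q.1 * g q.2 q.1 else 0) :=
    (Equiv.prodComm (Fin n) (Fin n)).sum_comp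
      fun q : Fin n × Fin n => if q.1 < q.2 then symMatrix x q.2 q.1 * g q.2 q.1 else 0
  rw [hswap, ← Finset.sum_filter, ← Finset.sum_filter, hlt, hlt, ← Finset.sum_add_distrib]
  refine Finset.sum_congr rfl fun e _ => ?_
  have h1 : symMatrix x e.1.1 e.1.2 = x e := by simp [symMatrix, e.2]
  have h2 : symMatrix x e.1.2 e.1.1 = x e := by simp [symMatrix, e.2, e.2.not_gt]
  rw [h1, h2]
  ring

theorem dotProduct_symMatrix_mulVec (x : Edge n → ℝ) (u v : Fin n → ℝ) :
    u ⬝ᵥ (symMatrix x).mulVec v = ∑ e : Edge n, x e * (u e.1.1 * v e.1.2 + u e.1.2 * v e.1.1) := by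
  rw [← sum_symMatrix_mul x fun i j => u i * v j]
  simp only [dotProduct, Matrix.mulVec, Finset.mul_sum]
  refine Finset.sum_congr rfl fun i _ => Finset.sum_congr rfl fun j _ => ?_
  ring

theorem quad_symMatrix (x : Edge n → ℝ) (v : Fin n → ℝ) :
    quad (symMatrix x) v = 2 * ∑ e : Edge n, x e * (v e.1.1 * v e.1.2) := by
  rw [quad, dotProduct_symMatrix_mulVec, Finset.mul_sum]
  refine Finset.sum_congr rfl fun e _ => ?_
  ring

/-- The edges at the node `i`. -/
def edgesAt (i : Fin n) : Finset (Edge n) :=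
  Finset.univ.filter fun e => e.1.1 = i ∨ e.1.2 = i

/-- The end point of an edge at `i` that differs from `i`. -/
def otherEnd (i : Fin n) (e : Edge n) : Fin n := if e.1.1 = i then e.1.2 else e.1.1

theorem symMatrix_mulVec (x : Edge n → ℝ) (v : Fin n → ℝ) (i : Fin n) :
    (symMatrix x).mulVec v i = ∑ e ∈ edgesAt i, x e * v (otherEnd i e) := by
  have h := dotProduct_symMatrix_mulVec x (Pi.single i 1) v
  rw [single_one_dotProduct] at h
  rw [h, edgesAt, Finset.sum_filter]
  refine Finset.sum_congr rfl fun e _ => ?_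
  have hne : e.1.1 ≠ e.1.2 := e.2.ne
  by_cases h1 : e.1.1 = i
  · have h2 : e.1.2 ≠ i := fun h => hne (h1.trans h.symm)
    simp [h1, h2, otherEnd]
  · by_cases h2 : e.1.2 = i
    · simp [h1, h2, otherEnd]
    · simp [h1, h2]

theorem linked_singleton_of_mem_edgesAt {i : Fin n} {e : Edge n} (he : e ∈ edgesAt i) :
    Linked i {e} := by
  rcases (Finset.mem_filter.1 he).2 with h | h
  · exact h ▸ linked_singleton_left e
  · exact h ▸ linked_singleton_right e

theorem otherEnd_mem_nodesFrom (i : Fin n) (e : Edge n) : otherEnd i e ∈ nodesFrom i {e} := by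
  refine mem_nodesFrom.2 (.inr ⟨e, by simp, ?_⟩)
  unfold otherEnd
  split_ifs <;> simp

end QuadraticForm

/-! ### Rows, row norms and objective as connected families -/

section Families

variable {n Δ : ℕ} {p : Fin n → MvPolynomial (Edge n) ℝ} {c : ℝ}

/-- The entries of the product of the matrix with the vector of polynomials are polynomials with
connected monomials. -/
theorem exists_linkedFamily_mulVec (htree : ∀ i, IsTreePoly Δ (p i))
    (hcoeff : ∀ i, (coeffNorm (p i) : ℝ) ≤ c) (hnode : ∀ i, PolyContains i (p i)) (i : Fin n) :
    ∃ (L : Finset (Σ _ : Edge n, Edge n →₀ ℕ)) (a : (Σ _ : Edge n, Edge n →₀ ℕ) → ℝ)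
      (γ : (Σ _ : Edge n, Edge n →₀ ℕ) → Edge n → ℕ),
      LinkedFamily L a γ {i} c (1 + 2) (1 + Δ) (2 * 3) ∧
        ∀ x, (symMatrix x).mulVec (evalVec p x) i = famVal L a γ x := by
  have hfam := fun j => linkedFamily_of_isTreePoly (htree j) (hnode j) (hcoeff j)
  refine ⟨(edgesAt i).sigma fun e => (p (otherEnd i e)).support,
    fun q => (p (otherEnd i q.1)).coeff q.2, attachExp 1 fun _ α => ⇑α,
    linkedFamily_attachExp (c := fun e α => (p (otherEnd i e)).coeff α) one_ne_zero
      (fun e _ => (hfam _).coeff_le) (fun e _ => (hfam _).exp_le) (fun e _ => (hfam _).card_le)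
      (fun e he l hl => ⟨i, by simp, ?_⟩) (fun e _ => (hfam _).mult), fun x => ?_⟩
  · obtain ⟨r, hr, hl⟩ := (hfam (otherEnd i e)).linked l hl
    rw [Finset.mem_singleton.1 hr] at hl
    exact (linked_singleton_of_mem_edgesAt he).union hl (otherEnd_mem_nodesFrom i e)
  · rw [symMatrix_mulVec, famVal_attachExp 1 _ _ (fun e α => (p (otherEnd i e)).coeff α)]
    simp only [pow_one, evalVec, eval_eq_famVal]

/-- The sums of the squares of the rows of the matrix. -/
theorem exists_linkedFamily_rowSq (i : Fin n) :
    ∃ (L : Finset (Σ _ : Edge n, Unit)) (a : (Σ _ : Edge n, Unit) → ℝ)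
      (γ : (Σ _ : Edge n, Unit) → Edge n → ℕ),
      LinkedFamily L a γ {i} 1 (2 + 0) (1 + 0) (2 * 1) ∧
        ∀ x, ∑ e ∈ edgesAt i, x e ^ 2 = famVal L a γ x := by
  refine ⟨(edgesAt i).sigma fun _ => Finset.univ, fun _ => 1, attachExp 2 fun _ _ _ => 0,
    linkedFamily_attachExp (c := fun _ _ => 1) two_ne_zero (by simp) (by simp)
      (by simp [expSupp]) (fun e he l _ => ⟨i, by simp, ?_⟩) ?_, fun x => ?_⟩
  · simpa [expSupp] using linked_singleton_of_mem_edgesAt he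
  · intro e _ U T _ _
    rw [one_pow]
    exact Finset.card_le_one_of_subsingleton T
  · rw [famVal_attachExp 2 _ _ (fun _ _ => 1)]
    simp [famVal]

/-- The objective is a polynomial with connected monomials and coefficients of order `1 / n`. -/
theorem exists_linkedFamily_objective (htree : ∀ i, IsTreePoly Δ (p i))
    (hcoeff : ∀ i, (coeffNorm (p i) : ℝ) ≤ c) (hnode : ∀ i, PolyContains i (p i)) :
    ∃ (L : Finset (Σ _ : Edge n, (Edge n →₀ ℕ) × (Edge n →₀ ℕ)))
      (a : (Σ _ : Edge n, (Edge n →₀ ℕ) × (Edge n →₀ ℕ)) → ℝ)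
      (γ : (Σ _ : Edge n, (Edge n →₀ ℕ) × (Edge n →₀ ℕ)) → Edge n → ℕ),
      LinkedFamily L a γ Finset.univ (c ^ 2 / n) (1 + 4) (1 + 2 * Δ) (2 * 9) ∧
        ∀ x, objective (symMatrix x) (evalVec p x) = famVal L a γ x := by
  have hfam := fun j => linkedFamily_of_isTreePoly (htree j) (hnode j) (hcoeff j)
  have hsupp : ∀ l : (Edge n →₀ ℕ) × (Edge n →₀ ℕ),
      expSupp (fun f => l.1 f + l.2 f) = expSupp ⇑l.1 ∪ expSupp ⇑l.2 := by
    intro l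
    ext f
    simp only [mem_expSupp, Finset.mem_union]
    omega
  refine ⟨Finset.univ.sigma fun e => (p e.1.1).support ×ˢ (p e.1.2).support,
    fun q => 1 / n * ((p q.1.1.1).coeff q.2.1 * (p q.1.1.2).coeff q.2.2),
    attachExp 1 fun _ l f => l.1 f + l.2 f,
    linkedFamily_attachExp
      (c := fun e (l : (Edge n →₀ ℕ) × (Edge n →₀ ℕ)) =>
        1 / n * ((p e.1.1).coeff l.1 * (p e.1.2).coeff l.2)) one_ne_zero
      (fun e _ l hl => ?_) (fun e _ l hl f => ?_) (fun e _ l hl => ?_) (fun e _ l hl => ?_)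
      (fun e _ U T hT hU => ?_), fun x => ?_⟩
  · have h1 := (hfam _).coeff_le l.1 (Finset.mem_product.1 hl).1
    have h2 := (hfam _).coeff_le l.2 (Finset.mem_product.1 hl).2
    rw [abs_mul, abs_mul, abs_of_nonneg (by positivity : (0 : ℝ) ≤ 1 / n)]
    calc 1 / (n : ℝ) * (|(p e.1.1).coeff l.1| * |(p e.1.2).coeff l.2|) ≤ 1 / n * (c * c) := by
          gcongr
          exact (abs_nonneg _).trans h1
      _ = c ^ 2 / n := by ring
  · have h1 := (hfam _).exp_le l.1 (Finset.mem_product.1 hl).1 f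
    have h2 := (hfam _).exp_le l.2 (Finset.mem_product.1 hl).2 f
    omega
  · have h1 := (hfam _).card_le l.1 (Finset.mem_product.1 hl).1
    have h2 := (hfam _).card_le l.2 (Finset.mem_product.1 hl).2
    rw [hsupp]
    refine (Finset.card_union_le _ _).trans ?_
    omega
  · obtain ⟨r1, hr1, hl1⟩ := (hfam e.1.1).linked l.1 (Finset.mem_product.1 hl).1
    obtain ⟨r2, hr2, hl2⟩ := (hfam e.1.2).linked l.2 (Finset.mem_product.1 hl).2
    rw [Finset.mem_singleton.1 hr1] at hl1
    rw [Finset.mem_singleton.1 hr2] at hl2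
    refine ⟨e.1.1, Finset.mem_univ _, ?_⟩
    -- The edge `e` joins the two trees, which contain one end point of `e` each.
    rw [hsupp, ← Finset.union_assoc]
    refine ((linked_singleton_left e).union hl1 (mem_nodesFrom.2 (.inl rfl))).union hl2 ?_
    exact mem_nodesFrom.2 (.inr ⟨e, by simp, .inr rfl⟩)
  -- A set of pairs lies in the product of its projections, so the multiplicity is at most `3 ^ k *
  -- 3 ^ k = 9 ^ k`.
  · have hsub : T ⊆ T.image Prod.fst ×ˢ T.image Prod.snd := by
      intro l hl
      exact Finset.mem_product.2 ⟨Finset.mem_image_of_mem _ hl, Finset.mem_image_of_mem _ hl⟩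
    have h1 := (hfam e.1.1).mult U (T.image Prod.fst) (by
      intro α hα
      obtain ⟨l, hl, rfl⟩ := Finset.mem_image.1 hα
      exact (Finset.mem_product.1 (hT hl)).1) (by
      intro α hα
      obtain ⟨l, hl, rfl⟩ := Finset.mem_image.1 hα
      exact (Finset.subset_union_left.trans (hsupp l).ge).trans (hU l hl))
    have h2 := (hfam e.1.2).mult U (T.image Prod.snd) (by
      intro α hα
      obtain ⟨l, hl, rfl⟩ := Finset.mem_image.1 hα
      exact (Finset.mem_product.1 (hT hl)).2) (by
      intro α hα
      obtain ⟨l, hl, rfl⟩ := Finset.mem_image.1 hα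
      exact (Finset.subset_union_right.trans (hsupp l).ge).trans (hU l hl))
    refine (Finset.card_le_card hsub).trans ?_
    rw [Finset.card_product, show 9 = 3 * 3 from rfl, mul_pow]
    exact Nat.mul_le_mul h1 h2
  · rw [famVal_attachExp 1 _ _
      (fun e (l : (Edge n →₀ ℕ) × (Edge n →₀ ℕ)) =>
        1 / n * ((p e.1.1).coeff l.1 * (p e.1.2).coeff l.2)), objective, quad_symMatrix,
      ← mul_assoc, Finset.mul_sum]
    refine Finset.sum_congr rfl fun e _ => ?_
    rw [pow_one, evalVec, evalVec, eval_eq_famVal, eval_eq_famVal, famVal, famVal, famVal,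
      Finset.sum_mul_sum, ← Finset.sum_product', mul_left_comm]
    congr 1
    rw [Finset.mul_sum]
    refine Finset.sum_congr rfl fun l _ => ?_
    simp only [pow_add, Finset.prod_mul_distrib]
    by_cases hn : (n : ℝ) = 0
    · simp [hn]
    · field_simp

end Families

/-! ### Smooth steps as test functions -/

/-- The mean value inequality on the ball of radius `|h|`. Three applications, starting from a bound
for the third derivative, give the Taylor remainder; the factorials are not needed. -/
theorem abs_le_of_abs_deriv_le {g : ℝ → ℝ} (hg : Differentiable ℝ g) (h0 : g 0 = 0) {C : ℝ}
    (hC : 0 ≤ C) {k : ℕ} (hk : ∀ h, |deriv g h| ≤ C * |h| ^ k) (h : ℝ) :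
    |g h| ≤ C * |h| ^ (k + 1) := by
  have := Convex.norm_image_sub_le_of_norm_deriv_le (f := g) (C := C * |h| ^ k)
    (s := Metric.closedBall 0 |h|) (x := 0) (y := h) (fun x _ => hg x)
    (fun x hx => by
      rw [Real.norm_eq_abs]
      rw [mem_closedBall_zero_iff, Real.norm_eq_abs] at hx
      exact (hk x).trans (by gcongr)) (convex_closedBall 0 _) (by simp) (by simp)
  rw [h0, sub_zero, sub_zero, Real.norm_eq_abs, Real.norm_eq_abs] at this
  rwa [pow_succ, ← mul_assoc]

/-- A function that is locally constant off a compact set has compactly supported, hence bounded,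
derivatives. The expansion coefficients are the first derivative and half the second. -/
theorem exists_testFun {φ : ℝ → ℝ} (hφ : ContDiff ℝ 3 φ) {K : Set ℝ} (hK : IsCompact K)
    (hconst : ∀ x ∉ K, ∃ a, ∀ᶠ y in 𝓝 x, φ y = a) (hbound : ∃ B, ∀ a, |φ a| ≤ B) :
    ∃ φ₁ φ₂ B, TestFun φ φ₁ φ₂ B := by
  have hs1 : HasCompactSupport (deriv φ) := by
    refine HasCompactSupport.intro hK fun x hx => ?_
    obtain ⟨a, ha⟩ := hconst x hx
    rw [Filter.EventuallyEq.deriv_eq (f := fun _ => a) ha]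
    simp
  have hs2 : HasCompactSupport (deriv (deriv φ)) := hs1.deriv
  have hs3 : HasCompactSupport (deriv (deriv (deriv φ))) := hs2.deriv
  have hc1 : ContDiff ℝ 2 (deriv φ) := (contDiff_succ_iff_deriv (n := 2)).1 hφ |>.2.2
  have hc2 : ContDiff ℝ 1 (deriv (deriv φ)) := (contDiff_succ_iff_deriv (n := 1)).1 hc1 |>.2.2
  have hc3 : ContDiff ℝ 0 (deriv (deriv (deriv φ))) :=
    (contDiff_succ_iff_deriv (n := 0)).1 hc2 |>.2.2
  obtain ⟨B0, hB0⟩ := hbound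
  obtain ⟨B1, hB1⟩ := hc1.continuous.bounded_above_of_compact_support hs1
  obtain ⟨B2, hB2⟩ := hc2.continuous.bounded_above_of_compact_support hs2
  obtain ⟨B3, hB3⟩ := hc3.continuous.bounded_above_of_compact_support hs3
  have n0 : 0 ≤ B0 := (abs_nonneg _).trans (hB0 0)
  have n1 : 0 ≤ B1 := (norm_nonneg _).trans (hB1 0)
  have n2 : 0 ≤ B2 := (norm_nonneg _).trans (hB2 0)
  have n3 : 0 ≤ B3 := (norm_nonneg _).trans (hB3 0)
  have d0 : Differentiable ℝ φ := hφ.differentiable (by norm_num)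
  have d1 : Differentiable ℝ (deriv φ) := hc1.differentiable (by norm_num)
  have d2 : Differentiable ℝ (deriv (deriv φ)) := hc2.differentiable (by norm_num)
  refine ⟨deriv φ, fun a => deriv (deriv φ) a / 2, B0 + B1 + B2 + B3, hφ.continuous,
    fun a => (hB0 a).trans (by linarith), fun a => (hB1 a).trans (by linarith), fun a => ?_,
    fun a h => ?_⟩
  · have := hB2 a
    rw [Real.norm_eq_abs] at this
    rw [abs_div, abs_two]
    linarith [abs_nonneg (deriv (deriv φ) a)]
  · have hshift : ∀ {g : ℝ → ℝ}, Differentiable ℝ g → ∀ h,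
        HasDerivAt (fun h => g (a + h)) (deriv g (a + h)) h := fun hg h => by
      simpa using (hg (a + h)).hasDerivAt.comp_const_add a h
    have e2 : ∀ h, |deriv (deriv φ) (a + h) - deriv (deriv φ) a| ≤ B3 * |h| ^ (0 + 1) := by
      have hd : ∀ h, HasDerivAt (fun h => deriv (deriv φ) (a + h) - deriv (deriv φ) a)
          (deriv (deriv (deriv φ)) (a + h)) h := fun h => (hshift d2 h).sub_const _
      refine abs_le_of_abs_deriv_le (fun h => (hd h).differentiableAt) (by simp) n3 fun h => ?_
      rw [(hd h).deriv]
      simpa using hB3 (a + h)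
    have e1 : ∀ h, |deriv φ (a + h) - deriv φ a - deriv (deriv φ) a * h| ≤
        B3 * |h| ^ (0 + 1 + 1) := by
      have hd : ∀ h, HasDerivAt (fun h => deriv φ (a + h) - deriv φ a - deriv (deriv φ) a * h)
          (deriv (deriv φ) (a + h) - deriv (deriv φ) a) h := fun h =>
        (((hshift d1 h).sub_const (deriv φ a)).sub
          ((hasDerivAt_id h).const_mul (deriv (deriv φ) a))).congr_deriv (by simp)
      refine abs_le_of_abs_deriv_le (fun h => (hd h).differentiableAt) (by simp) n3 fun h => ?_
      rw [(hd h).deriv]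
      exact e2 h
    have e0 : ∀ h, |φ (a + h) - φ a - deriv φ a * h - deriv (deriv φ) a / 2 * h ^ 2| ≤
        B3 * |h| ^ (0 + 1 + 1 + 1) := by
      have hd : ∀ h, HasDerivAt
          (fun h => φ (a + h) - φ a - deriv φ a * h - deriv (deriv φ) a / 2 * h ^ 2)
          (deriv φ (a + h) - deriv φ a - deriv (deriv φ) a * h) h := fun h => by
        have := (((hshift d0 h).sub_const (φ a)).sub ((hasDerivAt_id h).const_mul (deriv φ a))).sub
          ((hasDerivAt_pow 2 h).const_mul (deriv (deriv φ) a / 2))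
        refine this.congr_deriv ?_
        simp
        ring
      refine abs_le_of_abs_deriv_le (fun h => (hd h).differentiableAt) (by simp) n3 fun h => ?_
      rw [(hd h).deriv]
      exact e1 h
    refine (e0 h).trans ?_
    have : 0 ≤ |h| ^ 3 := by positivity
    norm_num
    nlinarith

/-- A smooth decreasing step from `1` to `0` between `a` and `a + δ`. -/
def stepDown (a δ t : ℝ) : ℝ := 1 - Real.smoothTransition ((t - a) / δ)

theorem stepDown_nonneg (a δ t : ℝ) : 0 ≤ stepDown a δ t :=
  sub_nonneg.2 (Real.smoothTransition.le_one _)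

theorem stepDown_le_one (a δ t : ℝ) : stepDown a δ t ≤ 1 :=
  sub_le_self _ (Real.smoothTransition.nonneg _)

theorem stepDown_of_le {a δ t : ℝ} (hδ : 0 < δ) (h : t ≤ a) : stepDown a δ t = 1 := by
  rw [stepDown, Real.smoothTransition.zero_of_nonpos, sub_zero]
  exact div_nonpos_of_nonpos_of_nonneg (by linarith) hδ.le

theorem stepDown_of_ge {a δ t : ℝ} (hδ : 0 < δ) (h : a + δ ≤ t) : stepDown a δ t = 0 := by
  rw [stepDown, Real.smoothTransition.one_of_one_le, sub_self]
  rw [le_div_iff₀ hδ]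
  linarith

theorem exists_testFun_stepDown (a : ℝ) {δ : ℝ} (hδ : 0 < δ) :
    ∃ φ₁ φ₂ B, TestFun (stepDown a δ) φ₁ φ₂ B := by
  refine exists_testFun (K := Set.Icc a (a + δ)) ?_ isCompact_Icc (fun x hx => ?_) ⟨1, fun t => ?_⟩
  · unfold stepDown
    exact contDiff_const.sub (Real.smoothTransition.contDiff.comp
      ((contDiff_id.sub contDiff_const).div_const _))
  · by_cases h : x < a
    · refine ⟨1, ?_⟩
      filter_upwards [Iio_mem_nhds h] with y hy
      exact stepDown_of_le hδ (le_of_lt hy)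
    · have h' : a + δ < x := by
        by_contra hcon
        exact hx ⟨not_lt.1 h, not_lt.1 hcon⟩
      refine ⟨0, ?_⟩
      filter_upwards [Ioi_mem_nhds h'] with y hy
      exact stepDown_of_ge hδ (le_of_lt hy)
  · rw [abs_of_nonneg (stepDown_nonneg _ _ _)]
    exact stepDown_le_one _ _ _

/-- A smooth even function that vanishes for `t ^ 2 ≤ 1 + η` and is `1` for `t ^ 2 ≥ 1 + 2 η`. -/
def outerStep (η t : ℝ) : ℝ := 1 - stepDown (1 + η) η (t ^ 2)

theorem outerStep_nonneg (η t : ℝ) : 0 ≤ outerStep η t :=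
  sub_nonneg.2 (stepDown_le_one _ _ _)

theorem outerStep_le_one (η t : ℝ) : outerStep η t ≤ 1 :=
  sub_le_self _ (stepDown_nonneg _ _ _)

theorem outerStep_of_le {η t : ℝ} (hη : 0 < η) (h : t ^ 2 ≤ 1 + η) : outerStep η t = 0 := by
  rw [outerStep, stepDown_of_le hη h, sub_self]

theorem outerStep_of_ge {η t : ℝ} (hη : 0 < η) (h : 1 + 2 * η ≤ t ^ 2) : outerStep η t = 1 := by
  rw [outerStep, stepDown_of_ge hη (by linarith), sub_zero]

theorem exists_testFun_outerStep {η : ℝ} (hη : 0 < η) :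
    ∃ φ₁ φ₂ B, TestFun (outerStep η) φ₁ φ₂ B := by
  refine exists_testFun (K := Set.Icc (-(1 + 2 * η)) (1 + 2 * η)) ?_ isCompact_Icc
    (fun x hx => ⟨1, ?_⟩) ⟨1, fun t => ?_⟩
  · unfold outerStep stepDown
    exact contDiff_const.sub (contDiff_const.sub (Real.smoothTransition.contDiff.comp
      (((contDiff_id.pow 2).sub contDiff_const).div_const _)))
  · filter_upwards [isClosed_Icc.isOpen_compl.mem_nhds hx] with y hy
    refine outerStep_of_ge hη ?_
    have hy' : 1 + 2 * η < |y| := by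
      by_contra hcon
      exact hy (abs_le.1 (not_lt.1 hcon))
    rw [← sq_abs]
    nlinarith
  · rw [abs_of_nonneg (outerStep_nonneg _ _)]
    exact outerStep_le_one _ _

/-! ### The distance to the cube -/

theorem clip_mem {n : ℕ} (v : Fin n → ℝ) (i : Fin n) : clip v i ∈ Set.Icc (-1 : ℝ) 1 := by
  simp [clip]

theorem continuous_clip {n : ℕ} : Continuous (clip (n := n)) := by
  unfold clip
  fun_prop

theorem sq_sub_clip_le {n : ℕ} (v : Fin n → ℝ) (i : Fin n) {a : ℝ} (ha : a ∈ Set.Icc (-1 : ℝ) 1) :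
    (v i - clip v i) ^ 2 ≤ (v i - a) ^ 2 := by
  obtain ⟨h1, h2⟩ := ha
  simp only [clip]
  rcases le_total (-1) (v i) with h | h
  · rw [max_eq_right h]
    rcases le_total 1 (v i) with h' | h'
    · rw [min_eq_left h']
      nlinarith
    · rw [min_eq_right h']
      nlinarith
  · rw [max_eq_left h, min_eq_right (by norm_num)]
    nlinarith

theorem distCube_eq {n : ℕ} (v : Fin n → ℝ) : distCube v = √(∑ i, (v i - clip v i) ^ 2) := by
  have hdist : ∀ w : EuclideanSpace ℝ (Fin n),
      dist (WithLp.toLp 2 v : EuclideanSpace ℝ (Fin n)) w = √(∑ i, (v i - w i) ^ 2) := by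
    intro w
    rw [EuclideanSpace.dist_eq]
    simp [Real.dist_eq, sq_abs]
  have hmem : (WithLp.toLp 2 (clip v) : EuclideanSpace ℝ (Fin n)) ∈
      {w : EuclideanSpace ℝ (Fin n) | ∀ i, w i ∈ Set.Icc (-1 : ℝ) 1} := by
    rw [Set.mem_ofPred_eq]
    exact fun i => clip_mem v i
  refine le_antisymm ?_ ?_
  · refine (Metric.infDist_le_dist_of_mem hmem).trans (le_of_eq ?_)
    rw [hdist]
  · refine (Metric.le_infDist ⟨_, hmem⟩).2 fun w hw => ?_
    rw [Set.mem_ofPred_eq] at hw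
    rw [hdist]
    exact Real.sqrt_le_sqrt (Finset.sum_le_sum fun i _ => sq_sub_clip_le v i (hw i))

/-- The square of the distance to the cube, divided by the dimension. -/
def avgExcess {n : ℕ} (v : Fin n → ℝ) : ℝ := 1 / (n : ℝ) * ∑ i, (v i - clip v i) ^ 2

theorem avgExcess_nonneg {n : ℕ} (v : Fin n → ℝ) : 0 ≤ avgExcess v :=
  mul_nonneg (by positivity) (Finset.sum_nonneg fun _ _ => sq_nonneg _)

theorem continuous_avgExcess {n : ℕ} : Continuous (avgExcess (n := n)) := by
  have := continuous_clip (n := n)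
  unfold avgExcess
  fun_prop

theorem distCube_div_sqrt {n : ℕ} (v : Fin n → ℝ) : distCube v / √(n : ℝ) = √(avgExcess v) := by
  rw [distCube_eq, avgExcess, ← Real.sqrt_div (Finset.sum_nonneg fun _ _ => sq_nonneg _),
    one_div, inv_mul_eq_div]

/-- Where the step is nonzero, the coordinate exceeds `√(1 + η)` in absolute value and is at least
`√(1 + η) - 1` away from the interval. This is the direction used for the Gaussian law. -/
theorem outerStep_le_sq_sub_clip {n : ℕ} {η : ℝ} (hη : 0 < η) (v : Fin n → ℝ) (i : Fin n) :
    outerStep η (v i) ≤ ((√(1 + η) - 1) ^ 2)⁻¹ * (v i - clip v i) ^ 2 := by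
  by_cases h : v i ^ 2 ≤ 1 + η
  · rw [outerStep_of_le hη h]
    positivity
  · have h1 : 1 < √(1 + η) := by
      rw [Real.lt_sqrt (by norm_num)]
      linarith
    have h2 : √(1 + η) ≤ |v i| := by
      rw [← Real.sqrt_sq_eq_abs]
      exact Real.sqrt_le_sqrt (not_le.1 h).le
    refine (outerStep_le_one _ _).trans ?_
    rw [inv_mul_eq_div, one_le_div (by have := sub_pos.2 h1; positivity)]
    obtain ⟨h3, h4⟩ := clip_mem v i
    rw [← sq_abs (v i - clip v i)]
    have h5 : |v i| - 1 ≤ |v i - clip v i| := by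
      have := abs_sub_abs_le_abs_sub (v i) (clip v i)
      have : |clip v i| ≤ 1 := abs_le.2 ⟨h3, h4⟩
      linarith
    exact pow_le_pow_left₀ (by linarith) (by linarith) 2

/-- The direction used for the sparse law: an unbounded quantity is controlled by the bounded test
function and a fourth moment. Below the threshold the excess is at most `η`; above it, `t ^ 2 ≤ T ^
2 + t ^ 4 / T ^ 2`. -/
theorem sq_sub_clip_le_outerStep {n : ℕ} {η T : ℝ} (hη : 0 < η) (hT : 0 < T) (v : Fin n → ℝ)
    (i : Fin n) :
    (v i - clip v i) ^ 2 ≤ η ^ 2 + T ^ 2 * outerStep η (v i) + v i ^ 4 / T ^ 2 := by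
  have h4 : 0 ≤ v i ^ 4 / T ^ 2 := by positivity
  have ho := outerStep_nonneg η (v i)
  by_cases h : 1 + 2 * η ≤ v i ^ 2
  · rw [outerStep_of_ge hη h]
    have h1 : (v i - clip v i) ^ 2 ≤ v i ^ 2 := by
      simpa using sq_sub_clip_le v i (a := 0) (by norm_num)
    have h2 : v i ^ 2 ≤ T ^ 2 + v i ^ 4 / T ^ 2 := by
      rw [← sub_nonneg]
      have : T ^ 2 + v i ^ 4 / T ^ 2 - v i ^ 2 =
          ((T ^ 2 - v i ^ 2) ^ 2 + T ^ 2 * v i ^ 2) / T ^ 2 := by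
        field_simp
        ring
      rw [this]
      positivity
    nlinarith [sq_nonneg η]
  · have h1 : |v i| ≤ 1 + η := by
      refine abs_le_of_sq_le_sq ?_ (by linarith)
      nlinarith [not_le.1 h, sq_nonneg η]
    obtain ⟨h2, h3⟩ := abs_le.1 h1
    have h5 : (v i - clip v i) ^ 2 ≤ η ^ 2 := by
      rcases le_total (v i) (-1) with h6 | h6
      · refine (sq_sub_clip_le v i (a := -1) (by norm_num)).trans ?_
        nlinarith
      · rcases le_total (v i) 1 with h7 | h7
        · refine (sq_sub_clip_le v i (a := v i) ⟨h6, h7⟩).trans ?_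
          nlinarith [sq_nonneg η]
        · refine (sq_sub_clip_le v i (a := 1) (by norm_num)).trans ?_
          nlinarith
    have : 0 ≤ T ^ 2 * outerStep η (v i) := mul_nonneg (sq_nonneg T) ho
    linarith

/-! ### Probability estimates -/

section Markov

variable {α : Type*} [MeasurableSpace α] {μ : Measure α}

theorem measure_lt_le_of_nonneg {Z : α → ℝ} (hZ : 0 ≤ᵐ[μ] Z) (hint : Integrable Z μ) {ε : ℝ}
    (hε : 0 < ε) : μ {x | ε < Z x} ≤ ENNReal.ofReal ((∫ x, Z x ∂μ) / ε) := by
  refine (measure_mono (t := {x | ENNReal.ofReal ε ≤ ENNReal.ofReal (Z x)}) fun x hx =>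
    ENNReal.ofReal_le_ofReal (le_of_lt hx)).trans ?_
  refine (meas_ge_le_lintegral_div hint.aemeasurable.ennreal_ofReal (by simpa using hε)
    ENNReal.ofReal_ne_top).trans ?_
  rw [← ofReal_integral_eq_lintegral_ofReal hint hZ, ENNReal.ofReal_div_of_pos hε]

theorem measure_le_ofReal_integral [IsFiniteMeasure μ] {s : Set α} {Z : α → ℝ} (hZ : ∀ x, 0 ≤ Z x)
    (hint : Integrable Z μ) (hs : ∀ x ∈ s, 1 ≤ Z x) : μ s ≤ ENNReal.ofReal (∫ x, Z x ∂μ) := by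
  rw [ofReal_integral_eq_lintegral_ofReal hint (.of_forall hZ)]
  calc μ s ≤ μ {x | 1 ≤ ENNReal.ofReal (Z x)} :=
        measure_mono fun x hx => ENNReal.one_le_ofReal.2 (hs x hx)
    _ ≤ (∫⁻ x, ENNReal.ofReal (Z x) ∂μ) / 1 :=
        meas_ge_le_lintegral_div hint.aemeasurable.ennreal_ofReal one_ne_zero ENNReal.one_ne_top
    _ = _ := div_one _

theorem integral_le_measureReal_add [IsProbabilityMeasure μ] {s : Set α} (hs : MeasurableSet s)
    {Z : α → ℝ} {a : ℝ} (ha : 0 ≤ a) (hZ : ∀ x, 0 ≤ Z x) (h1 : ∀ x, Z x ≤ 1)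
    (ha' : ∀ x ∉ s, Z x ≤ a) : ∫ x, Z x ∂μ ≤ (μ s).toReal + a := by
  have hint : Integrable (fun x => s.indicator (fun _ => (1 : ℝ)) x + a) μ :=
    ((integrable_const _).indicator hs).add (integrable_const _)
  refine (integral_mono_of_nonneg (.of_forall hZ) hint (.of_forall fun x => ?_)).trans
    (le_of_eq ?_)
  · by_cases hx : x ∈ s
    · simp only [hx, Set.indicator_of_mem]
      linarith [h1 x]
    · simpa [hx] using ha' x hx
  · rw [integral_add ((integrable_const _).indicator hs) (integrable_const _),
      integral_indicator hs]
    simp [Measure.real]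

theorem tendsto_measure_zero {ι : Type} {α : ι → Type} [∀ i, MeasurableSpace (α i)] {l : Filter ι}
    {μ : ∀ i, Measure (α i)} {s : ∀ i, Set (α i)} {g : ι → ℝ} (hg : Tendsto g l (𝓝 0))
    (h : ∀ᶠ i in l, μ i (s i) ≤ ENNReal.ofReal (g i)) : Tendsto (fun i => μ i (s i)) l (𝓝 0) := by
  refine tendsto_of_tendsto_of_tendsto_of_le_of_le' tendsto_const_nhds ?_
    (.of_forall fun _ => zero_le) h
  simpa using ENNReal.tendsto_ofReal hg

end Markov

/-! ### The sparse regime -/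

theorem tendsto_fst_sparseLimit : Tendsto (fun q : ℕ × ℝ => q.1) sparseLimit atTop :=
  tendsto_fst.mono_left inf_le_left

theorem tendsto_snd_sparseLimit : Tendsto (fun q : ℕ × ℝ => q.2) sparseLimit atTop :=
  tendsto_snd.mono_left inf_le_left

theorem eventually_sparseLimit :
    ∀ᶠ q : ℕ × ℝ in sparseLimit, 0 < q.1 ∧ 1 ≤ q.2 ∧ 2 * q.2 ≤ q.1 := by
  have h1 : ∀ᶠ q : ℕ × ℝ in sparseLimit, q.2 / (q.1 : ℝ) < 1 / 2 :=
    (tendsto_comap.mono_left inf_le_right).eventually (gt_mem_nhds (by norm_num))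
  filter_upwards [h1, tendsto_fst_sparseLimit.eventually_gt_atTop 0,
    tendsto_snd_sparseLimit.eventually_ge_atTop 1] with q hq hn hd
  refine ⟨hn, hd, ?_⟩
  rw [div_lt_iff₀ (Nat.cast_pos.2 hn)] at hq
  linarith

theorem tendsto_const_div_sqrt_sparseLimit (C : ℝ) :
    Tendsto (fun q : ℕ × ℝ => C / √q.2) sparseLimit (𝓝 0) :=
  (tendsto_const_nhds.div_atTop Real.tendsto_sqrt_atTop).comp tendsto_snd_sparseLimit

section SparseLaw

variable {n : ℕ} {d : ℝ}

theorem isProbabilityMeasure_sparseLaw (hd : 0 ≤ d) (hdn : d ≤ n) :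
    IsProbabilityMeasure (sparseLaw n d) := by
  have := isProbabilityMeasure_sparseEntryLaw hd hdn
  unfold sparseLaw
  infer_instance

instance (n : ℕ) : IsProbabilityMeasure (goeLaw n) := by
  unfold goeLaw
  infer_instance

theorem ae_sparseLaw {P : ℝ → Prop} (hd : 0 ≤ d) (hdn : d ≤ n)
    (h1 : P (rescaledEntry n d 1)) (h0 : P (rescaledEntry n d 0)) :
    ∀ᵐ x ∂(sparseLaw n d), ∀ e, P (x e) := by
  have := isProbabilityMeasure_sparseEntryLaw hd hdn
  exact eventually_all.2 fun e =>
    (Measure.tendsto_eval_ae_ae (i := e)).eventually (ae_sparseEntryLaw h1 h0)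

/-- Almost surely all entries lie in a compact cube, on which continuous functions are bounded. -/
theorem integrable_sparseLaw (hd : 0 < d) (hdn : 2 * d ≤ n) {G : (Edge n → ℝ) → ℝ}
    (hG : Continuous G) : Integrable G (sparseLaw n d) := by
  have := isProbabilityMeasure_sparseLaw hd.le (by linarith : d ≤ n)
  obtain ⟨C, hC⟩ := (isCompact_univ_pi fun _ : Edge n =>
    isCompact_Icc (a := -(1 / √d)) (b := 1 / √d)).exists_bound_of_continuousOn hG.continuousOn
  refine Integrable.of_bound hG.measurable.aestronglyMeasurable C ?_
  filter_upwards [ae_sparseLaw (n := n) (P := fun t => |t| ≤ 1 / √d) hd.le (by linarith)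
    (abs_rescaledEntry_one_le hd hdn) (abs_rescaledEntry_zero_le hd hdn)] with x hx
  exact hC x fun e _ => abs_le.1 (hx e)

end SparseLaw

/-! ### Transfer of expectations -/

/-- The hypotheses of the theorem on the vector of polynomials. -/
structure IsTreeVec {n : ℕ} (Δ : ℕ) (c : ℝ) (p : Fin n → MvPolynomial (Edge n) ℝ) : Prop where
  tree : ∀ i, IsTreePoly Δ (p i)
  coeff : ∀ i, (coeffNorm (p i) : ℝ) ≤ c
  node : ∀ i, PolyContains i (p i)

theorem IsTreeVec.nonneg {n Δ : ℕ} {c : ℝ} {p : Fin n → MvPolynomial (Edge n) ℝ}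
    (hp : IsTreeVec Δ c p) (hn : 0 < n) : 0 ≤ c :=
  (coeffNorm (p ⟨0, hn⟩)).2.trans (hp.coeff ⟨0, hn⟩)

theorem continuous_evalVec {n : ℕ} (p : Fin n → MvPolynomial (Edge n) ℝ) :
    Continuous (evalVec p) :=
  continuous_pi fun i => MvPolynomial.continuous_eval (p i)

theorem continuous_symMatrix {n : ℕ} : Continuous (symMatrix (n := n)) := by
  refine continuous_matrix fun i j => ?_
  simp only [symMatrix, Matrix.of_apply]
  split_ifs <;> fun_prop

theorem continuous_objective {n : ℕ} {v : (Edge n → ℝ) → Fin n → ℝ} (hv : Continuous v) :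
    Continuous fun x => objective (symMatrix x) (v x) := by
  have := continuous_symMatrix (n := n)
  unfold objective quad
  exact continuous_const.mul (hv.dotProduct (this.matrix_mulVec hv))

theorem exists_abs_integral_eval_sub_le (Δ : ℕ) (c : ℝ) {φ φ₁ φ₂ : ℝ → ℝ} {B : ℝ}
    (hφ : TestFun φ φ₁ φ₂ B) : ∃ C : ℝ, ∀ (n : ℕ) (d : ℝ) (p : Fin n → MvPolynomial (Edge n) ℝ),
      IsTreeVec Δ c p → 1 ≤ d → 2 * d ≤ n → ∀ i,
        |∫ y, φ (evalVec p y i) ∂(sparseLaw n d) - ∫ x, φ (evalVec p x i) ∂(goeLaw n)| ≤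
          C / √d := by
  -- The order 40 serves all estimates: `4 * 2 + 3` here, `4 * 5 + 3` for the objective, and `20 *
  -- 2` for the twentieth moment of a coordinate.
  obtain ⟨K, hK, hlaw⟩ := exists_smallLaw 40
  refine ⟨B * (8 * ((2 : ℕ) + 1) ^ 2) * (K * (influenceBound K 2 Δ 3 * (c ^ 2 + c ^ 4))),
    fun n d p hp hd hdn i => ?_⟩
  obtain ⟨h1, h2, hκ⟩ := hlaw n d hd hdn
  have h := (linkedFamily_of_isTreePoly (hp.tree i) (hp.node i) (hp.coeff i)).abs_integral_sub_le_of_le_two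
    (Fin.pos i) hK hκ (hp.nonneg (Fin.pos i)) (by norm_num) le_rfl h1 h2 hφ
  simp only [evalVec, eval_eq_famVal]
  refine h.trans (le_of_eq ?_)
  simp only [Finset.card_singleton, Nat.cast_one]
  ring

theorem exists_abs_integral_objective_sub_le (Δ : ℕ) (c : ℝ) {φ φ₁ φ₂ : ℝ → ℝ} {B : ℝ}
    (hφ : TestFun φ φ₁ φ₂ B) : ∃ C : ℝ, ∀ (n : ℕ) (d : ℝ) (p : Fin n → MvPolynomial (Edge n) ℝ),
      IsTreeVec Δ c p → 1 ≤ d → 2 * d ≤ n →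
        |∫ y, φ (objective (symMatrix y) (evalVec p y)) ∂(sparseLaw n d) -
          ∫ x, φ (objective (symMatrix x) (evalVec p x)) ∂(goeLaw n)| ≤ C / √d := by
  obtain ⟨K, hK, hlaw⟩ := exists_smallLaw 40
  have hB : 0 ≤ B := (abs_nonneg _).trans (hφ.bound 0)
  set W := (2 * (1 + 2 * Δ) : ℕ) * weightBound K (1 + 2 * Δ) (2 * 9) 2 with hW
  set I := influenceBound K (1 + 4) (1 + 2 * Δ) (2 * 9) with hI
  have hK0 : 0 ≤ K := by linarith
  have hI0 : 0 ≤ I := by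
    have := weightBound_nonneg hK0 (1 + 2 * Δ) (2 * 9) 2
    have := weightBound_nonneg hK0 (1 + 2 * Δ) (2 * 9) 4
    rw [hI, influenceBound]
    positivity
  refine ⟨B * (8 * ((1 + 4 : ℕ) + 1) ^ 2) * K * ((1 + 4 : ℕ) * (1 + c ^ 4 * W) +
    I * (c ^ 4 + c ^ 8)), fun n d p hp hd hdn => ?_⟩
  obtain ⟨h1, h2, hκ⟩ := hlaw n d hd hdn
  have hn : (0 : ℝ) < n := by linarith
  have hn1 : (1 : ℝ) ≤ n := by linarith
  have hn' : 0 < n := Nat.cast_pos.1 hn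
  obtain ⟨L, a, γ, hfam, hval⟩ := exists_linkedFamily_objective hp.tree hp.coeff hp.node
  have h := hfam.abs_integral_sub_le hn' hK hκ (by positivity) (by norm_num) h1 h2 hφ
  simp only [hval]
  refine h.trans ?_
  rw [← hI, Finset.card_univ, Fintype.card_fin]
  -- Coefficients of size `c ^ 2 / n` compensate for the `n` roots and the additional factor `n`.
  have e1 : (n : ℝ) * ((c ^ 2 / n) ^ 2 * ((2 * (1 + 2 * Δ) : ℕ) *
      (weightBound K (1 + 2 * Δ) (2 * 9) 2 * n))) = c ^ 4 * W := by
    rw [hW]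
    field_simp
  have e2 : ((c ^ 2 / (n : ℝ)) ^ 2 + (c ^ 2 / n) ^ 4) * n ≤ c ^ 4 + c ^ 8 := by
    have e3 : ((c ^ 2 / (n : ℝ)) ^ 2 + (c ^ 2 / n) ^ 4) * n = c ^ 4 / n + c ^ 8 / n ^ 3 := by
      field_simp
    rw [e3]
    exact add_le_add (div_le_self (by positivity) hn1)
      (div_le_self (by positivity) (one_le_pow₀ hn1))
  rw [e1]
  calc _ ≤ B * (8 * ((1 + 4 : ℕ) + 1) ^ 2) * (K / √d) * ((1 + 4 : ℕ) * (1 + c ^ 4 * W) +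
        I * (c ^ 4 + c ^ 8)) := by gcongr
    _ = _ := by ring

/-- Moments of the coordinates under the sparse law. -/
theorem exists_integral_eval_pow_le (Δ : ℕ) (c : ℝ) {m : ℕ} (hm : m ≤ 20) : ∃ C : ℝ, ∀ (n : ℕ) (d : ℝ)
    (p : Fin n → MvPolynomial (Edge n) ℝ), IsTreeVec Δ c p → 1 ≤ d → 2 * d ≤ n → ∀ i,
      ∫ y, evalVec p y i ^ m ∂(sparseLaw n d) ≤ C := by
  obtain ⟨K, hK, hlaw⟩ := exists_smallLaw 40
  refine ⟨c ^ m * weightBound K Δ 3 m, fun n d p hp hd hdn i => ?_⟩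
  obtain ⟨-, h2, hκ⟩ := hlaw n d hd hdn
  simp only [evalVec, eval_eq_famVal]
  exact (linkedFamily_of_isTreePoly (hp.tree i) (hp.node i) (hp.coeff i)).integral_pow_le hK
    (hp.nonneg (Fin.pos i)) (by omega) fun _ => h2.mono hκ

theorem exists_integral_mulVec_sq_le (Δ : ℕ) (c : ℝ) : ∃ C : ℝ, ∀ (n : ℕ) (d : ℝ)
    (p : Fin n → MvPolynomial (Edge n) ℝ), IsTreeVec Δ c p → 1 ≤ d → 2 * d ≤ n → ∀ i,
      ∫ y, (symMatrix y).mulVec (evalVec p y) i ^ 2 ∂(sparseLaw n d) ≤ C := by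
  obtain ⟨K, hK, hlaw⟩ := exists_smallLaw 40
  refine ⟨c ^ 2 * weightBound K (1 + Δ) (2 * 3) 2, fun n d p hp hd hdn i => ?_⟩
  obtain ⟨-, h2, hκ⟩ := hlaw n d hd hdn
  obtain ⟨L, a, γ, hfam, hval⟩ := exists_linkedFamily_mulVec hp.tree hp.coeff hp.node i
  simp only [hval]
  exact hfam.integral_pow_le hK (hp.nonneg (Fin.pos i)) (by norm_num) fun _ => h2.mono hκ

theorem exists_integral_rowSq_sq_le : ∃ C : ℝ, ∀ (n : ℕ) (d : ℝ), 1 ≤ d → 2 * d ≤ n → ∀ i : Fin n,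
      ∫ y, (∑ e ∈ edgesAt i, y e ^ 2) ^ 2 ∂(sparseLaw n d) ≤ C := by
  obtain ⟨K, hK, hlaw⟩ := exists_smallLaw 40
  refine ⟨1 ^ 2 * weightBound K (1 + 0) (2 * 1) 2, fun n d hd hdn i => ?_⟩
  obtain ⟨-, h2, hκ⟩ := hlaw n d hd hdn
  obtain ⟨L, a, γ, hfam, hval⟩ := exists_linkedFamily_rowSq i
  simp only [hval]
  exact hfam.integral_pow_le hK zero_le_one (by norm_num) fun _ => h2.mono hκ

/-! ### Transfer of the limits in probability -/

section Transfer

variable {Δ : ℕ} {c P : ℝ} {p : ∀ n : ℕ, Fin n → MvPolynomial (Edge n) ℝ}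

/-- The step equals 1 below `P - ε` and 0 above `P - ε / 2`, so its mean dominates the sparse
probability and is dominated by the Gaussian one at level `P - ε / 4`; the two means differ by `O(1
/ √d)`. -/
theorem plimGe_objective (hp : ∀ n, IsTreeVec Δ c (p n))
    (hobj : PLimGe atTop goeLaw (fun n x => objective (symMatrix x) (evalVec (p n) x)) P) :
    PLimGe sparseLimit (fun q => sparseLaw q.1 q.2)
      (fun q y => objective (symMatrix y) (evalVec (p q.1) y)) P := by
  intro ε hε
  obtain ⟨φ₁, φ₂, B, hφ⟩ := exists_testFun_stepDown (P - ε) (δ := ε / 2) (by linarith)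
  obtain ⟨C, hC⟩ := exists_abs_integral_objective_sub_le Δ c hφ
  have hcont : ∀ n, Continuous fun x : Edge n → ℝ => objective (symMatrix x) (evalVec (p n) x) :=
    fun n => continuous_objective (continuous_evalVec (p n))
  have hlim : Tendsto (fun q : ℕ × ℝ => ((goeLaw q.1) {x | objective (symMatrix x)
      (evalVec (p q.1) x) < P - ε / 4}).toReal + 0 + C / √q.2) sparseLimit (𝓝 0) := by
    have h1 := (ENNReal.tendsto_toReal ENNReal.zero_ne_top).comp
      ((hobj (ε / 4) (by linarith)).comp tendsto_fst_sparseLimit)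
    simpa using (h1.add_const 0).add (tendsto_const_div_sqrt_sparseLimit C)
  refine tendsto_measure_zero hlim ?_
  filter_upwards [eventually_sparseLimit] with q hq
  obtain ⟨hn, hd, hdn⟩ := hq
  have hd0 : 0 < q.2 := by linarith
  have := isProbabilityMeasure_sparseLaw (n := q.1) hd0.le (by linarith)
  refine (measure_le_ofReal_integral (Z := fun y => stepDown (P - ε) (ε / 2)
    (objective (symMatrix y) (evalVec (p q.1) y))) (fun y => stepDown_nonneg _ _ _)
    (integrable_sparseLaw hd0 hdn (hφ.cont.comp (hcont q.1)))
    fun y hy => (stepDown_of_le (by linarith) (le_of_lt hy)).ge).trans ?_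
  refine ENNReal.ofReal_le_ofReal ?_
  have h1 := (abs_le.1 (hC q.1 q.2 (p q.1) (hp q.1) hd hdn)).2
  have h2 := integral_le_measureReal_add (μ := goeLaw q.1)
    (s := {x | objective (symMatrix x) (evalVec (p q.1) x) < P - ε / 4})
    (Z := fun x => stepDown (P - ε) (ε / 2) (objective (symMatrix x) (evalVec (p q.1) x)))
    (measurableSet_lt (hcont q.1).measurable measurable_const) le_rfl
    (fun y => stepDown_nonneg _ _ _) (fun y => stepDown_le_one _ _ _)
    fun x hx => (stepDown_of_ge (by linarith) (by
      have : P - ε / 4 ≤ objective (symMatrix x) (evalVec (p q.1) x) := not_lt.1 hx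
      linarith)).le
  linarith

/-- The average is at most 1 and at most a multiple of the mean squared excess, so convergence in
probability of the latter becomes convergence in mean of the former. -/
theorem tendsto_integral_outerStep
    (hbox : PLimEq atTop goeLaw (fun n x => distCube (evalVec (p n) x) / √(n : ℝ)) 0) {η : ℝ}
    (hη : 0 < η) :
    Tendsto (fun n => ∫ x, 1 / (n : ℝ) * ∑ i, outerStep η (evalVec (p n) x i) ∂(goeLaw n))
      atTop (𝓝 0) := by
  set M := ((√(1 + η) - 1) ^ 2)⁻¹ with hM
  have hM0 : 0 ≤ M := by positivity
  have hnonneg : ∀ n (x : Edge n → ℝ),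
      0 ≤ 1 / (n : ℝ) * ∑ i, outerStep η (evalVec (p n) x i) := fun n x =>
    mul_nonneg (by positivity) (Finset.sum_nonneg fun _ _ => outerStep_nonneg _ _)
  rw [Metric.tendsto_atTop']
  intro ε hε
  set δ := ε / (2 * (M + 1)) with hδ
  have hδ0 : 0 < δ := by positivity
  have hMδ : M * δ ≤ ε / 2 := by
    rw [hδ, mul_div_assoc', div_le_iff₀ (by positivity)]
    nlinarith
  have h1 := (ENNReal.tendsto_toReal ENNReal.zero_ne_top).comp
    (hbox (√δ) (Real.sqrt_pos.2 hδ0))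
  obtain ⟨N, hN⟩ := (eventually_atTop.1 (h1.eventually (gt_mem_nhds
    (show (0 : ℝ≥0∞).toReal < ε / 2 by simpa using hε))))
  refine ⟨N, fun n hn => ?_⟩
  have h2 := hN n hn.le
  rw [Function.comp_apply] at h2
  have hmeas : MeasurableSet {x : Edge n → ℝ | √δ < |distCube (evalVec (p n) x) / √(n : ℝ) - 0|} := by
    simp only [distCube_div_sqrt]
    refine measurableSet_lt measurable_const ?_
    have := continuous_avgExcess.comp (continuous_evalVec (p n))
    exact ((Real.continuous_sqrt.comp this).sub continuous_const).abs.measurable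
  rw [Real.dist_eq, sub_zero, abs_of_nonneg (integral_nonneg (hnonneg n))]
  refine (integral_le_measureReal_add hmeas (a := M * δ) (by positivity) (hnonneg n) (fun x => ?_)
    (fun x hx => ?_)).trans_lt (by linarith)
  · have : ∑ i, outerStep η (evalVec (p n) x i) ≤ n := by
      simpa using Finset.sum_le_card_nsmul Finset.univ _ 1
        fun i _ => outerStep_le_one η (evalVec (p n) x i)
    rw [one_div, inv_mul_eq_div]
    exact div_le_one_of_le₀ this (Nat.cast_nonneg n)
  · have hx' : √(avgExcess (evalVec (p n) x)) ≤ √δ := by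
      have : |distCube (evalVec (p n) x) / √(n : ℝ) - 0| ≤ √δ := not_lt.1 hx
      rwa [distCube_div_sqrt, sub_zero, abs_of_nonneg (Real.sqrt_nonneg _)] at this
    have hx'' : avgExcess (evalVec (p n) x) ≤ δ := (Real.sqrt_le_sqrt_iff hδ0.le).1 hx'
    refine le_trans ?_ (mul_le_mul_of_nonneg_left hx'' hM0)
    rw [avgExcess, mul_left_comm, Finset.mul_sum (a := M)]
    gcongr with i
    exact outerStep_le_sq_sub_clip hη _ i

/-- Each coordinate is transferred separately, with an error uniform in `i`, and the results are
averaged. Convergence in mean, stronger than the claim about the distance, is needed again for the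
rounding. -/
theorem tendsto_integral_avgExcess (hp : ∀ n, IsTreeVec Δ c (p n))
    (hbox : PLimEq atTop goeLaw (fun n x => distCube (evalVec (p n) x) / √(n : ℝ)) 0) :
    Tendsto (fun q : ℕ × ℝ => ∫ y, avgExcess (evalVec (p q.1) y) ∂(sparseLaw q.1 q.2))
      sparseLimit (𝓝 0) := by
  obtain ⟨C₄, hC₄⟩ := exists_integral_eval_pow_le Δ c (m := 4) (by norm_num)
  have key : ∀ η T : ℝ, 0 < η → 0 < T → ∃ g : ℕ × ℝ → ℝ, Tendsto g sparseLimit (𝓝 0) ∧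
      ∀ᶠ q in sparseLimit, ∫ y, avgExcess (evalVec (p q.1) y) ∂(sparseLaw q.1 q.2) ≤
        η ^ 2 + T ^ 2 * g q + C₄ / T ^ 2 := by
    intro η T hη hT
    obtain ⟨φ₁, φ₂, B, hφ⟩ := exists_testFun_outerStep hη
    obtain ⟨C, hC⟩ := exists_abs_integral_eval_sub_le Δ c hφ
    refine ⟨fun q => ∫ x, 1 / (q.1 : ℝ) * ∑ i, outerStep η (evalVec (p q.1) x i) ∂(goeLaw q.1) +
      C / √q.2, ?_, ?_⟩
    · simpa using ((tendsto_integral_outerStep hbox hη).comp tendsto_fst_sparseLimit).add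
        (tendsto_const_div_sqrt_sparseLimit C)
    filter_upwards [eventually_sparseLimit] with q hq
    obtain ⟨hn, hd, hdn⟩ := hq
    have hd0 : 0 < q.2 := by linarith
    have hn0 : (0 : ℝ) < q.1 := Nat.cast_pos.2 hn
    have := isProbabilityMeasure_sparseLaw (n := q.1) hd0.le (by linarith)
    have hev : ∀ i, Continuous fun y => evalVec (p q.1) y i := fun i =>
      (continuous_apply i).comp (continuous_evalVec (p q.1))
    have hclip : ∀ i, Continuous fun y => clip (evalVec (p q.1) y) i := fun i =>
      (continuous_apply i).comp (continuous_clip.comp (continuous_evalVec (p q.1)))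
    have ho : ∀ i, Continuous fun y => outerStep η (evalVec (p q.1) y i) := fun i =>
      hφ.cont.comp (hev i)
    have hi1 : ∀ i, Integrable (fun y => (evalVec (p q.1) y i - clip (evalVec (p q.1) y) i) ^ 2)
        (sparseLaw q.1 q.2) := fun i =>
      integrable_sparseLaw hd0 hdn (((hev i).sub (hclip i)).pow 2)
    have hi2 : ∀ i, Integrable (fun y => outerStep η (evalVec (p q.1) y i))
        (sparseLaw q.1 q.2) := fun i => integrable_sparseLaw hd0 hdn (ho i)
    have hi3 : ∀ i, Integrable (fun y => evalVec (p q.1) y i ^ 4) (sparseLaw q.1 q.2) :=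
      fun i => integrable_sparseLaw hd0 hdn ((hev i).pow 4)
    have hi4 : ∀ i, Integrable (fun x => outerStep η (evalVec (p q.1) x i)) (goeLaw q.1) :=
      fun i => Integrable.of_bound (hφ.cont.comp (hev i)).measurable.aestronglyMeasurable B
        (.of_forall fun x => hφ.bound _)
    have hone : ∀ i, ∫ y, (evalVec (p q.1) y i - clip (evalVec (p q.1) y) i) ^ 2
        ∂(sparseLaw q.1 q.2) ≤ η ^ 2 + T ^ 2 * (∫ x, outerStep η (evalVec (p q.1) x i)
          ∂(goeLaw q.1) + C / √q.2) + C₄ / T ^ 2 := by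
      intro i
      have h0 : Integrable (fun y => η ^ 2 + T ^ 2 * outerStep η (evalVec (p q.1) y i))
          (sparseLaw q.1 q.2) := (integrable_const _).add ((hi2 i).const_mul _)
      have h3 : Integrable (fun y => evalVec (p q.1) y i ^ 4 / T ^ 2) (sparseLaw q.1 q.2) :=
        (hi3 i).div_const _
      calc _ ≤ ∫ y, (η ^ 2 + T ^ 2 * outerStep η (evalVec (p q.1) y i) +
            evalVec (p q.1) y i ^ 4 / T ^ 2) ∂(sparseLaw q.1 q.2) :=
            integral_mono (hi1 i) (h0.add h3)
              fun y => sq_sub_clip_le_outerStep hη hT (evalVec (p q.1) y) i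
        _ = η ^ 2 + T ^ 2 * ∫ y, outerStep η (evalVec (p q.1) y i) ∂(sparseLaw q.1 q.2) +
            (∫ y, evalVec (p q.1) y i ^ 4 ∂(sparseLaw q.1 q.2)) / T ^ 2 := by
            rw [integral_add h0 h3, integral_add (integrable_const _) ((hi2 i).const_mul _),
              integral_const_mul, integral_div]
            simp
        _ ≤ _ := by
            gcongr
            · have := (abs_le.1 (hC q.1 q.2 (p q.1) (hp q.1) hd hdn i)).2
              linarith
            · exact hC₄ q.1 q.2 (p q.1) (hp q.1) hd hdn i
    simp only [avgExcess]
    rw [integral_const_mul, integral_finsetSum _ fun i _ => hi1 i, integral_const_mul,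
      integral_finsetSum _ fun i _ => hi4 i]
    refine (mul_le_mul_of_nonneg_left (Finset.sum_le_sum fun i _ => hone i)
      (by positivity)).trans (le_of_eq ?_)
    simp only [Finset.sum_add_distrib, ← Finset.mul_sum, Finset.sum_const, Finset.card_univ,
      Fintype.card_fin, nsmul_eq_mul]
    field_simp
  have hnonneg : ∀ q : ℕ × ℝ,
      0 ≤ ∫ y, avgExcess (evalVec (p q.1) y) ∂(sparseLaw q.1 q.2) := fun q =>
    integral_nonneg fun y => avgExcess_nonneg _
  -- First `η` and `T` are fixed so that the two static errors are at most `ε / 4` each; then the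
  -- limit makes `T ^ 2 * g` small.
  refine tendsto_order.2 ⟨fun a ha => .of_forall fun q => ha.trans_le (hnonneg q), fun ε hε => ?_⟩
  set η := min 1 (ε / 4) with hη
  have hη0 : 0 < η := lt_min one_pos (by linarith)
  have hη2 : η ^ 2 ≤ ε / 4 := by
    have h1 : η ≤ 1 := min_le_left _ _
    have h2 : η ≤ ε / 4 := min_le_right _ _
    nlinarith
  obtain ⟨T, hT0, hT⟩ : ∃ T : ℝ, 0 < T ∧ C₄ / T ^ 2 ≤ ε / 4 := by
    refine ⟨√(4 * |C₄| / ε + 1), Real.sqrt_pos.2 (by positivity), ?_⟩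
    rw [Real.sq_sqrt (by positivity), div_le_iff₀ (by positivity)]
    have : ε / 4 * (4 * |C₄| / ε + 1) = |C₄| + ε / 4 := by field_simp
    rw [this]
    linarith [le_abs_self C₄]
  obtain ⟨g, hg, hle⟩ := key η T hη0 hT0
  have hg' : Tendsto (fun q => T ^ 2 * g q) sparseLimit (𝓝 0) := by
    simpa using hg.const_mul (T ^ 2)
  filter_upwards [hle, hg'.eventually (gt_mem_nhds (show (0 : ℝ) < ε / 4 by linarith))] with q h1 h2
  linarith

theorem plimEq_distCube
    (hlim : Tendsto (fun q : ℕ × ℝ => ∫ y, avgExcess (evalVec (p q.1) y) ∂(sparseLaw q.1 q.2))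
      sparseLimit (𝓝 0)) :
    PLimEq sparseLimit (fun q => sparseLaw q.1 q.2)
      (fun q y => distCube (evalVec (p q.1) y) / √(q.1 : ℝ)) 0 := by
  intro ε hε
  have h := hlim.div_const (ε ^ 2)
  rw [zero_div] at h
  refine tendsto_measure_zero h ?_
  filter_upwards [eventually_sparseLimit] with q hq
  obtain ⟨hn, hd, hdn⟩ := hq
  have hd0 : 0 < q.2 := by linarith
  refine le_trans (measure_mono fun y hy => ?_) (measure_lt_le_of_nonneg (ε := ε ^ 2)
    (.of_forall fun y => avgExcess_nonneg _) (integrable_sparseLaw hd0 hdn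
      (continuous_avgExcess.comp (continuous_evalVec (p q.1)))) (by positivity))
  have hy' : ε < |distCube (evalVec (p q.1) y) / √(q.1 : ℝ) - 0| := hy
  rw [distCube_div_sqrt, sub_zero, abs_of_nonneg (Real.sqrt_nonneg _)] at hy'
  exact (Real.lt_sqrt hε.le).1 hy'

end Transfer

/-! ### A uniform bound for the bilinear form -/

section Net

open Classical in
/-- The integer vectors of squared norm at most `R n`, with entries bounded by `b`. -/
def intNet (n R : ℕ) (b : ℝ) : Finset (Fin n → ℤ) :=
  (Fintype.piFinset fun _ => Finset.Icc (-((R * n : ℕ) : ℤ)) ((R * n : ℕ) : ℤ)).filter fun k =>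
    ∑ i, k i ^ 2 ≤ ((R * n : ℕ) : ℤ) ∧ ∀ i, |(k i : ℝ)| ≤ b

theorem natAbs_le_sq (a : ℤ) : (a.natAbs : ℤ) ≤ a ^ 2 := by
  rw [← Int.natAbs_pow_two]
  exact_mod_cast Nat.le_self_pow two_ne_zero _

/-- The box in the definition only secures finiteness: an integer is at most its square in absolute
value, so the norm bound already implies it. -/
theorem mem_intNet {n R : ℕ} {b : ℝ} {k : Fin n → ℤ} :
    k ∈ intNet n R b ↔ ∑ i, k i ^ 2 ≤ ((R * n : ℕ) : ℤ) ∧ ∀ i, |(k i : ℝ)| ≤ b := by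
  rw [intNet, Finset.mem_filter, Fintype.mem_piFinset]
  refine ⟨fun h => h.2, fun h => ⟨fun i => ?_, h⟩⟩
  have h1 := natAbs_le_sq (k i)
  have h2 := Finset.single_le_sum (f := fun i => k i ^ 2) (fun i _ => sq_nonneg _)
    (Finset.mem_univ i)
  have h3 := h.1
  rw [Finset.mem_Icc]
  constructor <;> omega

/-- Two geometric series of sum at most 2, with zero counted twice. -/
theorem sum_half_pow_natAbs_le (L : ℕ) :
    ∑ k ∈ Finset.Icc (-(L : ℤ)) L, (1 / 2 : ℝ) ^ k.natAbs ≤ 4 := by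
  classical
  have hsub : Finset.Icc (-(L : ℤ)) L ⊆ (Finset.range (L + 1)).image (fun j : ℕ => (j : ℤ)) ∪
      (Finset.range (L + 1)).image fun j : ℕ => -(j : ℤ) := by
    intro k hk
    rw [Finset.mem_Icc] at hk
    rw [Finset.mem_union, Finset.mem_image, Finset.mem_image]
    rcases le_total 0 k with h | h
    · exact .inl ⟨k.natAbs, by rw [Finset.mem_range]; omega, by omega⟩
    · exact .inr ⟨k.natAbs, by rw [Finset.mem_range]; omega, by omega⟩
  refine (Finset.sum_le_sum_of_subset_of_nonneg hsub fun _ _ _ => by positivity).trans ?_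
  have h1 := Finset.sum_union_inter (s₁ := (Finset.range (L + 1)).image fun j : ℕ => (j : ℤ))
    (s₂ := (Finset.range (L + 1)).image fun j : ℕ => -(j : ℤ))
    (f := fun k : ℤ => (1 / 2 : ℝ) ^ k.natAbs)
  have h2 : 0 ≤ ∑ k ∈ (Finset.range (L + 1)).image (fun j : ℕ => (j : ℤ)) ∩
      (Finset.range (L + 1)).image (fun j : ℕ => -(j : ℤ)), (1 / 2 : ℝ) ^ k.natAbs :=
    Finset.sum_nonneg fun _ _ => by positivity
  rw [Finset.sum_image (fun a _ b _ h => by simpa using h),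
    Finset.sum_image (fun a _ b _ h => by simpa using h)] at h1
  simp only [Int.natAbs_neg, Int.natAbs_natCast] at h1
  have h3 := sum_geometric_two_le (L + 1)
  linarith

/-- A weighted count: for integers the sum of the `|k i|` is at most the sum of the squares, so each
vector of the net has weight at least 1 under `2 ^ (R * n) * ∏ i, 2 ^ (-|k i|)`. The total weight
factorizes, with at most 4 per coordinate. -/
theorem card_intNet_le (n R : ℕ) (b : ℝ) : ((intNet n R b).card : ℝ) ≤ 2 ^ ((R + 2) * n) := by
  have h1 : ∀ k ∈ intNet n R b, (1 : ℝ) ≤ 2 ^ (R * n) * ∏ i, (1 / 2 : ℝ) ^ (k i).natAbs := by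
    intro k hk
    have h2 : ∑ i, (k i).natAbs ≤ R * n := by
      have h3 : ∑ i, ((k i).natAbs : ℤ) ≤ ∑ i, k i ^ 2 :=
        Finset.sum_le_sum fun i _ => natAbs_le_sq (k i)
      exact_mod_cast h3.trans (mem_intNet.1 hk).1
    rw [Finset.prod_pow_eq_pow_sum, one_div, inv_pow, ← div_eq_mul_inv, one_le_div (by positivity)]
    exact pow_le_pow_right₀ one_le_two h2
  calc ((intNet n R b).card : ℝ) = ∑ k ∈ intNet n R b, (1 : ℝ) := by simp
    _ ≤ ∑ k ∈ intNet n R b, 2 ^ (R * n) * ∏ i, (1 / 2 : ℝ) ^ (k i).natAbs := Finset.sum_le_sum h1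
    _ ≤ ∑ k ∈ Fintype.piFinset fun _ : Fin n =>
          Finset.Icc (-((R * n : ℕ) : ℤ)) ((R * n : ℕ) : ℤ),
          2 ^ (R * n) * ∏ i, (1 / 2 : ℝ) ^ (k i).natAbs :=
        Finset.sum_le_sum_of_subset_of_nonneg (Finset.filter_subset _ _)
          fun _ _ _ => by positivity
    _ = 2 ^ (R * n) * (∑ k ∈ Finset.Icc (-((R * n : ℕ) : ℤ)) ((R * n : ℕ) : ℤ),
          (1 / 2 : ℝ) ^ k.natAbs) ^ n := by
        rw [← Finset.mul_sum, Finset.sum_prod_piFinset _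
          fun (_ : Fin n) (k : ℤ) => (1 / 2 : ℝ) ^ k.natAbs]
        simp
    _ ≤ 2 ^ (R * n) * 4 ^ n := by
        gcongr
        exact sum_half_pow_natAbs_le _
    _ = 2 ^ ((R + 2) * n) := by
        rw [show (4 : ℝ) = 2 ^ 2 by norm_num, ← pow_mul, ← pow_add]
        ring

/-- A vector can be rounded to a multiple of `h` without decreasing a given linear functional. -/
theorem exists_int_rounding {n : ℕ} (δ g : Fin n → ℝ) {h : ℝ} (hh : 0 < h) :
    ∃ k : Fin n → ℤ, ∑ i, δ i * g i ≤ ∑ i, h * k i * g i ∧ ∀ i, |(k i : ℝ)| ≤ |δ i| / h + 1 := by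
  have hone : ∀ i, ∃ k : ℤ, δ i * g i ≤ h * k * g i ∧ |(k : ℝ)| ≤ |δ i| / h + 1 := by
    intro i
    have habs : |δ i| / h = |δ i / h| := by rw [abs_div, abs_of_pos hh]
    have e : h * (δ i / h) = δ i := by field_simp
    rw [habs]
    have h1 := Int.floor_le (δ i / h)
    have h2 := Int.lt_floor_add_one (δ i / h)
    have h3 := Int.le_ceil (δ i / h)
    have h4 := Int.ceil_lt_add_one (δ i / h)
    have h5 := le_abs_self (δ i / h)
    have h6 := neg_abs_le (δ i / h)
    -- Rounding up or down according to the sign of `g i` keeps the functional from decreasing, so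
    -- the net argument has no approximation error.
    rcases le_total 0 (g i) with hg | hg
    · refine ⟨⌈δ i / h⌉, ?_, abs_le.2 ⟨by linarith, by linarith⟩⟩
      refine mul_le_mul_of_nonneg_right ?_ hg
      nlinarith
    · refine ⟨⌊δ i / h⌋, ?_, abs_le.2 ⟨by linarith, by linarith⟩⟩
      refine mul_le_mul_of_nonpos_right ?_ hg
      nlinarith
  choose k hk using hone
  exact ⟨k, Finset.sum_le_sum fun i _ => (hk i).1, fun i => (hk i).2⟩

/-- `(a + 1) ^ 2 ≤ 2 * a ^ 2 + 2`; the radii 1 and 16 become the 4 and 34 of the nets. -/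
theorem sum_sq_le_of_abs_le {n R : ℕ} {δ : Fin n → ℝ} {h : ℝ} {k : Fin n → ℤ}
    (hk : ∀ i, |(k i : ℝ)| ≤ |δ i| / h + 1) (hδ : ∑ i, (δ i / h) ^ 2 ≤ R * n) :
    ∑ i, k i ^ 2 ≤ (((2 * R + 2) * n : ℕ) : ℤ) := by
  have h1 : ∀ i, (k i : ℝ) ^ 2 ≤ 2 * (δ i / h) ^ 2 + 2 := by
    intro i
    have h2 : |(k i : ℝ)| ≤ |δ i / h| + 1 := by
      refine (hk i).trans ?_
      rw [abs_div]
      gcongr ?_ + 1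
      rcases le_or_gt 0 h with hh | hh
      · rw [abs_of_nonneg hh]
      · exact (div_nonpos_of_nonneg_of_nonpos (abs_nonneg _) hh.le).trans (by positivity)
    rw [← sq_abs (k i : ℝ), ← sq_abs (δ i / h)]
    nlinarith [sq_nonneg (|δ i / h| - 1), abs_nonneg (k i : ℝ)]
  have h3 : ∑ i, (k i : ℝ) ^ 2 ≤ (2 * R + 2) * n := by
    refine (Finset.sum_le_sum fun i _ => h1 i).trans ?_
    rw [Finset.sum_add_distrib, ← Finset.mul_sum]
    simp only [Finset.sum_const, Finset.card_univ, Fintype.card_fin, nsmul_eq_mul]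
    linarith
  exact_mod_cast h3

end Net

/-! ### Chernoff and union bound over the net -/

section Uniform

variable {n : ℕ} {d : ℝ}

/-- Chernoff's bound for linear forms in the entries. -/
theorem sparseLaw_linear_le (hd : 0 < d) (hdn : 2 * d ≤ n) {a : Edge n → ℝ} {s : ℝ} (hs : 0 ≤ s)
    (ha : ∀ e, s * |a e| ≤ √d) (t : ℝ) :
    sparseLaw n d {y | t < ∑ e, y e * a e} ≤
      ENNReal.ofReal (Real.exp (-(s * t) + s ^ 2 * (∑ e, a e ^ 2) / n)) := by
  have hprob := isProbabilityMeasure_sparseEntryLaw (n := n) hd.le (by linarith : d ≤ n)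
  have := isProbabilityMeasure_sparseLaw (n := n) hd.le (by linarith : d ≤ n)
  have hsd : 0 < √d := Real.sqrt_pos.2 hd
  have hprod : ∀ y : Edge n → ℝ, Real.exp (s * (∑ e, y e * a e - t)) =
      Real.exp (-(s * t)) * ∏ e, Real.exp (s * a e * y e) := by
    intro y
    rw [← Real.exp_sum, ← Real.exp_add, mul_sub, Finset.mul_sum, sub_eq_neg_add]
    congr 2
    exact Finset.sum_congr rfl fun e _ => by ring
  refine (measure_le_ofReal_integral (Z := fun y => Real.exp (s * (∑ e, y e * a e - t)))
    (fun y => (Real.exp_pos _).le) (integrable_sparseLaw hd hdn (by fun_prop)) fun y hy => ?_).trans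
    (ENNReal.ofReal_le_ofReal ?_)
  · have hy' : t < ∑ e, y e * a e := hy
    exact Real.one_le_exp (mul_nonneg hs (by linarith))
  · simp only [hprod]
    rw [integral_const_mul, sparseLaw,
      integral_fintype_prod_eq_prod (μ := fun _ : Edge n => sparseEntryLaw n d)
        (fun e (r : ℝ) => Real.exp (s * a e * r)), Real.exp_add]
    gcongr
    rw [Finset.mul_sum, Finset.sum_div, Real.exp_sum]
    refine Finset.prod_le_prod (fun e _ => integral_nonneg fun _ => (Real.exp_pos _).le)
      fun e _ => ?_
    rw [← mul_pow]
    refine integral_exp_sparseEntryLaw_le hd hdn ?_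
    rw [abs_mul, abs_of_nonneg hs, mul_one_div, div_le_one hsd]
    exact ha e

theorem sum_edge_le_sum (f : Fin n → Fin n → ℝ) (hf : ∀ i j, 0 ≤ f i j) :
    ∑ e : Edge n, (f e.1.1 e.1.2 + f e.1.2 e.1.1) ≤ ∑ i, ∑ j, f i j := by
  have h := sum_symMatrix_mul (n := n) (fun _ => 1) f
  simp only [one_mul] at h
  rw [← h]
  refine Finset.sum_le_sum fun i _ => Finset.sum_le_sum fun j _ => ?_
  refine mul_le_of_le_one_left (hf i j) ?_
  simp only [symMatrix, Matrix.of_apply]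
  split_ifs <;> norm_num

/-- The vectors `u`, `v` for which the bilinear form has to be bounded. -/
structure AdmissiblePair (M ρ : ℝ) (u v : Fin n → ℝ) : Prop where
  sum_left : ∑ i, u i ^ 2 ≤ ρ * n
  sum_right : ∑ i, v i ^ 2 ≤ 16 * n
  abs_left : ∀ i, |u i| ≤ M
  abs_right : ∀ i, |v i| ≤ 2 * M

/-- The form is linear in each argument: `u` is rounded to multiples of `√ρ` with `v` fixed, then
`v` to integers with the rounded `u` fixed. The scale `√ρ` keeps the net for `u` exponential in `n`
with a rate independent of `ρ`. -/
theorem AdmissiblePair.exists_net {M ρ : ℝ} {u v : Fin n → ℝ} (h : AdmissiblePair M ρ u v)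
    (hρ : 0 < ρ) (y : Edge n → ℝ) :
    ∃ k ∈ intNet n 4 (M / √ρ + 1), ∃ l ∈ intNet n 34 (2 * M + 1),
      u ⬝ᵥ (symMatrix y).mulVec v ≤
        ∑ e : Edge n, y e * (√ρ * (k e.1.1 * l e.1.2 + k e.1.2 * l e.1.1)) := by
  have hs : 0 < √ρ := Real.sqrt_pos.2 hρ
  obtain ⟨k, hk, hk'⟩ := exists_int_rounding u ((symMatrix y).mulVec v) hs
  obtain ⟨l, hl, hl'⟩ := exists_int_rounding v
    (Matrix.vecMul (fun i => √ρ * (k i : ℝ)) (symMatrix y)) one_pos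
  refine ⟨k, mem_intNet.2 ⟨?_, fun i => ?_⟩, l, mem_intNet.2 ⟨?_, fun i => ?_⟩, ?_⟩
  · refine sum_sq_le_of_abs_le (R := 1) hk' ?_
    simp only [div_pow, Real.sq_sqrt hρ.le]
    rw [← Finset.sum_div, div_le_iff₀ hρ]
    have := h.sum_left
    push_cast
    linarith
  · refine (hk' i).trans ?_
    gcongr
    exact h.abs_left i
  · refine sum_sq_le_of_abs_le (R := 16) hl' ?_
    simpa using h.sum_right
  · refine (hl' i).trans ?_
    rw [div_one]
    gcongr
    exact h.abs_right i
  · have e1 : u ⬝ᵥ (symMatrix y).mulVec v ≤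
        (fun i => √ρ * (k i : ℝ)) ⬝ᵥ (symMatrix y).mulVec v := hk
    have e2 : (fun i => √ρ * (k i : ℝ)) ⬝ᵥ (symMatrix y).mulVec v ≤
        (fun i => √ρ * (k i : ℝ)) ⬝ᵥ (symMatrix y).mulVec fun i => (l i : ℝ) := by
      rw [Matrix.dotProduct_mulVec, Matrix.dotProduct_mulVec, dotProduct_comm,
        dotProduct_comm _ fun i => (l i : ℝ)]
      simpa only [one_mul] using! hl
    refine (e1.trans e2).trans (le_of_eq ?_)
    rw [dotProduct_symMatrix_mulVec]
    refine Finset.sum_congr rfl fun e _ => ?_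
    ring

/-- This is the variance proxy in Chernoff's bound. With `R = 4` and `R' = 34` it equals `272 * ρ *
n ^ 2`, small through `ρ`. -/
theorem sum_net_coeff_sq_le {R R' : ℕ} {b b' ρ : ℝ} (hρ : 0 ≤ ρ) {k l : Fin n → ℤ}
    (hk : k ∈ intNet n R b) (hl : l ∈ intNet n R' b') :
    ∑ e : Edge n, (√ρ * (k e.1.1 * l e.1.2 + k e.1.2 * l e.1.1)) ^ 2 ≤
      2 * ρ * ((R * n) * (R' * n)) := by
  have hk' : ∑ i, (k i : ℝ) ^ 2 ≤ R * n := by exact_mod_cast (mem_intNet.1 hk).1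
  have hl' : ∑ i, (l i : ℝ) ^ 2 ≤ R' * n := by exact_mod_cast (mem_intNet.1 hl).1
  calc ∑ e : Edge n, (√ρ * (k e.1.1 * l e.1.2 + k e.1.2 * l e.1.1)) ^ 2
      ≤ ∑ e : Edge n, 2 * ρ * ((k e.1.1 : ℝ) ^ 2 * (l e.1.2 : ℝ) ^ 2 +
          (k e.1.2 : ℝ) ^ 2 * (l e.1.1 : ℝ) ^ 2) := by
        refine Finset.sum_le_sum fun e _ => ?_
        rw [mul_pow, Real.sq_sqrt hρ, mul_comm 2 ρ, mul_assoc]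
        refine mul_le_mul_of_nonneg_left ?_ hρ
        nlinarith [sq_nonneg ((k e.1.1 : ℝ) * l e.1.2 - k e.1.2 * l e.1.1)]
    _ ≤ 2 * ρ * ∑ i, ∑ j, (k i : ℝ) ^ 2 * (l j : ℝ) ^ 2 := by
        rw [← Finset.mul_sum]
        refine mul_le_mul_of_nonneg_left ?_ (by positivity)
        exact sum_edge_le_sum (fun i j => (k i : ℝ) ^ 2 * (l j : ℝ) ^ 2) fun i j => by positivity
    _ ≤ _ := by
        rw [← Finset.sum_mul_sum]
        refine mul_le_mul_of_nonneg_left ?_ (by positivity)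
        exact mul_le_mul hk' hl' (Finset.sum_nonneg fun _ _ => sq_nonneg _) (by positivity)

theorem abs_net_coeff_le {R R' : ℕ} {b b' ρ : ℝ} {k l : Fin n → ℤ}
    (hk : k ∈ intNet n R b) (hl : l ∈ intNet n R' b') (e : Edge n) :
    |√ρ * (k e.1.1 * l e.1.2 + k e.1.2 * l e.1.1)| ≤ 2 * (√ρ * b * b') := by
  have hk' := (mem_intNet.1 hk).2
  have hl' := (mem_intNet.1 hl).2
  have hb : 0 ≤ b := (abs_nonneg _).trans (hk' e.1.1)
  rw [abs_mul, abs_of_nonneg (Real.sqrt_nonneg _)]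
  have h1 : |(k e.1.1 : ℝ) * l e.1.2 + k e.1.2 * l e.1.1| ≤ b * b' + b * b' := by
    refine (abs_add_le _ _).trans (add_le_add ?_ ?_)
    · rw [abs_mul]
      exact mul_le_mul (hk' _) (hl' _) (abs_nonneg _) hb
    · rw [abs_mul]
      exact mul_le_mul (hk' _) (hl' _) (abs_nonneg _) hb
  calc √ρ * |(k e.1.1 : ℝ) * l e.1.2 + k e.1.2 * l e.1.1| ≤ √ρ * (b * b' + b * b') := by gcongr
    _ = _ := by ring

/-- The nets have at most `2 ^ (6 n)` and `2 ^ (36 n)` elements, hence at most `exp (42 n)` pairs.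
Chernoff's bound with `s = 44 / θ` gives the exponent `-44 n + n`: the condition on `ρ` bounds the
quadratic term by `n`, and the condition on `M` keeps `s` times the coefficients below `√d`. -/
theorem sparseLaw_admissiblePair_le (hd : 0 < d) (hdn : 2 * d ≤ n) {M ρ θ : ℝ} (hM : 1 ≤ M)
    (hρ : 0 < ρ) (hρ1 : ρ ≤ 1) (hθ : 0 < θ) (hρθ : 272 * 44 ^ 2 * ρ ≤ θ ^ 2)
    (hMd : 12 * 44 * M ^ 2 ≤ θ * √d) :
    sparseLaw n d {y | ∃ u v : Fin n → ℝ, AdmissiblePair M ρ u v ∧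
      θ * n < u ⬝ᵥ (symMatrix y).mulVec v} ≤ ENNReal.ofReal (Real.exp (-n)) := by
  have hn : (0 : ℝ) < n := by linarith
  have hs0 : 0 < √ρ := Real.sqrt_pos.2 hρ
  have hs1 : √ρ ≤ 1 := Real.sqrt_le_one.2 hρ1
  set K := intNet n 4 (M / √ρ + 1) with hK
  set L := intNet n 34 (2 * M + 1) with hL
  have hsub : {y : Edge n → ℝ | ∃ u v : Fin n → ℝ, AdmissiblePair M ρ u v ∧
      θ * n < u ⬝ᵥ (symMatrix y).mulVec v} ⊆ ⋃ q ∈ K ×ˢ L, {y | θ * n <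
        ∑ e : Edge n, y e * (√ρ * (q.1 e.1.1 * q.2 e.1.2 + q.1 e.1.2 * q.2 e.1.1))} := by
    rintro y ⟨u, v, huv, hy⟩
    obtain ⟨k, hk, l, hl, hle⟩ := huv.exists_net hρ y
    simp only [Set.mem_iUnion]
    exact ⟨(k, l), Finset.mem_product.2 ⟨hk, hl⟩, hy.trans_le hle⟩
  have hone : ∀ q ∈ K ×ˢ L, sparseLaw n d {y | θ * n <
      ∑ e : Edge n, y e * (√ρ * (q.1 e.1.1 * q.2 e.1.2 + q.1 e.1.2 * q.2 e.1.1))} ≤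
        ENNReal.ofReal (Real.exp (-(43 * n))) := by
    intro q hq
    obtain ⟨hk, hl⟩ := Finset.mem_product.1 hq
    have hcoef := sum_net_coeff_sq_le hρ.le hk hl
    refine (sparseLaw_linear_le hd hdn (s := 44 / θ) (by positivity) (fun e => ?_) _).trans
      (ENNReal.ofReal_le_ofReal (Real.exp_le_exp.2 ?_))
    · refine (mul_le_mul_of_nonneg_left (abs_net_coeff_le hk hl e) (by positivity)).trans ?_
      -- Since `ρ ≤ 1 ≤ M`, the factors `M + √ρ` and `2 * M + 1` are at most `2 * M` and `3 * M`.
      have e1 : √ρ * (M / √ρ + 1) * (2 * M + 1) ≤ (2 * M) * (3 * M) := by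
        have : √ρ * (M / √ρ + 1) = M + √ρ := by field_simp
        rw [this]
        gcongr <;> linarith
      calc 44 / θ * (2 * (√ρ * (M / √ρ + 1) * (2 * M + 1))) ≤ 44 / θ * (2 * ((2 * M) * (3 * M))) := by
            gcongr
        _ = (12 * 44 * M ^ 2) / θ := by ring
        _ ≤ √d := by
            rw [div_le_iff₀ hθ]
            linarith
    · have e2 : (44 / θ) ^ 2 * (∑ e : Edge n, (√ρ * ((q.1 e.1.1 : ℝ) * q.2 e.1.2 +
          q.1 e.1.2 * q.2 e.1.1)) ^ 2) / n ≤ n := by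
        calc _ ≤ (44 / θ) ^ 2 * (2 * ρ * (((4 : ℕ) * n) * ((34 : ℕ) * n))) / n := by gcongr
          _ = (272 * 44 ^ 2 * ρ) / θ ^ 2 * n := by
              push_cast
              field_simp
              ring
          _ ≤ 1 * n := by
              gcongr
              exact div_le_one_of_le₀ hρθ (by positivity)
          _ = n := one_mul _
      have e3 : 44 / θ * (θ * n) = 44 * n := by field_simp
      linarith
  have hcard : (((K ×ˢ L).card : ℕ) : ℝ) ≤ Real.exp (42 * n) := by
    have h2 : (2 : ℝ) ≤ Real.exp 1 := by
      have := Real.add_one_le_exp (1 : ℝ)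
      linarith
    rw [Finset.card_product, Nat.cast_mul]
    calc (K.card : ℝ) * L.card ≤ 2 ^ ((4 + 2) * n) * 2 ^ ((34 + 2) * n) := by
          gcongr
          · exact card_intNet_le _ _ _
          · exact card_intNet_le _ _ _
      _ = 2 ^ (42 * n) := by
          rw [← pow_add]
          ring
      _ ≤ Real.exp 1 ^ (42 * n) := by gcongr
      _ = Real.exp (42 * n) := by
          rw [← Real.exp_nat_mul]
          push_cast
          ring_nf
  calc _ ≤ ∑ q ∈ K ×ˢ L, sparseLaw n d {y | θ * n <
        ∑ e : Edge n, y e * (√ρ * (q.1 e.1.1 * q.2 e.1.2 + q.1 e.1.2 * q.2 e.1.1))} :=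
        (measure_mono hsub).trans (measure_biUnion_finset_le _ _)
    _ ≤ (K ×ˢ L).card • ENNReal.ofReal (Real.exp (-(43 * n))) := Finset.sum_le_card_nsmul _ _ _ hone
    _ = ENNReal.ofReal ((K ×ˢ L).card * Real.exp (-(43 * n))) := by
        rw [nsmul_eq_mul, ENNReal.ofReal_mul (Nat.cast_nonneg _), ENNReal.ofReal_natCast]
    _ ≤ ENNReal.ofReal (Real.exp (42 * n) * Real.exp (-(43 * n))) := by gcongr
    _ = ENNReal.ofReal (Real.exp (-n)) := by
        rw [← Real.exp_add]
        ring_nf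

end Uniform

/-! ### Truncation and rounding -/

section Rounding

variable {n : ℕ}

theorem IsRounding.quad_le {A : Matrix (Fin n) (Fin n) ℝ} {v w : Fin n → ℝ}
    (h : IsRounding A v w) : quad A (clip v) ≤ quad A w := by
  obtain ⟨h, -⟩ := h
  induction h with
  | refl => exact le_rfl
  | tail _ hstep ih =>
    obtain ⟨_, _, _, _, _, hq⟩ := hstep
    exact ih.trans hq

theorem symMatrix_isSymm (x : Edge n → ℝ) : (symMatrix x).IsSymm := by
  ext i j
  simp only [Matrix.transpose_apply, symMatrix, Matrix.of_apply]
  rcases lt_trichotomy i j with h | h | h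
  · simp [h, h.not_gt]
  · simp [h]
  · simp [h, h.not_gt]

theorem symMatrix_diag (x : Edge n → ℝ) (i : Fin n) : symMatrix x i i = 0 := by
  simp [symMatrix]

/-- Truncation of the coordinates to `[-M, M]`. -/
def truncTo (M : ℝ) (v : Fin n → ℝ) : Fin n → ℝ := fun i => min M (max (-M) (v i))

theorem truncTo_cases (M t : ℝ) (hM : 1 ≤ M) :
    (|t| ≤ M ∧ min M (max (-M) t) = t) ∨ (M < t ∧ min M (max (-M) t) = M ∧
      min 1 (max (-1) t) = 1) ∨ (t < -M ∧ min M (max (-M) t) = -M ∧ min 1 (max (-1) t) = -1) := by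
  rcases lt_or_ge t (-M) with h | h
  · refine .inr (.inr ⟨h, ?_, ?_⟩)
    · rw [max_eq_left h.le, min_eq_right (by linarith)]
    · rw [max_eq_left (by linarith), min_eq_right (by norm_num)]
  · rcases lt_or_ge M t with h' | h'
    · refine .inr (.inl ⟨h', ?_, ?_⟩)
      · rw [max_eq_right h, min_eq_left h'.le]
      · rw [max_eq_right (by linarith), min_eq_left (by linarith)]
    · exact .inl ⟨abs_le.2 ⟨h, h'⟩, by rw [max_eq_right h, min_eq_right h']⟩

theorem clip_cases (t : ℝ) : (|t| ≤ 1 ∧ min 1 (max (-1) t) = t) ∨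
    (1 < t ∧ min 1 (max (-1) t) = 1) ∨ (t < -1 ∧ min 1 (max (-1) t) = -1) := by
  rcases truncTo_cases 1 t le_rfl with h | h | h
  · exact .inl h
  · exact .inr (.inl ⟨h.1, h.2.1⟩)
  · exact .inr (.inr ⟨h.1, h.2.1⟩)

variable {M : ℝ}

theorem truncTo_sub_clip_sq_le (hM : 1 ≤ M) (v : Fin n → ℝ) (i : Fin n) :
    (truncTo M v i - clip v i) ^ 2 ≤ (v i - clip v i) ^ 2 := by
  simp only [truncTo, clip]
  rcases truncTo_cases M (v i) hM with ⟨-, h⟩ | ⟨h1, h2, h3⟩ | ⟨h1, h2, h3⟩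
  · rw [h]
  · rw [h2, h3]
    nlinarith
  · rw [h2, h3]
    nlinarith

theorem sub_truncTo_sq_le (hM : 1 ≤ M) (v : Fin n → ℝ) (i : Fin n) :
    (v i - truncTo M v i) ^ 2 ≤ (v i - clip v i) ^ 2 := by
  simp only [truncTo, clip]
  rcases truncTo_cases M (v i) hM with ⟨-, h⟩ | ⟨h1, h2, h3⟩ | ⟨h1, h2, h3⟩
  · rw [h, sub_self, zero_pow two_ne_zero]
    exact sq_nonneg _
  · rw [h2, h3]
    nlinarith
  · rw [h2, h3]
    nlinarith

theorem abs_truncTo_sub_clip_le (hM : 1 ≤ M) (v : Fin n → ℝ) (i : Fin n) :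
    |truncTo M v i - clip v i| ≤ M := by
  simp only [truncTo, clip]
  rcases truncTo_cases M (v i) hM with ⟨h0, h⟩ | ⟨h1, h2, h3⟩ | ⟨h1, h2, h3⟩
  · rw [h]
    rcases clip_cases (v i) with ⟨h4, h5⟩ | ⟨h4, h5⟩ | ⟨h4, h5⟩
    · rw [h5, sub_self, abs_zero]
      linarith
    · rw [h5]
      exact abs_le.2 ⟨by linarith, by linarith [(abs_le.1 h0).2]⟩
    · rw [h5]
      exact abs_le.2 ⟨by linarith [(abs_le.1 h0).1], by linarith⟩
  · rw [h2, h3]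
    exact abs_le.2 ⟨by linarith, by linarith⟩
  · rw [h2, h3]
    exact abs_le.2 ⟨by linarith, by linarith⟩

theorem abs_truncTo_le (hM : 0 ≤ M) (v : Fin n → ℝ) (i : Fin n) : |truncTo M v i| ≤ M := by
  refine abs_le.2 ⟨le_min (by linarith) (le_max_left _ _), min_le_left _ _⟩

theorem abs_truncTo_le_abs (hM : 0 ≤ M) (v : Fin n → ℝ) (i : Fin n) :
    |truncTo M v i| ≤ |v i| := by
  simp only [truncTo]
  have h1 := neg_abs_le (v i)
  have h2 := le_abs_self (v i)
  refine abs_le.2 ⟨le_min ?_ (h1.trans (le_max_right _ _)), ?_⟩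
  · linarith [abs_nonneg (v i)]
  · rcases le_total (-M) (v i) with h | h
    · rw [max_eq_right h]
      exact (min_le_right _ _).trans h2
    · rw [max_eq_left h]
      exact (min_le_right _ _).trans (by linarith [abs_nonneg (v i)])

theorem clip_eq_truncTo (v : Fin n → ℝ) : clip v = truncTo 1 v := rfl

/-- The part of a coordinate beyond a high level `M` is controlled by a high moment. -/
theorem sub_truncTo_sq_le_pow (hM : 1 ≤ M) (v : Fin n → ℝ) (i : Fin n) :
    (v i - truncTo M v i) ^ 2 ≤ v i ^ 10 / M ^ 8 := by
  have hM0 : 0 < M := by linarith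
  have h10 : ∀ t : ℝ, M ≤ |t| → t ^ 2 ≤ t ^ 10 / M ^ 8 := by
    intro t ht
    rw [le_div_iff₀ (by positivity)]
    have h1 : M ^ 8 ≤ t ^ 8 := by
      rw [← Even.pow_abs (by decide : Even 8) t]
      exact pow_le_pow_left₀ hM0.le ht 8
    calc t ^ 2 * M ^ 8 ≤ t ^ 2 * t ^ 8 := by gcongr
      _ = t ^ 10 := by ring
  simp only [truncTo]
  rcases truncTo_cases M (v i) hM with ⟨-, h⟩ | ⟨h1, h2, -⟩ | ⟨h1, h2, -⟩
  · rw [h, sub_self, zero_pow two_ne_zero]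
    exact div_nonneg (Even.pow_nonneg (by decide) _) (by positivity)
  · rw [h2]
    refine le_trans ?_ (h10 _ (h1.le.trans (le_abs_self _)))
    nlinarith
  · rw [h2]
    refine le_trans ?_ (h10 _ (by linarith [neg_abs_le (v i)]))
    nlinarith

/-- The constant 16: each summand is at most `4 * v i ^ 2`, hence at most 8 times the squared excess
plus 8, and the squared excesses sum to at most `ρ * n ≤ n`. -/
theorem admissiblePair_truncTo (hM : 1 ≤ M) {ρ : ℝ} (hρ : ρ ≤ 1) {v : Fin n → ℝ}
    (hv : ∑ i, (v i - clip v i) ^ 2 ≤ ρ * n) :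
    AdmissiblePair M ρ (truncTo M v - clip v) (truncTo M v + clip v) where
  sum_left := (Finset.sum_le_sum fun i _ => truncTo_sub_clip_sq_le hM v i).trans hv
  sum_right := by
    have h1 : ∀ i, (truncTo M v i + clip v i) ^ 2 ≤ 8 * (v i - clip v i) ^ 2 + 8 := by
      intro i
      have h2 := abs_truncTo_le_abs (by linarith : 0 ≤ M) v i
      have h3 := abs_truncTo_le_abs zero_le_one v i
      rw [← clip_eq_truncTo] at h3
      have h4 : (truncTo M v i + clip v i) ^ 2 ≤ (2 * |v i|) ^ 2 := by
        rw [← sq_abs]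
        refine pow_le_pow_left₀ (abs_nonneg _) ((abs_add_le _ _).trans (by linarith)) 2
      rw [mul_pow, sq_abs] at h4
      obtain ⟨h5, h6⟩ := clip_mem v i
      nlinarith [sq_nonneg (v i - 2 * clip v i)]
    have hn : (0 : ℝ) ≤ n := Nat.cast_nonneg n
    refine (Finset.sum_le_sum fun i _ => h1 i).trans ?_
    rw [Finset.sum_add_distrib, ← Finset.mul_sum]
    simp only [Finset.sum_const, Finset.card_univ, Fintype.card_fin, nsmul_eq_mul]
    nlinarith
  abs_left := abs_truncTo_sub_clip_le hM v
  abs_right i := by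
    have h2 := abs_truncTo_le (by linarith : 0 ≤ M) v i
    have h3 := abs_truncTo_le zero_le_one v i
    rw [← clip_eq_truncTo] at h3
    exact (abs_add_le _ _).trans (by linarith)

/-- Applied with `u` the truncation of `v` at level `M` and `w` its truncation at level 1. The first
term pairs a small vector with the matrix applied to `v`, a polynomial with bounded moments; the
second concerns coordinates beyond `M`; the third is the bounded form of the union bound. -/
theorem quad_sub_quad (y : Edge n → ℝ) (u v w : Fin n → ℝ) :
    quad (symMatrix y) v - quad (symMatrix y) w =
      2 * ((v - u) ⬝ᵥ (symMatrix y).mulVec v) - quad (symMatrix y) (v - u) +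
        (u - w) ⬝ᵥ (symMatrix y).mulVec (u + w) := by
  simp only [quad, dotProduct_symMatrix_mulVec, Finset.mul_sum, ← Finset.sum_sub_distrib,
    ← Finset.sum_add_distrib]
  refine Finset.sum_congr rfl fun e _ => ?_
  simp only [Pi.sub_apply, Pi.add_apply]
  ring

theorem two_mul_dotProduct_le (t g : Fin n → ℝ) {s : ℝ} (hs : 0 < s) :
    2 * (t ⬝ᵥ g) ≤ s * ∑ i, t i ^ 2 + 1 / s * ∑ i, g i ^ 2 := by
  simp only [dotProduct, Finset.mul_sum, ← Finset.sum_add_distrib]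
  refine Finset.sum_le_sum fun i _ => ?_
  rw [← sub_nonneg]
  have : s * t i ^ 2 + 1 / s * g i ^ 2 - 2 * (t i * g i) = (s * t i - g i) ^ 2 / s := by
    field_simp
    ring
  rw [this]
  positivity

theorem sum_edge_add (g : Edge n → ℝ) (t : Fin n → ℝ) :
    ∑ e : Edge n, g e * (t e.1.1 + t e.1.2) = ∑ i, t i * ∑ e ∈ edgesAt i, g e := by
  have h1 := dotProduct_symMatrix_mulVec g t fun _ => 1
  simp only [mul_one] at h1
  rw [← h1, dotProduct]
  refine Finset.sum_congr rfl fun i _ => ?_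
  rw [symMatrix_mulVec]
  simp

/-- By `|t_i t_j| ≤ (t_i ^ 2 + t_j ^ 2) / 2` the form is dominated by absolute row sums, and the
hypothesis turns these into row sums of squares. The 2 stems from the at most `2 * n` edges at a
node. -/
theorem neg_quad_le {a : ℝ} (ha : 0 ≤ a) {y : Edge n → ℝ} (hy : ∀ e, |y e| ≤ a * (1 / n + y e ^ 2))
    (t : Fin n → ℝ) :
    -quad (symMatrix y) t ≤ a * ∑ i, t i ^ 2 * (2 + ∑ e ∈ edgesAt i, y e ^ 2) := by
  have h1 : -quad (symMatrix y) t ≤ ∑ e : Edge n, |y e| * (t e.1.1 ^ 2 + t e.1.2 ^ 2) := by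
    rw [quad_symMatrix, ← neg_mul, Finset.mul_sum]
    refine Finset.sum_le_sum fun e _ => ?_
    have h2 := neg_abs_le (y e * (t e.1.1 * t e.1.2))
    rw [abs_mul] at h2
    have h3 := abs_mul_le_half (t e.1.1) (t e.1.2)
    nlinarith [abs_nonneg (y e)]
  refine h1.trans ?_
  rw [sum_edge_add (fun e => |y e|) fun i => t i ^ 2, Finset.mul_sum]
  refine Finset.sum_le_sum fun i _ => ?_
  rw [mul_left_comm]
  refine mul_le_mul_of_nonneg_left ?_ (sq_nonneg _)
  refine (Finset.sum_le_sum fun e _ => hy e).trans ?_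
  rw [← Finset.mul_sum, Finset.sum_add_distrib]
  gcongr
  rw [Finset.sum_const, nsmul_eq_mul, mul_one_div]
  have hn : (0 : ℝ) < n := Nat.cast_pos.2 (Fin.pos i)
  rw [div_le_iff₀ hn]
  exact_mod_cast card_edges_at_le i

end Rounding

/-! ### The loss of the objective under truncation and rounding -/

section RoundingLimit

variable {Δ : ℕ} {c P : ℝ}

/-- The error that is caused by the linear term. -/
def linearError {n : ℕ} (s : ℝ) (y : Edge n → ℝ) (v : Fin n → ℝ) : ℝ :=
  s * avgExcess v + 1 / s * (1 / (n : ℝ) * ∑ i, (symMatrix y).mulVec v i ^ 2)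

/-- The error that is caused by the truncation at a high level. -/
def tailError {n : ℕ} (d : ℝ) (y : Edge n → ℝ) (v : Fin n → ℝ) : ℝ :=
  √(2 * d) / d * (1 / (n : ℝ) * ∑ i, (v i ^ 20 + (8 + 2 * (∑ e ∈ edgesAt i, y e ^ 2) ^ 2)))

/-- The choice `M ^ 8 = d` makes the part beyond `M` at most `v i ^ 10 / d`, which beats the factor
`√(2 * d)` from the size of the entries and leaves a tail of order `1 / √d`. -/
theorem objective_sub_le {n : ℕ} {d M ρ s θ : ℝ} (hn : 0 < n) (hd : 0 < d) (hM : 1 ≤ M)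
    (hMd : M ^ 8 = d) (hs : 0 < s) {y : Edge n → ℝ}
    (hy : ∀ e, |y e| ≤ √(2 * d) * (1 / n + y e ^ 2)) {v w : Fin n → ℝ} (hρ1 : ρ ≤ 1)
    (hρ : avgExcess v ≤ ρ)
    (hθ : ∀ u z : Fin n → ℝ, AdmissiblePair M ρ u z → u ⬝ᵥ (symMatrix y).mulVec z ≤ θ * n)
    (hw : quad (symMatrix y) (clip v) ≤ quad (symMatrix y) w) :
    objective (symMatrix y) v ≤ objective (symMatrix y) w +
      (linearError s y v + tailError d y v + θ) / 2 := by
  have hn' : (0 : ℝ) < n := Nat.cast_pos.2 hn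
  have hexc : ∑ i, (v i - clip v i) ^ 2 = n * avgExcess v := by
    rw [avgExcess]
    field_simp
  have h1 := hθ _ _ (admissiblePair_truncTo hM hρ1 (v := v) (by
    rw [hexc, mul_comm]
    gcongr))
  have h2 : 2 * ((v - truncTo M v) ⬝ᵥ (symMatrix y).mulVec v) ≤ n * linearError s y v := by
    refine (two_mul_dotProduct_le _ _ hs).trans ?_
    have e : n * linearError s y v = s * (n * avgExcess v) +
        1 / s * ∑ i, (symMatrix y).mulVec v i ^ 2 := by
      rw [linearError]
      field_simp
    rw [e, ← hexc]
    exact add_le_add (mul_le_mul_of_nonneg_left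
      (Finset.sum_le_sum fun i _ => sub_truncTo_sq_le hM v i) hs.le) le_rfl
  have h3 : -quad (symMatrix y) (v - truncTo M v) ≤ n * tailError d y v := by
    refine (neg_quad_le (Real.sqrt_nonneg _) hy _).trans ?_
    have e : n * tailError d y v = √(2 * d) *
        ∑ i, (v i ^ 20 + (8 + 2 * (∑ e ∈ edgesAt i, y e ^ 2) ^ 2)) / d := by
      rw [tailError, ← Finset.sum_div]
      field_simp
    rw [e]
    refine mul_le_mul_of_nonneg_left (Finset.sum_le_sum fun i _ => ?_) (Real.sqrt_nonneg _)
    have h4 := sub_truncTo_sq_le_pow hM v i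
    rw [hMd] at h4
    set S := ∑ e ∈ edgesAt i, y e ^ 2
    have hS : 0 ≤ S := Finset.sum_nonneg fun _ _ => sq_nonneg _
    calc (v - truncTo M v) i ^ 2 * (2 + S) ≤ v i ^ 10 / d * (2 + S) := by
          rw [Pi.sub_apply]
          gcongr
      _ = (v i ^ 10 * (2 + S)) / d := by ring
      _ ≤ _ := by
          gcongr
          -- The product is at most `(v i ^ 10) ^ 2 + (2 + S) ^ 2`, and `(2 + S) ^ 2 ≤ 8 + 2 * S ^
          -- 2`.
          nlinarith [sq_nonneg (v i ^ 10 - (2 + S)), sq_nonneg (S - 2), sq_nonneg (v i ^ 10)]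
  have h5 := quad_sub_quad y (truncTo M v) v (clip v)
  have h6 : quad (symMatrix y) v ≤ quad (symMatrix y) w +
      n * (linearError s y v + tailError d y v + θ) := by linarith
  calc objective (symMatrix y) v ≤ 1 / (2 * (n : ℝ)) * (quad (symMatrix y) w +
        n * (linearError s y v + tailError d y v + θ)) := by
        unfold objective
        gcongr
    _ = _ := by
        unfold objective
        field_simp

theorem linearError_nonneg {n : ℕ} {s : ℝ} (hs : 0 < s) (y : Edge n → ℝ) (v : Fin n → ℝ) :
    0 ≤ linearError s y v := by
  have := avgExcess_nonneg v
  unfold linearError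
  positivity

theorem tailError_nonneg {n : ℕ} {d : ℝ} (hd : 0 < d) (y : Edge n → ℝ) (v : Fin n → ℝ) :
    0 ≤ tailError d y v := by
  have : ∀ i, 0 ≤ v i ^ 20 := fun i => Even.pow_nonneg (by decide) _
  unfold tailError
  refine mul_nonneg (by positivity) (mul_nonneg (by positivity) (Finset.sum_nonneg fun i _ => ?_))
  have := this i
  positivity

variable {n : ℕ} {d : ℝ} {p : Fin n → MvPolynomial (Edge n) ℝ}

theorem continuous_mulVec_evalVec (p : Fin n → MvPolynomial (Edge n) ℝ) (i : Fin n) :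
    Continuous fun y => (symMatrix y).mulVec (evalVec p y) i :=
  (continuous_apply i).comp (continuous_symMatrix.matrix_mulVec (continuous_evalVec p))

theorem average_le {f : Fin n → ℝ} {C : ℝ} (hn : 0 < n) (h : ∀ i, f i ≤ C) :
    1 / (n : ℝ) * ∑ i, f i ≤ C := by
  have hn' : (0 : ℝ) < n := Nat.cast_pos.2 hn
  rw [one_div, inv_mul_le_iff₀ hn']
  simpa using Finset.sum_le_card_nsmul Finset.univ f C fun i _ => h i

theorem exists_integral_linearError_le (Δ : ℕ) (c : ℝ) : ∃ C : ℝ, 0 ≤ C ∧ ∀ (n : ℕ) (d : ℝ)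
    (p : Fin n → MvPolynomial (Edge n) ℝ), IsTreeVec Δ c p → 0 < n → 1 ≤ d → 2 * d ≤ n →
      ∀ s : ℝ, 0 < s →
      Integrable (fun y => linearError s y (evalVec p y)) (sparseLaw n d) ∧
      ∫ y, linearError s y (evalVec p y) ∂(sparseLaw n d) ≤
        s * ∫ y, avgExcess (evalVec p y) ∂(sparseLaw n d) + 1 / s * C := by
  obtain ⟨C, hC⟩ := exists_integral_mulVec_sq_le Δ c
  refine ⟨|C|, abs_nonneg C, fun n d p hp hn hd hdn s hs => ?_⟩
  have hd0 : 0 < d := by linarith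
  have i1 : Integrable (fun y => s * avgExcess (evalVec p y)) (sparseLaw n d) :=
    (integrable_sparseLaw hd0 hdn (continuous_avgExcess.comp (continuous_evalVec p))).const_mul s
  have i2 : ∀ i, Integrable (fun y => (symMatrix y).mulVec (evalVec p y) i ^ 2) (sparseLaw n d) :=
    fun i => integrable_sparseLaw hd0 hdn ((continuous_mulVec_evalVec p i).pow 2)
  have i3 : Integrable (fun y => 1 / s * (1 / (n : ℝ) *
      ∑ i, (symMatrix y).mulVec (evalVec p y) i ^ 2)) (sparseLaw n d) :=
    ((integrable_finsetSum _ fun i _ => i2 i).const_mul _).const_mul _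
  refine ⟨i1.add i3, ?_⟩
  simp only [linearError]
  rw [integral_add i1 i3, integral_const_mul, integral_const_mul, integral_const_mul,
    integral_finsetSum _ fun i _ => i2 i]
  gcongr
  exact average_le hn fun i => (hC n d p hp hd hdn i).trans (le_abs_self C)

theorem exists_integral_tailError_le (Δ : ℕ) (c : ℝ) : ∃ C : ℝ, ∀ (n : ℕ) (d : ℝ)
    (p : Fin n → MvPolynomial (Edge n) ℝ), IsTreeVec Δ c p → 0 < n → 1 ≤ d → 2 * d ≤ n →
      Integrable (fun y => tailError d y (evalVec p y)) (sparseLaw n d) ∧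
      ∫ y, tailError d y (evalVec p y) ∂(sparseLaw n d) ≤ C / √d := by
  obtain ⟨C₁, hC₁⟩ := exists_integral_eval_pow_le Δ c (m := 20) le_rfl
  obtain ⟨C₂, hC₂⟩ := exists_integral_rowSq_sq_le
  refine ⟨√2 * (C₁ + (8 + 2 * C₂)), fun n d p hp hn hd hdn => ?_⟩
  have hd0 : 0 < d := by linarith
  have := isProbabilityMeasure_sparseLaw (n := n) hd0.le (by linarith)
  have i1 : ∀ i, Integrable (fun y => evalVec p y i ^ 20) (sparseLaw n d) := fun i =>
    integrable_sparseLaw hd0 hdn (((continuous_apply i).comp (continuous_evalVec p)).pow 20)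
  have i2 : ∀ i : Fin n, Integrable (fun y => (∑ e ∈ edgesAt i, y e ^ 2) ^ 2) (sparseLaw n d) :=
    fun i => integrable_sparseLaw hd0 hdn (by fun_prop)
  have i3 : ∀ i : Fin n, Integrable (fun y => 8 + 2 * (∑ e ∈ edgesAt i, y e ^ 2) ^ 2)
      (sparseLaw n d) := fun i => (integrable_const _).add ((i2 i).const_mul 2)
  have i4 : ∀ i : Fin n, Integrable
      (fun y => evalVec p y i ^ 20 + (8 + 2 * (∑ e ∈ edgesAt i, y e ^ 2) ^ 2)) (sparseLaw n d) :=
    fun i => (i1 i).add (i3 i)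
  refine ⟨((integrable_finsetSum _ fun i _ => i4 i).const_mul _).const_mul _, ?_⟩
  simp only [tailError]
  rw [integral_const_mul, integral_const_mul, integral_finsetSum _ fun i _ => i4 i]
  have hone : ∀ i : Fin n, ∫ y, (evalVec p y i ^ 20 + (8 + 2 * (∑ e ∈ edgesAt i, y e ^ 2) ^ 2))
      ∂(sparseLaw n d) ≤ C₁ + (8 + 2 * C₂) := by
    intro i
    rw [integral_add (i1 i) (i3 i), integral_add (integrable_const _) ((i2 i).const_mul 2),
      integral_const_mul, integral_const, probReal_univ, one_smul]
    have := hC₁ n d p hp hd hdn i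
    have := hC₂ n d hd hdn i
    linarith
  have hs : √(2 * d) / d = √2 / √d := by
    rw [Real.sqrt_mul (by norm_num), mul_div_assoc, Real.sqrt_div_self', mul_one_div]
  rw [hs]
  calc √2 / √d * _ ≤ √2 / √d * (C₁ + (8 + 2 * C₂)) := by
        gcongr
        exact average_le hn hone
    _ = _ := by ring

/-- Five exceptional events have vanishing probability: a small objective before rounding, a large
linear error, a large tail error, a large excess, and a failure of the uniform bilinear bound.
Outside them `objective_sub_le` applies to whatever value `σ` returns. -/
theorem plimGe_rounding {p : ∀ n : ℕ, Fin n → MvPolynomial (Edge n) ℝ}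
    (hp : ∀ n, IsTreeVec Δ c (p n))
    (hlim : Tendsto (fun q : ℕ × ℝ => ∫ y, avgExcess (evalVec (p q.1) y) ∂(sparseLaw q.1 q.2))
      sparseLimit (𝓝 0))
    (hobj : PLimGe sparseLimit (fun q => sparseLaw q.1 q.2)
      (fun q y => objective (symMatrix y) (evalVec (p q.1) y)) P)
    {σ : ∀ n : ℕ, (Fin n → ℝ) → Matrix (Fin n) (Fin n) ℝ → (Fin n → ℝ)}
    (hσ : IsRoundingOperator σ) :
    PLimGe sparseLimit (fun q => sparseLaw q.1 q.2)
      (fun q y => objective (symMatrix y) (σ q.1 (evalVec (p q.1) y) (symMatrix y))) P := by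
  intro ε hε
  obtain ⟨C₁, hC₁0, hC₁⟩ := exists_integral_linearError_le Δ c
  obtain ⟨C₂, hC₂⟩ := exists_integral_tailError_le Δ c
  set θ := ε / 4 with hθ
  have hθ0 : 0 < θ := by positivity
  set ρ := min 1 (θ ^ 2 / (272 * 44 ^ 2)) with hρ
  have hρ0 : 0 < ρ := lt_min one_pos (by positivity)
  have hρ1 : ρ ≤ 1 := min_le_left _ _
  have hρθ : 272 * 44 ^ 2 * ρ ≤ θ ^ 2 := by
    have : ρ ≤ θ ^ 2 / (272 * 44 ^ 2) := min_le_right _ _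
    rw [le_div_iff₀ (by norm_num)] at this
    linarith
  -- The summand `1 / √d` only keeps `a` positive. With `s = 1 / √a` both parts of the linear error
  -- are of order `√a`.
  set a : ℕ × ℝ → ℝ := fun q =>
    (∫ y, avgExcess (evalVec (p q.1) y) ∂(sparseLaw q.1 q.2)) + 1 / √q.2 with ha
  have ha0 : Tendsto a sparseLimit (𝓝 0) := by
    have := hlim.add (tendsto_const_div_sqrt_sparseLimit 1)
    rw [add_zero] at this
    exact this
  set s : ℕ × ℝ → ℝ := fun q => 1 / √(a q) with hs
  -- The level `d ^ (1/8)` tends to infinity, yet `M ^ 2 = d ^ (1/4)` is negligible against `√d`, as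
  -- the union bound requires.
  set M : ℕ × ℝ → ℝ := fun q => √(√(√q.2)) with hM
  -- the exceptional events
  have t0 := hobj (ε / 2) (by positivity)
  have t1 : Tendsto (fun q : ℕ × ℝ => sparseLaw q.1 q.2
      {y | θ < linearError (s q) y (evalVec (p q.1) y)}) sparseLimit (𝓝 0) := by
    have hg : Tendsto (fun q => ((1 + C₁) * √(a q)) / θ) sparseLimit (𝓝 0) := by
      have := (Real.continuous_sqrt.tendsto 0).comp ha0
      rw [Real.sqrt_zero] at this
      simpa using (this.const_mul (1 + C₁)).div_const θ
    refine tendsto_measure_zero hg ?_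
    filter_upwards [eventually_sparseLimit] with q hq
    obtain ⟨hn, hd, hdn⟩ := hq
    have hd0 : 0 < q.2 := by linarith
    have hexc : 0 ≤ ∫ y, avgExcess (evalVec (p q.1) y) ∂(sparseLaw q.1 q.2) :=
      integral_nonneg fun y => avgExcess_nonneg _
    have haq : 0 < a q := by
      have : 0 < 1 / √q.2 := by positivity
      exact add_pos_of_nonneg_of_pos hexc this
    have hsa : 0 < √(a q) := Real.sqrt_pos.2 haq
    have hsq : 0 < s q := by positivity
    obtain ⟨hint, hle⟩ := hC₁ q.1 q.2 (p q.1) (hp q.1) hn hd hdn (s q) hsq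
    refine (measure_lt_le_of_nonneg (.of_forall fun y => linearError_nonneg hsq _ _) hint
      hθ0).trans (ENNReal.ofReal_le_ofReal ?_)
    gcongr
    refine hle.trans ?_
    have h1 : ∫ y, avgExcess (evalVec (p q.1) y) ∂(sparseLaw q.1 q.2) ≤ a q :=
      le_add_of_nonneg_right (by positivity)
    have h2 : s q * a q = √(a q) := by
      simp only [hs]
      rw [one_div, inv_mul_eq_div, Real.div_sqrt]
    have h3 : 1 / s q = √(a q) := one_div_one_div _
    rw [h3]
    nlinarith [mul_le_mul_of_nonneg_left h1 hsq.le]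
  have t2 : Tendsto (fun q : ℕ × ℝ => sparseLaw q.1 q.2
      {y | θ < tailError q.2 y (evalVec (p q.1) y)}) sparseLimit (𝓝 0) := by
    have hg : Tendsto (fun q : ℕ × ℝ => (C₂ / √q.2) / θ) sparseLimit (𝓝 0) := by
      simpa using (tendsto_const_div_sqrt_sparseLimit C₂).div_const θ
    refine tendsto_measure_zero hg ?_
    filter_upwards [eventually_sparseLimit] with q hq
    obtain ⟨hn, hd, hdn⟩ := hq
    have hd0 : 0 < q.2 := by linarith
    obtain ⟨hint, hle⟩ := hC₂ q.1 q.2 (p q.1) (hp q.1) hn hd hdn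
    refine (measure_lt_le_of_nonneg (.of_forall fun y => tailError_nonneg hd0 _ _) hint
      hθ0).trans (ENNReal.ofReal_le_ofReal ?_)
    gcongr
  have t3 : Tendsto (fun q : ℕ × ℝ => sparseLaw q.1 q.2
      {y | ρ < avgExcess (evalVec (p q.1) y)}) sparseLimit (𝓝 0) := by
    have hg := hlim.div_const ρ
    rw [zero_div] at hg
    refine tendsto_measure_zero hg ?_
    filter_upwards [eventually_sparseLimit] with q hq
    obtain ⟨hn, hd, hdn⟩ := hq
    have hd0 : 0 < q.2 := by linarith
    exact measure_lt_le_of_nonneg (.of_forall fun y => avgExcess_nonneg _)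
      (integrable_sparseLaw hd0 hdn (continuous_avgExcess.comp (continuous_evalVec (p q.1)))) hρ0
  have hMlim : Tendsto M sparseLimit atTop :=
    (Real.tendsto_sqrt_atTop.comp (Real.tendsto_sqrt_atTop.comp Real.tendsto_sqrt_atTop)).comp
      tendsto_snd_sparseLimit
  have hMs : ∀ q, M q ^ 4 = √q.2 := by
    intro q
    simp only [hM]
    rw [show 4 = 2 * 2 from rfl, pow_mul, Real.sq_sqrt (Real.sqrt_nonneg _),
      Real.sq_sqrt (Real.sqrt_nonneg _)]
  have hMev : ∀ᶠ q in sparseLimit, 1 ≤ M q ∧ 12 * 44 * M q ^ 2 ≤ θ * √q.2 := by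
    filter_upwards [hMlim.eventually_ge_atTop 1, hMlim.eventually_ge_atTop (12 * 44 / θ)]
      with q h1 h2
    refine ⟨h1, ?_⟩
    rw [div_le_iff₀ hθ0] at h2
    have h3 : M q * θ ≤ M q ^ 2 * θ := by
      gcongr
      nlinarith
    calc 12 * 44 * M q ^ 2 ≤ (M q ^ 2 * θ) * M q ^ 2 := by
          exact mul_le_mul_of_nonneg_right (h2.trans h3) (sq_nonneg _)
      _ = θ * M q ^ 4 := by ring
      _ = θ * √q.2 := by rw [hMs]
  have t4 : Tendsto (fun q : ℕ × ℝ => sparseLaw q.1 q.2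
      {y | ∃ u v : Fin q.1 → ℝ, AdmissiblePair (M q) ρ u v ∧
        θ * q.1 < u ⬝ᵥ (symMatrix y).mulVec v}) sparseLimit (𝓝 0) := by
    have hg : Tendsto (fun q : ℕ × ℝ => Real.exp (-(q.1 : ℝ))) sparseLimit (𝓝 0) :=
      (Real.tendsto_exp_neg_atTop_nhds_zero.comp tendsto_natCast_atTop_atTop).comp
        tendsto_fst_sparseLimit
    refine tendsto_measure_zero hg ?_
    filter_upwards [eventually_sparseLimit, hMev] with q hq hMq
    obtain ⟨hn, hd, hdn⟩ := hq
    exact sparseLaw_admissiblePair_le (by linarith) hdn hMq.1 hρ0 hρ1 hθ0 hρθ hMq.2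
  have tsum := (((t0.add t1).add t2).add t3).add t4
  simp only [add_zero] at tsum
  refine tendsto_of_tendsto_of_tendsto_of_le_of_le' tendsto_const_nhds tsum
    (.of_forall fun _ => zero_le) ?_
  filter_upwards [eventually_sparseLimit, hMev] with q hq hMq
  obtain ⟨hn, hd, hdn⟩ := hq
  have hd0 : 0 < q.2 := by linarith
  have haq : 0 < a q := add_pos_of_nonneg_of_pos
    (integral_nonneg fun y => avgExcess_nonneg _) (by positivity)
  have hsq : 0 < s q := by
    have := Real.sqrt_pos.2 haq
    positivity
  have hM8 : M q ^ 8 = q.2 := by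
    rw [show 8 = 4 * 2 from rfl, pow_mul, hMs, Real.sq_sqrt hd0.le]
  -- As `σ` is arbitrary, the bad event need not be measurable; only monotonicity and subadditivity
  -- of the outer measure are used. The inclusion holds almost surely, since the bound on the
  -- entries does.
  refine le_trans (measure_mono_ae ?_) ((measure_union_le _ _).trans (add_le_add_left
    ((measure_union_le _ _).trans (add_le_add_left ((measure_union_le _ _).trans
      (add_le_add_left (measure_union_le _ _) _)) _)) _))
  filter_upwards [ae_sparseLaw (n := q.1) (P := fun t => |t| ≤ √(2 * q.2) * (1 / q.1 + t ^ 2))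
    hd0.le (by linarith) (abs_rescaledEntry_one_le_sq hd0 hdn)
    (abs_rescaledEntry_zero_le_sq hd0 hdn)] with y hy hbad
  by_contra hgood
  have hbad' : objective (symMatrix y) (σ q.1 (evalVec (p q.1) y) (symMatrix y)) < P - ε := hbad
  have hgood' : ¬ ((((objective (symMatrix y) (evalVec (p q.1) y) < P - ε / 2 ∨
      θ < linearError (s q) y (evalVec (p q.1) y)) ∨ θ < tailError q.2 y (evalVec (p q.1) y)) ∨
      ρ < avgExcess (evalVec (p q.1) y)) ∨ ∃ u v : Fin q.1 → ℝ, AdmissiblePair (M q) ρ u v ∧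
        θ * q.1 < u ⬝ᵥ (symMatrix y).mulVec v) := hgood
  push Not at hgood'
  obtain ⟨⟨⟨⟨g0, g1⟩, g2⟩, g3⟩, g4⟩ := hgood'
  -- The loss is at most `3 * θ / 2 = 3 * ε / 8`, which together with `ε / 2` stays below `ε`.
  have := objective_sub_le hn hd0 hMq.1 hM8 hsq hy hρ1 g3 g4
    (hσ q.1 (evalVec (p q.1) y) (symMatrix y) (symMatrix_isSymm y) (symMatrix_diag y)).quad_le
  linarith

end RoundingLimit

end

theorem theorem2p1 (Δ : ℕ) (c P : ℝ)
    (p : ∀ n : ℕ, Fin n → MvPolynomial (Edge n) ℝ)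
    (htree : ∀ (n : ℕ) (i : Fin n), IsTreePoly Δ (p n i))
    (hcoeff : ∀ (n : ℕ) (i : Fin n), (coeffNorm (p n i) : ℝ) ≤ c)
    (hnode : ∀ (n : ℕ) (i : Fin n), PolyContains i (p n i))
    (hobj : PLimGe atTop goeLaw
      (fun n x => objective (symMatrix x) (evalVec (p n) x)) P)
    (hbox : PLimEq atTop goeLaw
      (fun n x => distCube (evalVec (p n) x) / √(n : ℝ)) 0) :
    PLimGe sparseLimit (fun q => sparseLaw q.1 q.2)
      (fun q y => objective (symMatrix y) (evalVec (p q.1) y)) P ∧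
    PLimEq sparseLimit (fun q => sparseLaw q.1 q.2)
      (fun q y => distCube (evalVec (p q.1) y) / √(q.1 : ℝ)) 0 ∧
    ∀ σ : ∀ n : ℕ, (Fin n → ℝ) → Matrix (Fin n) (Fin n) ℝ → (Fin n → ℝ),
      IsRoundingOperator σ →
        PLimGe sparseLimit (fun q => sparseLaw q.1 q.2)
          (fun q y => objective (symMatrix y)
            (σ q.1 (evalVec (p q.1) y) (symMatrix y))) P := by
  have hp : ∀ n, IsTreeVec Δ c (p n) := fun n => ⟨htree n, hcoeff n, hnode n⟩
  have hobj' := plimGe_objective hp hobj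
  have hlim := tendsto_integral_avgExcess hp hbox
  exact ⟨hobj', plimEq_distCube hlim, fun σ hσ => plimGe_rounding hp hlim hobj' hσ⟩
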